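/- Let $k$ be a field and let $(H,R)$ be a quasitriangular Hopf algebra over $k$ which is elementary, i.e. $H$ is finite-dimensional and all simple $H$-modules are one-dimensional. (Quasitriangular means that $R\in H\otimes H$ is invertible, $(\Delta\otimes\mathrm{id})(R)=R_{13}R_{23}$, $(\mathrm{id}\otimes\Delta)(R)=R_{13}R_{12}$ and $\Delta^{o}(h)R=R\Delta(h)$ for all $h\in H$.) Let $J$ be the Jacobson radical of $H$, let $\operatorname{gr}(H)=\bigoplus_{n\ge 0}J^n/J^{n+1}$ be the radically graded version of $H$, with the induced Hopf algebra structure, and let $\operatorname{gr}(R)$ be the image of $R$ in $H/J\otimes H/J\subseteq \operatorname{gr}(H)\otimes\operatorname{gr}(H)$. Then $(\operatorname{gr}(H),\operatorname{gr}(R))$ is a graded quasitriangular Hopf algebra. For a finite group $G$ and a ramification datum $S=\sum_C S_C\,C$ (a formal sum over the conjugacy classes $C$ of $G$ with $S_C\in\mathbb N$), the Hopf quiver $Q(G,S)$ has vertex set $G$ and, for each $x\in G$ and $c\in C$, exactly $S_C$ arrows from $x$ to $cx$. The path algebra $kQ^a$ of a finite quiver $Q$ has the paths of $Q$ as a basis,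 multiplication by concatenation, and grading by path length; an ideal $I$ of $kQ^a$ is admissible if $\mathfrak a^m\subseteq I\subseteq\mathfrak a^2$ for some $m\ge2$, where $\mathfrak a$ is the ideal spanned by the paths of length at least $1$. Say that $Q$ presents $(\operatorname{gr}(H),\operatorname{gr}(R))$ if there are a graded Hopf algebra structure on $kQ^a$, a universal $R$-matrix $\mathfrak R$ for it, and an admissible Hopf ideal $I$ such that $kQ^a/I\cong\operatorname{gr}(H)$ as graded Hopf algebras, by an isomorphism which takes the image of $\mathfrak R$ to $\operatorname{gr}(R)$. There exist a finite abelian group $G$ and a ramification datum $S$ of $G$ such that $Q(H)=Q(G,S)$ presents $(\operatorname{gr}(H),\operatorname{gr}(R))$; moreover the presentation can be chosen such that $\mathfrak R\in kQ_0\otimes kQ_0$ and such that the degree-$0$ part of $kQ(G,S)^a$ is the dual $(kG)^*$ of the group algebra, the vertices being the basis dual to $G$. The quiver is unique. If a Hopf quiver $Q(G',S')$, with $G'$ any finite group, presents $(\operatorname{gr}(H),\operatorname{gr}(R))$, then $Q(G',S')$ and $Q(G,S)$ are isomorphic quivers. If it has a presentation in which the degree-$0$ part of $kQ(G',S')^a$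 is $(kG')^*$, with the vertices as the basis dual to $G'$, then there is a group isomorphism $G\to G'$ which takes $S$ to $S'$. -/

import Mathlib

universe u v w

open scoped TensorProduct DirectSum

/-! ### Hopf algebras -/

section HopfAlgebras

/-- A Hopf algebra structure on a given (fixed) `k`-algebra `A`: a comultiplication and a counit
that are algebra homomorphisms, and an antipode. -/
structure HopfStructure (k A : Type*) [CommRing k] [Ring A] [Algebra k A] where
  /-- the comultiplication -/
  comul : A →ₐ[k] A ⊗[k] A
  /-- the counit -/
  counit : A →ₐ[k] k
  /-- the antipode -/
  antipode : A →ₗ[k] A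
  coassoc : (Algebra.TensorProduct.assoc k k k A A A).toAlgHom.comp
      ((Algebra.TensorProduct.map comul (.id k A)).comp comul)
      = (Algebra.TensorProduct.map (.id k A) comul).comp comul
  counit_left : (Algebra.TensorProduct.map counit (.id k A)).comp comul
      = (Algebra.TensorProduct.lid k A).symm
  counit_right : (Algebra.TensorProduct.map (.id k A) counit).comp comul
      = (Algebra.TensorProduct.rid k k A).symm
  antipode_left : ∀ a : A, LinearMap.mul' k A (antipode.rTensor A (comul a)) =
      algebraMap k A (counit a)
  antipode_right : ∀ a : A, LinearMap.mul' k A (antipode.lTensor A (comul a)) =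
      algebraMap k A (counit a)

/-- The Mathlib Hopf algebra given by a Hopf structure; its underlying algebra is the given one. -/
@[reducible] noncomputable def HopfStructure.toHopfAlgebra {k A : Type*} [CommRing k] [Ring A]
    [Algebra k A] (h : HopfStructure k A) : HopfAlgebra k A where
  toBialgebra := Bialgebra.ofAlgHom h.comul h.counit h.coassoc h.counit_left h.counit_right
  antipode := h.antipode
  mul_antipode_rTensor_comul := LinearMap.ext h.antipode_left
  mul_antipode_lTensor_comul := LinearMap.ext h.antipode_right

/-- `R` is a universal `R`-matrix of the Hopf algebra `H`, that is, `(H, R)` is a quasitriangular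
Hopf algebra: `R` is invertible, `(Δ ⊗ id)(R) = R₁₃ R₂₃`, `(id ⊗ Δ)(R) = R₁₃ R₁₂`, and
`Δᵒ(h) R = R Δ(h)` for all `h`. -/
structure IsUniversalRMatrix (k H : Type*) [CommRing k] [Ring H] [HopfAlgebra k H]
    (R : H ⊗[k] H) : Prop where
  isUnit : IsUnit R
  comul_left :
    Algebra.TensorProduct.map (Bialgebra.comulAlgHom k H) (AlgHom.id k H) R =
      Algebra.TensorProduct.map
          (Algebra.TensorProduct.includeLeft : H →ₐ[k] H ⊗[k] H) (AlgHom.id k H) R *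
        Algebra.TensorProduct.map
          (Algebra.TensorProduct.includeRight : H →ₐ[k] H ⊗[k] H) (AlgHom.id k H) R
  comul_right :
    Algebra.TensorProduct.map (AlgHom.id k H) (Bialgebra.comulAlgHom k H) R =
      Algebra.TensorProduct.map (AlgHom.id k H)
          (Algebra.TensorProduct.includeRight : H →ₐ[k] H ⊗[k] H) R *
        Algebra.TensorProduct.map (AlgHom.id k H)
          (Algebra.TensorProduct.includeLeft : H →ₐ[k] H ⊗[k] H) R
  comul_op_mul : ∀ h : H,
    TensorProduct.comm k H H (Coalgebra.comul h) * R = R * Coalgebra.comul h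

/-- The degree-`n` part `∑_{i + j = n} 𝒜 i ⊗ 𝒜 j` of `A ⊗ A`, where `𝒜 i` is the degree-`i` part
of `A`. -/
def tensorPiece {k A : Type*} [CommRing k] [Ring A] [Algebra k A] (𝒜 : ℕ → Submodule k A)
    (n : ℕ) : Submodule k (A ⊗[k] A) :=
  Submodule.span k {u | ∃ i j : ℕ, i + j = n ∧ ∃ a ∈ 𝒜 i, ∃ b ∈ 𝒜 j, a ⊗ₜ[k] b = u}

/-- `𝒜` is a grading of the Hopf algebra `A`: `A = ⨁ 𝒜 n` is a graded algebra, and the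
comultiplication, the counit and the antipode are homogeneous of degree `0`. -/
structure IsGradedHopf (k : Type*) {A : Type*} [CommRing k] [Ring A] [HopfAlgebra k A]
    (𝒜 : ℕ → Submodule k A) : Prop where
  isInternal : DirectSum.IsInternal 𝒜
  one_mem : (1 : A) ∈ 𝒜 0
  mul_mem : ∀ i j : ℕ, ∀ a ∈ 𝒜 i, ∀ b ∈ 𝒜 j, a * b ∈ 𝒜 (i + j)
  comul_mem : ∀ n : ℕ, ∀ a ∈ 𝒜 n, Coalgebra.comul (R := k) a ∈ tensorPiece 𝒜 n
  counit_eq_zero : ∀ n : ℕ, n ≠ 0 → ∀ a ∈ 𝒜 n, Coalgebra.counit (R := k) a = 0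
  antipode_mem : ∀ n : ℕ, ∀ a ∈ 𝒜 n, HopfAlgebra.antipode k a ∈ 𝒜 n

end HopfAlgebras

/-! ### Quivers and path algebras -/

section PathAlgebras

/-- Two quivers are isomorphic: there are compatible bijections of vertices and of arrows. -/
def QuiverIsomorphic (V W : Type*) [Quiver V] [Quiver W] : Prop :=
  ∃ e : V ≃ W, ∀ x y : V, Nonempty ((x ⟶ y) ≃ (e x ⟶ e y))

/-- The vertex set `G` of the Hopf quiver `Q(G, S)`, where the ramification datum
`S = ∑_C S_C C` is given by its coefficients. -/
def HopfQuiver {G : Type*} [Group G] (_S : ConjClasses G → ℕ) : Type _ := G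

/-- In `Q(G, S)` there are `S_C` arrows from `x` to `c x` for each `x ∈ G`, each conjugacy class
`C` and each `c ∈ C`, and no other arrows: the number of arrows from `x` to `y` is `S_C` for the
class `C` of `y x⁻¹`. -/
instance HopfQuiver.instQuiver {G : Type*} [Group G] (S : ConjClasses G → ℕ) :
    Quiver (HopfQuiver S) where
  Hom := fun x y : G => Fin (S (ConjClasses.mk (y * x⁻¹)))

instance HopfQuiver.instFintype {G : Type*} [Group G] [h : Fintype G] (S : ConjClasses G → ℕ) :
    Fintype (HopfQuiver S) := h

/-- A path of a quiver, with its source `p.1` and its target `p.2.1`. -/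
abbrev QuiverPath (V : Type*) [Quiver V] := Σ a : V, Σ b : V, Quiver.Path a b

/-- The path algebra of the quiver `V`: the vector space with basis the paths of `V`. -/
def PathAlgebra (k V : Type*) [Field k] [Quiver V] := QuiverPath V →₀ k

namespace PathAlgebra

variable (k : Type*) {V : Type*} [Field k] [Quiver V]

noncomputable instance : AddCommGroup (PathAlgebra k V) :=
  inferInstanceAs (AddCommGroup (QuiverPath V →₀ k))

noncomputable instance : Module k (PathAlgebra k V) :=
  inferInstanceAs (Module k (QuiverPath V →₀ k))

/-- The basis element given by a path. -/
noncomputable def single (p : QuiverPath V) : PathAlgebra k V := Finsupp.single p (1 : k)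

/-- The idempotent (trivial path) at a vertex. -/
noncomputable def vertex (v : V) : PathAlgebra k V := single k ⟨v, v, Quiver.Path.nil⟩

open Classical in
/-- The product `p · q` of two paths is the path "first `q`, then `p`" if the target of `q` is the
source of `p`, and `0` otherwise. -/
noncomputable def concat (p q : QuiverPath V) : PathAlgebra k V :=
  if h : q.2.1 = p.1 then single k ⟨q.1, p.2.1, (q.2.2.cast rfl h).comp p.2.2⟩ else 0

/-- Bilinear extension of the concatenation of paths. -/
noncomputable def mulLin : PathAlgebra k V →ₗ[k] PathAlgebra k V →ₗ[k] PathAlgebra k V :=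
  Finsupp.linearCombination k
    (fun p : QuiverPath V => (Finsupp.linearCombination k (fun q : QuiverPath V => concat k p q) :
      PathAlgebra k V →ₗ[k] PathAlgebra k V))

noncomputable instance : Mul (PathAlgebra k V) := ⟨fun f g => mulLin k f g⟩

noncomputable instance [Fintype V] : One (PathAlgebra k V) := ⟨∑ v : V, vertex k v⟩

variable {k}

@[elab_as_elim]
theorem induction_basis {C : PathAlgebra k V → Prop} (f : PathAlgebra k V) (zero : C 0)
    (add : ∀ f g, C f → C g → C (f + g)) (smul : ∀ (a : k) (f), C f → C (a • f))
    (single : ∀ p, C (single k p)) : C f :=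
  Finsupp.induction_linear f zero add fun p a => by
    have h : a • PathAlgebra.single k p = (Finsupp.single p a : QuiverPath V →₀ k) := by
      rw [← mul_one a, ← smul_eq_mul, ← Finsupp.smul_single, smul_eq_mul, mul_one]; rfl
    exact h ▸ smul a _ (single p)

theorem mul_def (f g : PathAlgebra k V) : f * g = mulLin k f g := rfl

theorem single_mul_single (p q : QuiverPath V) :
    single k p * single k q = concat k p q := by
  rw [mul_def, mulLin, single, single]
  erw [Finsupp.linearCombination_single, one_smul, Finsupp.linearCombination_single, one_smul]

theorem concat_of_eq {a b c : V} (p : Quiver.Path b c) (q : Quiver.Path a b) :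
    concat k (⟨b, c, p⟩ : QuiverPath V) ⟨a, b, q⟩ = single k ⟨a, c, q.comp p⟩ := by
  simp [concat]

theorem concat_of_ne {p q : QuiverPath V} (h : q.2.1 ≠ p.1) : concat k p q = 0 := by
  simp [concat, h]

theorem single_assoc (p q r : QuiverPath V) :
    mulLin k (concat k p q) (single k r) = mulLin k (single k p) (concat k q r) := by
  obtain ⟨a, b, p⟩ := p
  obtain ⟨c, d, q⟩ := q
  obtain ⟨e, f, r⟩ := r
  by_cases h₁ : d = a
  · subst h₁
    by_cases h₂ : f = c
    · subst h₂
      rw [concat_of_eq, concat_of_eq, ← mul_def, ← mul_def, single_mul_single,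
        single_mul_single, concat_of_eq, concat_of_eq, Quiver.Path.comp_assoc]
    · rw [concat_of_eq, concat_of_ne (p := ⟨c, d, q⟩) (q := ⟨e, f, r⟩) h₂, ← mul_def,
        single_mul_single, concat_of_ne (q := ⟨e, f, r⟩) h₂, map_zero]
  · rw [concat_of_ne (p := ⟨a, b, p⟩) (q := ⟨c, d, q⟩) h₁, map_zero, LinearMap.zero_apply]
    by_cases h₂ : f = c
    · subst h₂
      rw [concat_of_eq, ← mul_def, single_mul_single, concat_of_ne (p := ⟨a, b, p⟩) h₁]
    · rw [concat_of_ne (p := ⟨c, d, q⟩) (q := ⟨e, f, r⟩) h₂, map_zero]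


theorem assoc_aux (f g h : PathAlgebra k V) : f * g * h = f * (g * h) := by
  simp only [mul_def]
  induction f using induction_basis with
  | zero => simp
  | add f f' hf hf' => simp only [map_add, LinearMap.add_apply, hf, hf']
  | smul a f hf => simp only [map_smul, LinearMap.smul_apply, hf]
  | single p =>
    induction g using induction_basis with
    | zero => simp
    | add f f' hf hf' => simp only [map_add, LinearMap.add_apply, hf, hf']
    | smul a f hf => simp only [map_smul, LinearMap.smul_apply, hf]
    | single q =>
      induction h using induction_basis with
      | zero => simp
      | add f f' hf hf' => simp only [map_add, hf, hf']
      | smul a f hf => simp only [map_smul, hf]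
      | single r =>
        rw [← mul_def (single k p) (single k q), ← mul_def (single k q) (single k r),
          single_mul_single, single_mul_single, single_assoc]

theorem vertex_mul_single [DecidableEq V] (v : V) (p : QuiverPath V) :
    mulLin k (vertex k v) (single k p) = if v = p.2.1 then single k p else 0 := by
  obtain ⟨a, b, p⟩ := p
  rw [← mul_def, vertex, single_mul_single]
  by_cases h : v = b
  · subst h
    rw [concat_of_eq, Quiver.Path.comp_nil, if_pos rfl]
  · rw [concat_of_ne (q := ⟨a, b, p⟩) (Ne.symm h), if_neg h]

theorem single_mul_vertex [DecidableEq V] (v : V) (p : QuiverPath V) :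
    mulLin k (single k p) (vertex k v) = if v = p.1 then single k p else 0 := by
  obtain ⟨a, b, p⟩ := p
  rw [← mul_def, vertex, single_mul_single]
  by_cases h : v = a
  · subst h
    rw [concat_of_eq, Quiver.Path.nil_comp, if_pos rfl]
  · rw [concat_of_ne (p := ⟨a, b, p⟩) h, if_neg h]

theorem one_mul_aux [Fintype V] (f : PathAlgebra k V) : 1 * f = f := by
  classical
  change mulLin k (∑ v : V, vertex k v) f = f
  induction f using induction_basis with
  | zero => simp
  | add f f' hf hf' => simp only [map_add, hf, hf']
  | smul a f hf => simp only [map_smul, hf]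
  | single p => simp [vertex_mul_single]

theorem mul_one_aux [Fintype V] (f : PathAlgebra k V) : f * 1 = f := by
  classical
  change mulLin k f (∑ v : V, vertex k v) = f
  induction f using induction_basis with
  | zero => simp
  | add f f' hf hf' => rw [map_add, LinearMap.add_apply, hf, hf']
  | smul a f hf => rw [map_smul, LinearMap.smul_apply, hf]
  | single p => simp [single_mul_vertex]

noncomputable instance [Fintype V] : Ring (PathAlgebra k V) where
  __ := (inferInstance : AddCommGroup (PathAlgebra k V))
  mul_assoc := assoc_aux
  one_mul := one_mul_aux
  mul_one := mul_one_aux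
  zero_mul f := by rw [mul_def, map_zero, LinearMap.zero_apply]
  mul_zero f := by rw [mul_def, map_zero]
  left_distrib f g h := by simp only [mul_def, map_add]
  right_distrib f g h := by simp only [mul_def, map_add, LinearMap.add_apply]

noncomputable instance [Fintype V] : Algebra k (PathAlgebra k V) :=
  Algebra.ofModule
    (fun a f g => by simp only [mul_def, map_smul, LinearMap.smul_apply])
    (fun a f g => by simp only [mul_def, map_smul])

variable (k V)

/-- The degree-`n` part of the path algebra: the span of the paths of length `n`. -/
noncomputable def grading (n : ℕ) : Submodule k (PathAlgebra k V) :=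
  Submodule.span k (single k '' {p : QuiverPath V | p.2.2.length = n})

/-- The arrow ideal: the span of all paths of length at least `1`. -/
noncomputable def arrowIdeal : Submodule k (PathAlgebra k V) :=
  Submodule.span k (single k '' {p : QuiverPath V | 1 ≤ p.2.2.length})

/-- An ideal `I` is admissible if `J ^ m ⊆ I ⊆ J ^ 2` for some `m ≥ 2`, where `J` is the arrow
ideal. -/
def IsAdmissible [Fintype V] (I : Ideal (PathAlgebra k V)) : Prop :=
  ∃ m : ℕ, 2 ≤ m ∧ arrowIdeal k V ^ m ≤ I.restrictScalars k ∧
    I.restrictScalars k ≤ arrowIdeal k V ^ 2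

end PathAlgebra

/-- A presentation of the graded quasitriangular Hopf algebra `(B, RB)`, with grading `ℬ`, by the
finite quiver `V`: a quasitriangular graded Hopf algebra structure on the path algebra of `V`
(graded by length), an admissible Hopf ideal `I` of it, and an isomorphism from the quotient by
`I`, with the structure induced by the quotient map, onto `(B, RB)`. -/
structure QuiverPresentation (k : Type*) {B : Type*} [Field k] [Ring B] [HopfAlgebra k B]
    (ℬ : ℕ → Submodule k B) (RB : B ⊗[k] B) (V : Type*) [Quiver V] [Fintype V] where
  /-- the Hopf algebra structure on the path algebra -/
  hopf : HopfStructure k (PathAlgebra k V)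
  isGradedHopf :
    letI := hopf.toHopfAlgebra
    IsGradedHopf k (PathAlgebra.grading k V)
  /-- the universal `R`-matrix of the path algebra -/
  rMatrix : PathAlgebra k V ⊗[k] PathAlgebra k V
  isUniversalRMatrix :
    letI := hopf.toHopfAlgebra
    IsUniversalRMatrix k (PathAlgebra k V) rMatrix
  /-- the ideal of relations -/
  I : Ideal (PathAlgebra k V)
  isTwoSided : I.IsTwoSided
  isHopfIdeal :
    letI := hopf.toHopfAlgebra
    I.IsHopfIdeal k
  isAdmissible : PathAlgebra.IsAdmissible k V I
  /-- the isomorphism of Hopf algebras -/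
  iso :
    letI := hopf.toHopfAlgebra
    (PathAlgebra k V ⧸ I) ≃ₐc[k] B
  map_grading : ∀ n : ℕ,
    (fun f : PathAlgebra k V => iso (Ideal.Quotient.mk I f)) ''
      (PathAlgebra.grading k V n : Set (PathAlgebra k V)) = ℬ n
  map_rMatrix :
    letI := hopf.toHopfAlgebra
    TensorProduct.map
      ((iso : (PathAlgebra k V ⧸ I) →ₐc[k] B) : (PathAlgebra k V ⧸ I) →ₗ[k] B)
      ((iso : (PathAlgebra k V ⧸ I) →ₐc[k] B) : (PathAlgebra k V ⧸ I) →ₗ[k] B)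
      (TensorProduct.map (Ideal.Quotient.mkₐ k I).toLinearMap
        (Ideal.Quotient.mkₐ k I).toLinearMap rMatrix) = RB

/-- The degree-`0` part of the Hopf algebra of a presentation by a Hopf quiver `Q(G, S)` is the
dual `(kG)*` of the group algebra, the vertices being the basis dual to `G`:
`Δ(e_g) = ∑_{x y = g} e_x ⊗ e_y` and `ε(e_g) = δ_{g, 1}`. -/
def QuiverPresentation.IsDualGroupAlgebra {k B : Type*} [Field k] [Ring B] [HopfAlgebra k B]
    {ℬ : ℕ → Submodule k B} {RB : B ⊗[k] B} {G : Type*} [Group G] [Fintype G]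
    {S : ConjClasses G → ℕ} (P : QuiverPresentation k ℬ RB (HopfQuiver S)) : Prop :=
  (∀ g : G, P.hopf.comul (PathAlgebra.vertex k (V := HopfQuiver S) g) =
    ∑ x : G, PathAlgebra.vertex k (V := HopfQuiver S) x ⊗ₜ[k]
      PathAlgebra.vertex k (V := HopfQuiver S) (x⁻¹ * g : G)) ∧
  P.hopf.counit (PathAlgebra.vertex k (V := HopfQuiver S) (1 : G)) = 1 ∧
  ∀ g : G, g ≠ 1 → P.hopf.counit (PathAlgebra.vertex k (V := HopfQuiver S) g) = 0

end PathAlgebras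

/-! ### Elementary Hopf algebras and their radically graded versions -/

section RadicallyGraded

set_option linter.unusedSectionVars false

/-- The algebra `H` is elementary: it is finite-dimensional over `k` and all of its simple modules
are one-dimensional. -/
class IsElementary (k : Type*) (H : Type u) [Field k] [Ring H] [Algebra k H] : Prop where
  finiteDimensional : FiniteDimensional k H
  finrank_simple : ∀ (M : Type u) [AddCommGroup M] [Module k M] [Module H M]
    [IsScalarTower k H M] [IsSimpleModule H M], Module.finrank k M = 1

/-- The `n`-th power `J ^ n` of the Jacobson radical `J` of `H`, as a subspace; `J ^ 0 = H`. -/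
noncomputable def radPow (k H : Type*) [Field k] [Ring H] [Algebra k H] (n : ℕ) :
    Submodule k H :=
  ((Ring.jacobson H) ^ n).restrictScalars k

/-- The quotient `J ^ n / J ^ (n + 1)`. -/
def GrPiece (k H : Type*) [Field k] [Ring H] [Algebra k H] (n : ℕ) : Type _ :=
  ↥(radPow k H n) ⧸ (radPow k H (n + 1)).submoduleOf (radPow k H n)

noncomputable instance (k H : Type*) [Field k] [Ring H] [Algebra k H] (n : ℕ) :
    AddCommGroup (GrPiece k H n) :=
  inferInstanceAs (AddCommGroup (↥(radPow k H n) ⧸ (radPow k H (n + 1)).submoduleOf _))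

noncomputable instance (k H : Type*) [Field k] [Ring H] [Algebra k H] (n : ℕ) :
    Module k (GrPiece k H n) :=
  inferInstanceAs (Module k (↥(radPow k H n) ⧸ (radPow k H (n + 1)).submoduleOf _))

/-- The radically graded version `gr H = ⨁ₙ J ^ n / J ^ (n + 1)`, with `J` the Jacobson radical. -/
abbrev Gr (k H : Type*) [Field k] [Ring H] [Algebra k H] : Type _ := ⨁ n : ℕ, GrPiece k H n

section Algebra

variable {k H : Type*} [Field k] [Ring H] [Algebra k H]

theorem radPow_zero : radPow k H 0 = ⊤ := by
  ext x; simp [radPow, Submodule.pow_zero, Ideal.one_eq_top]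

theorem mem_radPow_zero (x : H) : x ∈ radPow k H 0 := by
  rw [radPow_zero]; trivial

theorem mem_radPow_one {x : H} : x ∈ radPow k H 1 ↔ x ∈ Ring.jacobson H := by
  simp [radPow, Submodule.pow_one]

theorem radPow_mul {i j : ℕ} {x y : H} (hx : x ∈ radPow k H i) (hy : y ∈ radPow k H j) :
    x * y ∈ radPow k H (i + j) := by
  change x * y ∈ (Ring.jacobson H) ^ (i + j)
  rcases Nat.eq_zero_or_pos j with rfl | hj
  · exact Ideal.mul_mem_right _ _ hx
  · rw [Submodule.pow_add _ hj.ne']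
    exact Ideal.mul_mem_mul hx hy

theorem radPow_anti {i j : ℕ} (h : i ≤ j) : radPow k H j ≤ radPow k H i :=
  fun _ hx => Ideal.pow_le_pow_right h hx

/-- The class in `J ^ n / J ^ (n + 1)` of an element of `J ^ n`. -/
noncomputable def GrPiece.mk (n : ℕ) (x : H) (hx : x ∈ radPow k H n) : GrPiece k H n :=
  Submodule.Quotient.mk ⟨x, hx⟩

/-- The map on `J ^ n / J ^ (n + 1)` induced by a linear map on `J ^ n` which vanishes on
`J ^ (n + 1)`. -/
noncomputable def GrPiece.lift {M : Type*} [AddCommGroup M] [Module k M] (n : ℕ)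
    (f : ↥(radPow k H n) →ₗ[k] M) (hf : ∀ x, x.1 ∈ radPow k H (n + 1) → f x = 0) :
    GrPiece k H n →ₗ[k] M :=
  Submodule.liftQ ((radPow k H (n + 1)).submoduleOf (radPow k H n)) f fun x hx => hf x hx

theorem GrPiece.lift_mk {M : Type*} [AddCommGroup M] [Module k M] {n : ℕ}
    (f : ↥(radPow k H n) →ₗ[k] M) (hf : ∀ x, x.1 ∈ radPow k H (n + 1) → f x = 0) {x : H}
    (hx : x ∈ radPow k H n) : GrPiece.lift n f hf (GrPiece.mk n x hx) = f ⟨x, hx⟩ := rfl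

theorem GrPiece.mk_eq {n : ℕ} {x y : H} (hx : x ∈ radPow k H n) (hy : y ∈ radPow k H n)
    (h : x - y ∈ radPow k H (n + 1)) : GrPiece.mk (k := k) n x hx = GrPiece.mk n y hy :=
  (Submodule.Quotient.eq _).mpr h

theorem GrPiece.ind {n : ℕ} {C : GrPiece k H n → Prop} (h : ∀ x hx, C (GrPiece.mk n x hx))
    (a : GrPiece k H n) : C a := by
  obtain ⟨⟨x, hx⟩, rfl⟩ := Submodule.Quotient.mk_surjective _ a
  exact h x hx

theorem GrPiece.sigma_eq {m n : ℕ} (h : m = n) {x y : H} (hx : x ∈ radPow k H m)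
    (hy : y ∈ radPow k H n) (hxy : x = y) :
    (GradedMonoid.mk m (GrPiece.mk m x hx) : GradedMonoid (GrPiece k H)) =
      GradedMonoid.mk n (GrPiece.mk n y hy) := by
  subst h; subst hxy; rfl

/-- The product `(x + J ^ (i + 1)) (y + J ^ (j + 1)) = x y + J ^ (i + j + 1)`. -/
noncomputable def GrPiece.mul {i j : ℕ} (a : GrPiece k H i) (b : GrPiece k H j) : GrPiece k H (i + j) :=
  Quotient.liftOn₂' a b (fun x y => GrPiece.mk (i + j) (x.1 * y.1) (radPow_mul x.2 y.2)) <| by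
    intro x y x' y' hx hy
    rw [Submodule.quotientRel_def] at hx hy
    apply GrPiece.mk_eq
    have e : x.1 * y.1 - x'.1 * y'.1 = (x.1 - x'.1) * y.1 + x'.1 * (y.1 - y'.1) := by
      noncomm_ring
    rw [e]
    refine Submodule.add_mem _ ?_ ?_
    · have := radPow_mul (k := k) (i := i + 1) (j := j) (x := x.1 - x'.1) (y := y.1) hx y.2
      rwa [show i + 1 + j = i + j + 1 by omega] at this
    · exact radPow_mul (k := k) (i := i) (j := j + 1) (x := x'.1) (y := y.1 - y'.1) x'.2 hy

theorem GrPiece.mk_mul_mk {i j : ℕ} {x y : H} (hx : x ∈ radPow k H i) (hy : y ∈ radPow k H j) :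
    GrPiece.mul (GrPiece.mk i x hx) (GrPiece.mk j y hy) =
      GrPiece.mk (k := k) (i + j) (x * y) (radPow_mul hx hy) := rfl

theorem GrPiece.mk_add_mk {n : ℕ} {x y : H} (hx : x ∈ radPow k H n) (hy : y ∈ radPow k H n) :
    GrPiece.mk n x hx + GrPiece.mk n y hy =
      GrPiece.mk (k := k) n (x + y) (Submodule.add_mem _ hx hy) := rfl

theorem GrPiece.smul_mk {n : ℕ} (c : k) {x : H} (hx : x ∈ radPow k H n) :
    c • GrPiece.mk n x hx = GrPiece.mk (k := k) n (c • x) (Submodule.smul_mem _ c hx) := rfl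

theorem GrPiece.mk_eq_zero {n : ℕ} {x : H} (hx : x ∈ radPow k H n)
    (h : x ∈ radPow k H (n + 1)) : GrPiece.mk (k := k) n x hx = 0 :=
  GrPiece.mk_eq hx (Submodule.zero_mem _) (by simpa using h)

noncomputable instance : GradedMonoid.GMul (GrPiece k H) := ⟨GrPiece.mul⟩

noncomputable instance : GradedMonoid.GOne (GrPiece k H) := ⟨GrPiece.mk 0 1 (mem_radPow_zero 1)⟩

noncomputable instance : DirectSum.GRing (GrPiece k H) where
  mul_zero {i j} a := by
    induction a using GrPiece.ind with | h x hx
    exact (GrPiece.mk_eq_zero (radPow_mul hx (Submodule.zero_mem _))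
      (by rw [mul_zero]; exact Submodule.zero_mem _))
  zero_mul {i j} b := by
    induction b using GrPiece.ind with | h x hx
    exact (GrPiece.mk_eq_zero (radPow_mul (Submodule.zero_mem _) hx)
      (by rw [zero_mul]; exact Submodule.zero_mem _))
  mul_add {i j} a b c := by
    induction a using GrPiece.ind with | h x hx
    induction b using GrPiece.ind with | h y hy
    induction c using GrPiece.ind with | h z hz
    exact GrPiece.mk_eq _ _ (by simp [mul_add])
  add_mul {i j} a b c := by
    induction a using GrPiece.ind with | h x hx
    induction b using GrPiece.ind with | h y hy
    induction c using GrPiece.ind with | h z hz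
    exact GrPiece.mk_eq _ _ (by simp [add_mul])
  one_mul := by
    rintro ⟨i, a⟩
    induction a using GrPiece.ind with | h x hx
    exact GrPiece.sigma_eq (zero_add i) _ _ (one_mul x)
  mul_one := by
    rintro ⟨i, a⟩
    induction a using GrPiece.ind with | h x hx
    exact GrPiece.sigma_eq (add_zero i) _ _ (mul_one x)
  mul_assoc := by
    rintro ⟨i, a⟩ ⟨j, b⟩ ⟨l, c⟩
    induction a using GrPiece.ind with | h x hx
    induction b using GrPiece.ind with | h y hy
    induction c using GrPiece.ind with | h z hz
    exact GrPiece.sigma_eq (add_assoc i j l) _ _ (mul_assoc x y z)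
  natCast n := GrPiece.mk 0 (n : H) (mem_radPow_zero _)
  natCast_zero := GrPiece.mk_eq_zero _ (by rw [Nat.cast_zero]; exact Submodule.zero_mem _)
  natCast_succ n := GrPiece.mk_eq _ _ (by simp)
  intCast n := GrPiece.mk 0 (n : H) (mem_radPow_zero _)
  intCast_ofNat n := GrPiece.mk_eq _ _ (by simp)
  intCast_negSucc_ofNat n := GrPiece.mk_eq _ _ (by simp)

noncomputable instance : DirectSum.GAlgebra k (GrPiece k H) where
  toFun :=
    { toFun := fun c => GrPiece.mk 0 (algebraMap k H c) (mem_radPow_zero _)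
      map_zero' := GrPiece.mk_eq_zero _ (by rw [map_zero]; exact Submodule.zero_mem _)
      map_add' := fun a b => GrPiece.mk_eq _ _ (by simp) }
  map_one := GrPiece.mk_eq _ _ (by simp)
  map_mul a b := GrPiece.sigma_eq rfl _ _ (map_mul _ a b)
  commutes := by
    rintro c ⟨i, a⟩
    induction a using GrPiece.ind with | h x hx
    exact GrPiece.sigma_eq (show 0 + i = i + 0 by simp) _ _ (Algebra.commutes c x)
  smul_def := by
    rintro c ⟨i, a⟩
    induction a using GrPiece.ind with | h x hx
    exact GrPiece.sigma_eq (show i = 0 + i by simp) (Submodule.smul_mem _ c hx) _ (Algebra.smul_def c x)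

variable (k H)

/-- The degree-`n` part of `gr H`. -/
noncomputable def Gr.grading (n : ℕ) : Submodule k (Gr k H) :=
  LinearMap.range (DirectSum.lof k ℕ (GrPiece k H) n)

/-- The symbol map `J ^ n → gr H`, `x ↦ x + J ^ (n + 1)` in degree `n`. -/
noncomputable def Gr.symbol (n : ℕ) : ↥(radPow k H n) →ₗ[k] Gr k H :=
  DirectSum.lof k ℕ (GrPiece k H) n ∘ₗ
    { toFun := fun x => GrPiece.mk n x.1 x.2
      map_add' := fun _ _ => rfl
      map_smul' := fun _ _ => rfl }

/-- The projection `H → H / J` onto the degree-`0` part of `gr H`. -/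
noncomputable def Gr.degreeZero : H →ₗ[k] Gr k H :=
  Gr.symbol k H 0 ∘ₗ LinearMap.id.codRestrict (radPow k H 0) mem_radPow_zero

/-- Any linear extension to `H` of the symbol map `J ^ n → gr H`; only its values on `J ^ n` will
matter. -/
noncomputable def Gr.ext (n : ℕ) : H →ₗ[k] Gr k H :=
  (LinearMap.exists_extend (V' := Gr k H) (Gr.symbol k H n)).choose

variable {k H}

theorem Gr.ext_apply {n : ℕ} {x : H} (hx : x ∈ radPow k H n) :
    Gr.ext k H n x = DirectSum.of (GrPiece k H) n (GrPiece.mk n x hx) :=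
  LinearMap.congr_fun (LinearMap.exists_extend (V' := Gr k H) (Gr.symbol k H n)).choose_spec ⟨x, hx⟩

theorem Gr.ext_eq_zero {n m : ℕ} (h : n < m) {x : H} (hx : x ∈ radPow k H m) :
    Gr.ext k H n x = 0 := by
  rw [Gr.ext_apply (radPow_anti h.le hx), GrPiece.mk_eq_zero _ (radPow_anti h hx), map_zero]

theorem Gr.ext_mul {i j : ℕ} {x y : H} (hx : x ∈ radPow k H i) (hy : y ∈ radPow k H j) :
    Gr.ext k H i x * Gr.ext k H j y = Gr.ext k H (i + j) (x * y) := by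
  rw [Gr.ext_apply hx, Gr.ext_apply hy, Gr.ext_apply (radPow_mul hx hy), DirectSum.of_mul_of]
  rfl

theorem Gr.ext_one : Gr.ext k H 0 1 = 1 := by
  rw [Gr.ext_apply (mem_radPow_zero 1)]; rfl

@[elab_as_elim]
theorem Gr.induction {C : Gr k H → Prop} (a : Gr k H) (zero : C 0)
    (ext : ∀ n x, x ∈ radPow k H n → C (Gr.ext k H n x))
    (add : ∀ a b, C a → C b → C (a + b)) : C a := by
  induction a using DirectSum.induction_on with
  | zero => exact zero
  | of n a =>
    induction a using GrPiece.ind with | h x hx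
    rw [← Gr.ext_apply hx]; exact ext n x hx
  | add a b ha hb => exact add a b ha hb

/-- The filtration `∑_{i + j = n} J ^ i ⊗ J ^ j` of `H ⊗ H`. -/
noncomputable abbrev radTensor (k H : Type*) [Field k] [Ring H] [Algebra k H] (n : ℕ) :
    Submodule k (H ⊗[k] H) := tensorPiece (radPow k H) n

theorem tmul_mem_radTensor {i j n : ℕ} (h : i + j = n) {a b : H} (ha : a ∈ radPow k H i)
    (hb : b ∈ radPow k H j) : a ⊗ₜ[k] b ∈ radTensor k H n :=
  Submodule.subset_span ⟨i, j, h, a, ha, b, hb, rfl⟩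

theorem radTensor_anti {m n : ℕ} (h : m ≤ n) : radTensor k H n ≤ radTensor k H m := by
  refine Submodule.span_le.mpr ?_
  rintro _ ⟨i, j, hij, a, ha, b, hb, rfl⟩
  rcases le_total m i with h' | h'
  · exact tmul_mem_radTensor (add_zero m) (radPow_anti h' ha) (mem_radPow_zero b)
  · exact tmul_mem_radTensor (i := i) (j := m - i) (by omega) ha (radPow_anti (by omega) hb)

theorem radTensor_mul {m n : ℕ} {u v : H ⊗[k] H} (hu : u ∈ radTensor k H m)
    (hv : v ∈ radTensor k H n) : u * v ∈ radTensor k H (m + n) := by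
  induction hu using Submodule.span_induction with
  | zero => rw [zero_mul]; exact Submodule.zero_mem _
  | add x y _ _ hx hy => rw [add_mul]; exact Submodule.add_mem _ hx hy
  | smul c x _ hx => rw [smul_mul_assoc]; exact Submodule.smul_mem _ _ hx
  | mem x hx =>
    obtain ⟨i, j, hij, a, ha, b, hb, rfl⟩ := hx
    induction hv using Submodule.span_induction with
    | zero => rw [mul_zero]; exact Submodule.zero_mem _
    | add x y _ _ hx hy => rw [mul_add]; exact Submodule.add_mem _ hx hy
    | smul c x _ hx => rw [mul_smul_comm]; exact Submodule.smul_mem _ _ hx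
    | mem x hx =>
      obtain ⟨i', j', hij', a', ha', b', hb', rfl⟩ := hx
      rw [Algebra.TensorProduct.tmul_mul_tmul]
      exact tmul_mem_radTensor (by omega) (radPow_mul ha ha') (radPow_mul hb hb')

variable (k H)

/-- The map `H ⊗ H → gr H ⊗ gr H` which sends `x ⊗ y`, for `x ∈ J ^ i`, `y ∈ J ^ j`
and `i + j = n`, to the tensor product of the symbols of `x` and of `y`. -/
noncomputable def Gr.tensorSymbol (n : ℕ) : H ⊗[k] H →ₗ[k] Gr k H ⊗[k] Gr k H :=
  ∑ ij ∈ Finset.HasAntidiagonal.antidiagonal n, TensorProduct.map (Gr.ext k H ij.1) (Gr.ext k H ij.2)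

variable {k H}

theorem Gr.tensorSymbol_tmul {i j n : ℕ} (h : i + j = n) {a b : H} (ha : a ∈ radPow k H i)
    (hb : b ∈ radPow k H j) :
    Gr.tensorSymbol k H n (a ⊗ₜ[k] b) = Gr.ext k H i a ⊗ₜ[k] Gr.ext k H j b := by
  rw [Gr.tensorSymbol, LinearMap.sum_apply,
    Finset.sum_eq_single_of_mem (i, j) (Finset.HasAntidiagonal.mem_antidiagonal.mpr h), TensorProduct.map_tmul]
  rintro ⟨i', j'⟩ h' hne
  rw [Finset.HasAntidiagonal.mem_antidiagonal] at h'
  simp only [ne_eq, Prod.mk.injEq] at h' hne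
  rw [TensorProduct.map_tmul]
  rcases lt_trichotomy i' i with h1 | h1 | h1
  · rw [Gr.ext_eq_zero h1 ha, TensorProduct.zero_tmul]
  · omega
  · rw [Gr.ext_eq_zero (n := j') (m := j) (by omega) hb, TensorProduct.tmul_zero]

theorem Gr.tensorSymbol_eq_zero {m n : ℕ} (h : n < m) {u : H ⊗[k] H}
    (hu : u ∈ radTensor k H m) : Gr.tensorSymbol k H n u = 0 := by
  have hle : radTensor k H m ≤ LinearMap.ker (Gr.tensorSymbol k H n) := by
    refine Submodule.span_le.mpr ?_
    rintro _ ⟨i, j, hij, a, ha, b, hb, rfl⟩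
    rw [SetLike.mem_coe, LinearMap.mem_ker, Gr.tensorSymbol, LinearMap.sum_apply]
    refine Finset.sum_eq_zero ?_
    rintro ⟨i', j'⟩ h'
    rw [Finset.HasAntidiagonal.mem_antidiagonal] at h'
    simp only at h'
    rw [TensorProduct.map_tmul]
    rcases lt_or_ge i' i with h1 | h1
    · rw [Gr.ext_eq_zero h1 ha, TensorProduct.zero_tmul]
    · rw [Gr.ext_eq_zero (n := j') (m := j) (by omega) hb, TensorProduct.tmul_zero]
  exact hle hu

theorem Gr.tensorSymbol_mul {m n : ℕ} {u v : H ⊗[k] H} (hu : u ∈ radTensor k H m)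
    (hv : v ∈ radTensor k H n) :
    Gr.tensorSymbol k H m u * Gr.tensorSymbol k H n v =
      Gr.tensorSymbol k H (m + n) (u * v) := by
  induction hu using Submodule.span_induction with
  | zero => rw [zero_mul, map_zero, zero_mul, map_zero]
  | add x y _ _ hx hy => rw [add_mul, map_add, add_mul, hx, hy, map_add]
  | smul c x _ hx => rw [smul_mul_assoc, map_smul, smul_mul_assoc, hx, map_smul]
  | mem x hx =>
    obtain ⟨i, j, hij, a, ha, b, hb, rfl⟩ := hx
    induction hv using Submodule.span_induction with
    | zero => rw [mul_zero, map_zero, mul_zero, map_zero]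
    | add x y _ _ hx hy => rw [mul_add, map_add, mul_add, hx, hy, map_add]
    | smul c x _ hx => rw [mul_smul_comm, map_smul, mul_smul_comm, hx, map_smul]
    | mem x hx =>
      obtain ⟨i', j', hij', a', ha', b', hb', rfl⟩ := hx
      rw [Algebra.TensorProduct.tmul_mul_tmul, Gr.tensorSymbol_tmul hij ha hb,
        Gr.tensorSymbol_tmul hij' ha' hb', Algebra.TensorProduct.tmul_mul_tmul,
        Gr.tensorSymbol_tmul (i := i + i') (j := j + j') (by omega) (radPow_mul ha ha')
          (radPow_mul hb hb'), Gr.ext_mul ha ha', Gr.ext_mul hb hb']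

end Algebra

section Hopf

variable {k : Type*} {H : Type u} [Field k] [Ring H] [HopfAlgebra k H]

theorem character_eq_zero (χ : H →ₐ[k] k) {x : H} (hx : x ∈ Ring.jacobson H) : χ x = 0 := by
  have : RingHomSurjective (χ : H →+* k) :=
    ⟨fun c => ⟨algebraMap k H c, by simp⟩⟩
  have := Ring.le_comap_jacobson (χ : H →+* k) hx
  have hk : Ring.jacobson k = ⊥ := by
    rw [eq_bot_iff]
    have : (⊥ : Ideal k).IsMaximal := Ideal.bot_isMaximal
    exact Ring.jacobson_le_of_isMaximal _
  rw [hk] at this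
  simpa using this

theorem counit_jacobson {x : H} (hx : x ∈ Ring.jacobson H) : Coalgebra.counit (R := k) x = 0 :=
  character_eq_zero (Bialgebra.counitAlgHom k H) hx

section Characters

variable [IsElementary k H]

/-- Over an elementary algebra, every maximal left ideal is the kernel of a character. -/
theorem exists_character (m : Ideal H) (hm : m.IsMaximal) :
    ∃ χ : H →ₐ[k] k, ∀ x, χ x = 0 ↔ x ∈ m := by
  have : IsSimpleModule H (H ⧸ m) := isSimpleModule_iff_isCoatom.mpr hm.out
  have d1 : Module.finrank k (H ⧸ m) = 1 := IsElementary.finrank_simple (k := k) (H := H) (H ⧸ m)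
  have hex : ∀ x : H, ∃! c : k, Algebra.lsmul k k (H ⧸ m) x = c • LinearMap.id := fun x =>
    LinearMap.existsUnique_eq_smul_id_of_finrank_eq_one d1 _
  choose χ hχ huniq using hex
  simp only at hχ huniq
  let f : H →ₐ[k] k := AlgHom.ofLinearMap
    { toFun := χ
      map_add' := fun x y => (huniq _ _ (by rw [map_add, hχ, hχ, add_smul])).symm
      map_smul' := fun c x => (huniq _ _ (by
        rw [map_smul, hχ, smul_smul]; rfl)).symm }
    (huniq _ _ (by rw [map_one, one_smul]; rfl)).symm
    (fun x y => (huniq _ _ (by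
      rw [map_mul, hχ, hχ, smul_mul_smul_comm]; rfl)).symm)
  refine ⟨f, fun x => ?_⟩
  have key : (Submodule.Quotient.mk x : H ⧸ m) = χ x • Submodule.Quotient.mk (1 : H) := by
    have := LinearMap.congr_fun (hχ x) (Submodule.Quotient.mk (1 : H))
    change x • (Submodule.Quotient.mk (1 : H) : H ⧸ m) =
      χ x • (Submodule.Quotient.mk (1 : H) : H ⧸ m) at this
    rw [← Submodule.Quotient.mk_smul, smul_eq_mul, mul_one] at this
    exact this
  have h1 : (Submodule.Quotient.mk (1 : H) : H ⧸ m) ≠ 0 := by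
    rw [Ne, Submodule.Quotient.mk_eq_zero]
    exact fun h => hm.ne_top ((Ideal.eq_top_iff_one _).mpr h)
  rw [← Submodule.Quotient.mk_eq_zero m, key]
  change χ x = 0 ↔ _
  rw [smul_eq_zero, or_iff_left h1]

theorem mem_jacobson_iff (x : H) : x ∈ Ring.jacobson H ↔ ∀ χ : H →ₐ[k] k, χ x = 0 := by
  refine ⟨fun hx χ => character_eq_zero χ hx, fun h => ?_⟩
  rw [Ring.jacobson_eq_sInf_isMaximal, Submodule.mem_sInf]
  intro m hm
  obtain ⟨χ, hχ⟩ := exists_character (k := k) m hm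
  exact (hχ x).mp (h χ)

theorem antipode_mem_jacobson {x : H} (hx : x ∈ Ring.jacobson H) :
    HopfAlgebra.antipode k x ∈ Ring.jacobson H := by
  rw [mem_jacobson_iff (k := k)]
  intro χ
  let f : H →ₐ[k] k := AlgHom.ofLinearMap (χ.toLinearMap ∘ₗ HopfAlgebra.antipode k)
    (by simp) (fun x y => by simp [HopfAlgebra.antipode_mul_antidistrib, mul_comm])
  exact character_eq_zero f hx

theorem comul_jacobson {x : H} (hx : x ∈ Ring.jacobson H) :
    Coalgebra.comul (R := k) x ∈ radTensor k H 1 := by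
  have : FiniteDimensional k H := IsElementary.finiteDimensional
  let J : Submodule k H := (Ring.jacobson H).restrictScalars k
  let W : Submodule k (Module.Dual k H) :=
    Submodule.span k (Set.range fun χ : H →ₐ[k] k => χ.toLinearMap)
  have hJ : W.dualCoannihilator = J := by
    ext y
    rw [Submodule.mem_dualCoannihilator]
    change _ ↔ y ∈ Ring.jacobson H
    rw [mem_jacobson_iff (k := k)]
    refine ⟨fun h χ => h _ (Submodule.subset_span ⟨χ, rfl⟩), fun h φ hφ => ?_⟩
    induction hφ using Submodule.span_induction with
    | zero => rfl
    | add φ ψ _ _ h1 h2 => rw [LinearMap.add_apply, h1, h2, add_zero]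
    | smul c φ _ h1 => rw [LinearMap.smul_apply, h1, smul_zero]
    | mem φ hφ => obtain ⟨χ, rfl⟩ := hφ; exact h χ
  have hW : ∀ φ : Module.Dual k (H ⧸ J), φ ∘ₗ J.mkQ ∈ W := by
    intro φ
    rw [← Subspace.dualCoannihilator_dualAnnihilator_eq (W := W), hJ,
      Submodule.mem_dualAnnihilator]
    intro y hy
    rw [LinearMap.comp_apply, Submodule.mkQ_apply, (Submodule.Quotient.mk_eq_zero J).mpr hy,
      map_zero]
  have hpair : ∀ φ ∈ W, ∀ ψ ∈ W,
      TensorProduct.map φ ψ (Coalgebra.comul (R := k) x) = 0 := by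
    intro φ hφ ψ hψ
    induction hφ using Submodule.span_induction with
    | zero => rw [TensorProduct.map_zero_left, LinearMap.zero_apply]
    | add φ φ' _ _ h1 h2 => rw [TensorProduct.map_add_left, LinearMap.add_apply, h1, h2, add_zero]
    | smul c φ _ h1 => rw [TensorProduct.map_smul_left, LinearMap.smul_apply, h1, smul_zero]
    | mem φ hφ =>
      obtain ⟨χ, rfl⟩ := hφ
      induction hψ using Submodule.span_induction with
      | zero => rw [TensorProduct.map_zero_right, LinearMap.zero_apply]
      | add φ φ' _ _ h1 h2 =>
        rw [TensorProduct.map_add_right, LinearMap.add_apply, h1, h2, add_zero]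
      | smul c φ _ h1 => rw [TensorProduct.map_smul_right, LinearMap.smul_apply, h1, smul_zero]
      | mem φ hφ =>
        obtain ⟨ψ, rfl⟩ := hφ
        have := character_eq_zero (((Algebra.TensorProduct.lid k k).toAlgHom.comp
          (Algebra.TensorProduct.map χ ψ)).comp (Bialgebra.comulAlgHom k H)) hx
        exact (Algebra.TensorProduct.lid k k).injective (this.trans (map_zero _).symm)
  have hker : TensorProduct.map J.mkQ J.mkQ (Coalgebra.comul (R := k) x) = 0 := by
    let b := Module.finBasis k (H ⧸ J)
    apply (b.tensorProduct b).ext_elem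
    rintro ⟨i, j⟩
    have := hpair _ (hW (b.coord i)) _ (hW (b.coord j))
    rw [TensorProduct.map_comp, LinearMap.comp_apply] at this
    generalize TensorProduct.map J.mkQ J.mkQ (Coalgebra.comul (R := k) x) = t at this ⊢
    have hc : ∀ t : (H ⧸ J) ⊗[k] (H ⧸ J), (b.tensorProduct b).repr t (i, j) =
        TensorProduct.lid k k (TensorProduct.map (b.coord i) (b.coord j) t) := by
      intro t
      induction t using TensorProduct.induction_on with
      | zero => simp
      | add x y hx hy => simp only [map_add, Finsupp.add_apply, hx, hy]
      | tmul x y => simp [mul_comm]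
    rw [hc, this]
    simp
  rw [← LinearMap.mem_ker, TensorProduct.map_ker (LinearMap.exact_subtype_mkQ J)
    J.mkQ_surjective (LinearMap.exact_subtype_mkQ J) J.mkQ_surjective] at hker
  refine (sup_le ?_ ?_ : _ ≤ radTensor k H 1) hker
  · rintro _ ⟨t, rfl⟩
    induction t using TensorProduct.induction_on with
    | zero => rw [map_zero]; exact Submodule.zero_mem _
    | add x y hx hy => rw [map_add]; exact Submodule.add_mem _ hx hy
    | tmul a b =>
      rw [LinearMap.lTensor_tmul]
      exact tmul_mem_radTensor (i := 0) (j := 1) rfl (mem_radPow_zero a)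
        (mem_radPow_one.mpr b.2)
  · rintro _ ⟨t, rfl⟩
    induction t using TensorProduct.induction_on with
    | zero => rw [map_zero]; exact Submodule.zero_mem _
    | add x y hx hy => rw [map_add]; exact Submodule.add_mem _ hx hy
    | tmul a b =>
      rw [LinearMap.rTensor_tmul]
      exact tmul_mem_radTensor (i := 1) (j := 0) rfl (mem_radPow_one.mpr a.2)
        (mem_radPow_zero b)

theorem comul_radPow {n : ℕ} {x : H} (hx : x ∈ radPow k H n) :
    Coalgebra.comul (R := k) x ∈ radTensor k H n := by
  induction n generalizing x with
  | zero =>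
    generalize Coalgebra.comul (R := k) x = t
    induction t using TensorProduct.induction_on with
    | zero => exact Submodule.zero_mem _
    | add x y hx hy => exact Submodule.add_mem _ hx hy
    | tmul a b =>
      exact tmul_mem_radTensor (i := 0) (j := 0) rfl (mem_radPow_zero a) (mem_radPow_zero b)
  | succ n ih =>
    change x ∈ (Ring.jacobson H) ^ (n + 1) at hx
    rw [Submodule.pow_succ] at hx
    induction hx using Submodule.mul_induction_on' with
    | mem_mul_mem a ha b hb =>
      rw [Bialgebra.comul_mul]
      exact radTensor_mul (ih ha) (comul_jacobson hb)
    | add a _ b _ ha hb => rw [map_add]; exact Submodule.add_mem _ ha hb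

theorem antipode_radPow {n : ℕ} {x : H} (hx : x ∈ radPow k H n) :
    HopfAlgebra.antipode k x ∈ radPow k H n := by
  induction n generalizing x with
  | zero => exact mem_radPow_zero _
  | succ n ih =>
    change x ∈ (Ring.jacobson H) ^ (n + 1) at hx
    rw [Submodule.pow_succ] at hx
    induction hx using Submodule.mul_induction_on' with
    | mem_mul_mem a ha b hb =>
      rw [HopfAlgebra.antipode_mul_antidistrib, add_comm n 1]
      exact radPow_mul (mem_radPow_one.mpr (antipode_mem_jacobson hb)) (ih ha)
    | add a _ b _ ha hb => rw [map_add]; exact Submodule.add_mem _ ha hb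

end Characters

variable (k H)

/-- The counit of `gr H`: it is induced by that of `H` on `H / J`, and is zero in positive
degrees. -/
noncomputable def Gr.counitLin : Gr k H →ₗ[k] k :=
  DirectSum.toModule k ℕ k fun n =>
    GrPiece.lift n (if n = 0 then Coalgebra.counit ∘ₗ (radPow k H n).subtype else 0) <| by
      rintro ⟨x, hx⟩ hx'
      split_ifs with h
      · subst h
        exact counit_jacobson (mem_radPow_one.mp hx')
      · rfl

variable [IsElementary k H]

/-- The comultiplication of `gr H`: if `x ∈ J ^ n` and `Δ x = ∑ aᵢ ⊗ bⱼ` with `aᵢ ∈ J ^ i`,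
`bⱼ ∈ J ^ j` and `i + j = n`, then it sends the symbol of `x` to the sum of the tensor products of
the symbols of `aᵢ` and `bⱼ`. -/
noncomputable def Gr.comulLin : Gr k H →ₗ[k] Gr k H ⊗[k] Gr k H :=
  DirectSum.toModule k ℕ _ fun n =>
    GrPiece.lift n (Gr.tensorSymbol k H n ∘ₗ Coalgebra.comul ∘ₗ (radPow k H n).subtype) <| by
      rintro ⟨x, hx⟩ hx'
      exact Gr.tensorSymbol_eq_zero n.lt_succ_self (comul_radPow hx')

/-- The antipode of `gr H`, induced by that of `H`. -/
noncomputable def Gr.antipodeLin : Gr k H →ₗ[k] Gr k H :=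
  DirectSum.toModule k ℕ _ fun n =>
    GrPiece.lift n (Gr.ext k H n ∘ₗ HopfAlgebra.antipode k ∘ₗ (radPow k H n).subtype) <| by
      rintro ⟨x, hx⟩ hx'
      exact Gr.ext_eq_zero n.lt_succ_self (antipode_radPow hx')

variable {k H}

theorem Gr.counitLin_ext {n : ℕ} {x : H} (hx : x ∈ radPow k H n) :
    Gr.counitLin k H (Gr.ext k H n x) = if n = 0 then Coalgebra.counit (R := k) x else 0 := by
  rw [Gr.ext_apply hx, ← DirectSum.lof_eq_of k, Gr.counitLin, DirectSum.toModule_lof,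
    GrPiece.lift_mk]
  split_ifs with h
  · rfl
  · rfl

theorem Gr.comulLin_ext {n : ℕ} {x : H} (hx : x ∈ radPow k H n) :
    Gr.comulLin k H (Gr.ext k H n x) = Gr.tensorSymbol k H n (Coalgebra.comul x) := by
  rw [Gr.ext_apply hx, ← DirectSum.lof_eq_of k, Gr.comulLin, DirectSum.toModule_lof]
  rfl

theorem Gr.antipodeLin_ext {n : ℕ} {x : H} (hx : x ∈ radPow k H n) :
    Gr.antipodeLin k H (Gr.ext k H n x) = Gr.ext k H n (HopfAlgebra.antipode k x) := by
  rw [Gr.ext_apply hx, ← DirectSum.lof_eq_of k, Gr.antipodeLin, DirectSum.toModule_lof]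
  rfl

variable (k H)

/-- The counit of `gr H` as a homomorphism of algebras. -/
noncomputable def Gr.counitAlg : Gr k H →ₐ[k] k :=
  AlgHom.ofLinearMap (Gr.counitLin k H)
    (by rw [← Gr.ext_one, Gr.counitLin_ext (mem_radPow_zero 1), if_pos rfl, Bialgebra.counit_one])
    (fun a b => by
      induction a using Gr.induction with
      | zero => simp
      | add a a' h h' => simp only [add_mul, map_add, h, h']
      | ext m x hx =>
        induction b using Gr.induction with
        | zero => simp
        | add a a' h h' => simp only [mul_add, map_add, h, h']
        | ext n y hy =>
          rw [Gr.ext_mul hx hy, Gr.counitLin_ext (radPow_mul hx hy), Gr.counitLin_ext hx,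
            Gr.counitLin_ext hy, Bialgebra.counit_mul]
          by_cases hm : m = 0 <;> by_cases hn : n = 0 <;> simp [hm, hn])

/-- The comultiplication of `gr H` as a homomorphism of algebras. -/
noncomputable def Gr.comulAlg : Gr k H →ₐ[k] Gr k H ⊗[k] Gr k H :=
  AlgHom.ofLinearMap (Gr.comulLin k H)
    (by
      rw [← Gr.ext_one, Gr.comulLin_ext (mem_radPow_zero 1), Bialgebra.comul_one,
        Algebra.TensorProduct.one_def,
        Gr.tensorSymbol_tmul (i := 0) (j := 0) rfl (mem_radPow_zero 1) (mem_radPow_zero 1),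
        Gr.ext_one, Algebra.TensorProduct.one_def])
    (fun a b => by
      induction a using Gr.induction with
      | zero => simp
      | add a a' h h' => simp only [add_mul, map_add, h, h']
      | ext m x hx =>
        induction b using Gr.induction with
        | zero => simp
        | add a a' h h' => simp only [mul_add, map_add, h, h']
        | ext n y hy =>
          rw [Gr.ext_mul hx hy, Gr.comulLin_ext (radPow_mul hx hy), Gr.comulLin_ext hx,
            Gr.comulLin_ext hy, Bialgebra.comul_mul,
            Gr.tensorSymbol_mul (comul_radPow hx) (comul_radPow hy)])

variable {k H}

theorem Gr.map_comul_left {n : ℕ} {u : H ⊗[k] H} (hu : u ∈ radTensor k H n) :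
    TensorProduct.map (Gr.comulLin k H) LinearMap.id (Gr.tensorSymbol k H n u) =
      ∑ ml ∈ Finset.HasAntidiagonal.antidiagonal n,
        TensorProduct.map (Gr.tensorSymbol k H ml.1) (Gr.ext k H ml.2)
          (TensorProduct.map Coalgebra.comul LinearMap.id u) := by
  induction hu using Submodule.span_induction with
  | zero => simp
  | add x y _ _ hx hy => simp only [map_add, hx, hy, Finset.sum_add_distrib]
  | smul c x _ hx => simp only [map_smul, hx, Finset.smul_sum]
  | mem x hx =>
    obtain ⟨i, j, hij, a, ha, b, hb, rfl⟩ := hx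
    rw [Gr.tensorSymbol_tmul hij ha hb, TensorProduct.map_tmul, Gr.comulLin_ext ha,
      Finset.sum_eq_single_of_mem (i, j) (Finset.HasAntidiagonal.mem_antidiagonal.mpr hij)]
    · simp
    · rintro ⟨i', j'⟩ h' hne
      rw [Finset.HasAntidiagonal.mem_antidiagonal] at h'
      simp only [ne_eq, Prod.mk.injEq] at h' hne
      rw [TensorProduct.map_tmul, TensorProduct.map_tmul]
      rcases lt_trichotomy i' i with h1 | h1 | h1
      · rw [Gr.tensorSymbol_eq_zero h1 (comul_radPow ha), TensorProduct.zero_tmul]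
      · omega
      · rw [LinearMap.id_apply, Gr.ext_eq_zero (n := j') (m := j) (by omega) hb,
          TensorProduct.tmul_zero]

theorem Gr.map_comul_right {n : ℕ} {u : H ⊗[k] H} (hu : u ∈ radTensor k H n) :
    TensorProduct.map LinearMap.id (Gr.comulLin k H) (Gr.tensorSymbol k H n u) =
      ∑ ml ∈ Finset.HasAntidiagonal.antidiagonal n,
        TensorProduct.map (Gr.ext k H ml.1) (Gr.tensorSymbol k H ml.2)
          (TensorProduct.map LinearMap.id Coalgebra.comul u) := by
  induction hu using Submodule.span_induction with
  | zero => simp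
  | add x y _ _ hx hy => simp only [map_add, hx, hy, Finset.sum_add_distrib]
  | smul c x _ hx => simp only [map_smul, hx, Finset.smul_sum]
  | mem x hx =>
    obtain ⟨i, j, hij, a, ha, b, hb, rfl⟩ := hx
    rw [Gr.tensorSymbol_tmul hij ha hb, TensorProduct.map_tmul, Gr.comulLin_ext hb,
      Finset.sum_eq_single_of_mem (i, j) (Finset.HasAntidiagonal.mem_antidiagonal.mpr hij)]
    · simp
    · rintro ⟨i', j'⟩ h' hne
      rw [Finset.HasAntidiagonal.mem_antidiagonal] at h'
      simp only [ne_eq, Prod.mk.injEq] at h' hne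
      rw [TensorProduct.map_tmul, TensorProduct.map_tmul]
      rcases lt_trichotomy i' i with h1 | h1 | h1
      · rw [LinearMap.id_apply, Gr.ext_eq_zero h1 ha, TensorProduct.zero_tmul]
      · omega
      · rw [Gr.tensorSymbol_eq_zero (n := j') (m := j) (by omega) (comul_radPow hb),
          TensorProduct.tmul_zero]

theorem Gr.assoc_sum (n : ℕ) (t : (H ⊗[k] H) ⊗[k] H) :
    TensorProduct.assoc k (Gr k H) (Gr k H) (Gr k H)
      (∑ ml ∈ Finset.HasAntidiagonal.antidiagonal n,
        TensorProduct.map (Gr.tensorSymbol k H ml.1) (Gr.ext k H ml.2) t) =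
      ∑ ml ∈ Finset.HasAntidiagonal.antidiagonal n,
        TensorProduct.map (Gr.ext k H ml.1) (Gr.tensorSymbol k H ml.2)
          (TensorProduct.assoc k H H H t) := by
  induction t using TensorProduct.induction_on with
  | zero => simp
  | add x y hx hy => simp only [map_add, Finset.sum_add_distrib, hx, hy]
  | tmul s c =>
    induction s using TensorProduct.induction_on with
    | zero => simp
    | add x y hx hy => simp only [TensorProduct.add_tmul, map_add, Finset.sum_add_distrib, hx, hy]
    | tmul a b =>
      simp only [TensorProduct.map_tmul, TensorProduct.assoc_tmul, Gr.tensorSymbol,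
        LinearMap.sum_apply, TensorProduct.sum_tmul, TensorProduct.tmul_sum, map_sum]
      rw [Finset.sum_sigma', Finset.sum_sigma']
      refine Finset.sum_nbij'
        (fun q => ⟨(q.2.1, q.2.2 + q.1.2), (q.2.2, q.1.2)⟩)
        (fun q => ⟨(q.1.1 + q.2.1, q.2.2), (q.1.1, q.2.1)⟩) ?_ ?_ ?_ ?_ ?_
      · rintro ⟨⟨a, b⟩, ⟨c, d⟩⟩ h
        simp only [Finset.mem_sigma, Finset.HasAntidiagonal.mem_antidiagonal] at h ⊢
        exact ⟨by omega, trivial⟩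
      · rintro ⟨⟨a, b⟩, ⟨c, d⟩⟩ h
        simp only [Finset.mem_sigma, Finset.HasAntidiagonal.mem_antidiagonal] at h ⊢
        exact ⟨by omega, trivial⟩
      · rintro ⟨⟨a, b⟩, ⟨c, d⟩⟩ h
        simp only [Finset.mem_sigma, Finset.HasAntidiagonal.mem_antidiagonal] at h ⊢
        obtain ⟨-, rfl⟩ := h
        rfl
      · rintro ⟨⟨a, b⟩, ⟨c, d⟩⟩ h
        simp only [Finset.mem_sigma, Finset.HasAntidiagonal.mem_antidiagonal] at h ⊢
        obtain ⟨-, rfl⟩ := h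
        rfl
      · rintro ⟨⟨a, b⟩, ⟨c, d⟩⟩ h
        rfl

theorem Gr.coassoc (a : Gr k H) :
    TensorProduct.assoc k (Gr k H) (Gr k H) (Gr k H)
      (TensorProduct.map (Gr.comulLin k H) LinearMap.id (Gr.comulLin k H a)) =
      TensorProduct.map LinearMap.id (Gr.comulLin k H) (Gr.comulLin k H a) := by
  induction a using Gr.induction with
  | zero => simp
  | add a a' h h' => simp only [map_add, h, h']
  | ext n x hx =>
    rw [Gr.comulLin_ext hx, Gr.map_comul_left (comul_radPow hx),
      Gr.map_comul_right (comul_radPow hx), Gr.assoc_sum]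
    exact Finset.sum_congr rfl fun _ _ => congrArg _ (Coalgebra.coassoc_apply x)

theorem Gr.map_counit_left {n : ℕ} {u : H ⊗[k] H} (hu : u ∈ radTensor k H n) :
    TensorProduct.lid k _
      (TensorProduct.map (Gr.counitLin k H) LinearMap.id (Gr.tensorSymbol k H n u)) =
      Gr.ext k H n (TensorProduct.lid k _ (TensorProduct.map Coalgebra.counit LinearMap.id u)) := by
  induction hu using Submodule.span_induction with
  | zero => simp
  | add x y _ _ hx hy => simp only [map_add, hx, hy]
  | smul c x _ hx => simp only [map_smul, hx]
  | mem x hx =>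
    obtain ⟨i, j, hij, a, ha, b, hb, rfl⟩ := hx
    rw [Gr.tensorSymbol_tmul hij ha hb]
    simp only [TensorProduct.map_tmul, Gr.counitLin_ext ha, LinearMap.id_apply,
      TensorProduct.lid_tmul, map_smul]
    split_ifs with h
    · subst h; rw [zero_add] at hij; rw [hij]
    · rw [counit_jacobson (mem_radPow_one.mp (radPow_anti (by omega) ha)), zero_smul, zero_smul]

theorem Gr.map_counit_right {n : ℕ} {u : H ⊗[k] H} (hu : u ∈ radTensor k H n) :
    TensorProduct.rid k _
      (TensorProduct.map LinearMap.id (Gr.counitLin k H) (Gr.tensorSymbol k H n u)) =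
      Gr.ext k H n (TensorProduct.rid k _ (TensorProduct.map LinearMap.id Coalgebra.counit u)) := by
  induction hu using Submodule.span_induction with
  | zero => simp
  | add x y _ _ hx hy => simp only [map_add, hx, hy]
  | smul c x _ hx => simp only [map_smul, hx]
  | mem x hx =>
    obtain ⟨i, j, hij, a, ha, b, hb, rfl⟩ := hx
    rw [Gr.tensorSymbol_tmul hij ha hb]
    simp only [TensorProduct.map_tmul, Gr.counitLin_ext hb, LinearMap.id_apply,
      TensorProduct.rid_tmul, map_smul]
    split_ifs with h
    · subst h; rw [add_zero] at hij; rw [hij]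
    · rw [counit_jacobson (mem_radPow_one.mp (radPow_anti (by omega) hb)), zero_smul, zero_smul]

theorem Gr.mul_antipode_left {n : ℕ} {u : H ⊗[k] H} (hu : u ∈ radTensor k H n) :
    LinearMap.mul' k (Gr k H) ((Gr.antipodeLin k H).rTensor _ (Gr.tensorSymbol k H n u)) =
      Gr.ext k H n (LinearMap.mul' k H ((HopfAlgebra.antipode k).rTensor H u)) := by
  induction hu using Submodule.span_induction with
  | zero => simp
  | add x y _ _ hx hy => simp only [map_add, hx, hy]
  | smul c x _ hx => simp only [map_smul, hx]
  | mem x hx =>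
    obtain ⟨i, j, hij, a, ha, b, hb, rfl⟩ := hx
    rw [Gr.tensorSymbol_tmul hij ha hb, LinearMap.rTensor_tmul, LinearMap.rTensor_tmul,
      LinearMap.mul'_apply, LinearMap.mul'_apply, Gr.antipodeLin_ext ha,
      Gr.ext_mul (antipode_radPow ha) hb, hij]

theorem Gr.mul_antipode_right {n : ℕ} {u : H ⊗[k] H} (hu : u ∈ radTensor k H n) :
    LinearMap.mul' k (Gr k H) ((Gr.antipodeLin k H).lTensor _ (Gr.tensorSymbol k H n u)) =
      Gr.ext k H n (LinearMap.mul' k H ((HopfAlgebra.antipode k).lTensor H u)) := by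
  induction hu using Submodule.span_induction with
  | zero => simp
  | add x y _ _ hx hy => simp only [map_add, hx, hy]
  | smul c x _ hx => simp only [map_smul, hx]
  | mem x hx =>
    obtain ⟨i, j, hij, a, ha, b, hb, rfl⟩ := hx
    rw [Gr.tensorSymbol_tmul hij ha hb, LinearMap.lTensor_tmul, LinearMap.lTensor_tmul,
      LinearMap.mul'_apply, LinearMap.mul'_apply, Gr.antipodeLin_ext hb,
      Gr.ext_mul ha (antipode_radPow hb), hij]

theorem Gr.ext_algebraMap_counit {n : ℕ} {x : H} (hx : x ∈ radPow k H n) :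
    Gr.ext k H n (algebraMap k H (Coalgebra.counit x)) =
      algebraMap k (Gr k H) (Gr.counitLin k H (Gr.ext k H n x)) := by
  rw [Gr.counitLin_ext hx]
  split_ifs with h
  · subst h
    rw [Algebra.algebraMap_eq_smul_one, map_smul, Gr.ext_one, Algebra.algebraMap_eq_smul_one]
  · rw [counit_jacobson (mem_radPow_one.mp (radPow_anti (by omega) hx)), map_zero, map_zero,
      map_zero]

variable (k H)

/-- The Hopf algebra structure of `gr H`. -/
noncomputable def Gr.hopf : HopfStructure k (Gr k H) where
  comul := Gr.comulAlg k H
  counit := Gr.counitAlg k H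
  antipode := Gr.antipodeLin k H
  coassoc := AlgHom.ext fun a => Gr.coassoc a
  counit_left := AlgHom.ext fun a => by
    apply (Algebra.TensorProduct.lid k (Gr k H)).injective
    refine Eq.trans ?_ (AlgEquiv.apply_symm_apply _ a).symm
    change TensorProduct.lid k _ (TensorProduct.map (Gr.counitLin k H) LinearMap.id
      (Gr.comulLin k H a)) = a
    induction a using Gr.induction with
    | zero => simp
    | add a a' h h' => simp only [map_add, h, h']
    | ext n x hx =>
      rw [Gr.comulLin_ext hx, Gr.map_counit_left (comul_radPow hx)]
      refine congrArg _ ?_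
      have := Coalgebra.rTensor_counit_comul (R := k) x
      rw [LinearMap.rTensor] at this
      rw [this, TensorProduct.lid_tmul, one_smul]
  counit_right := AlgHom.ext fun a => by
    apply (Algebra.TensorProduct.rid k k (Gr k H)).injective
    refine Eq.trans ?_ (AlgEquiv.apply_symm_apply _ a).symm
    change TensorProduct.rid k _ (TensorProduct.map LinearMap.id (Gr.counitLin k H)
      (Gr.comulLin k H a)) = a
    induction a using Gr.induction with
    | zero => simp
    | add a a' h h' => simp only [map_add, h, h']
    | ext n x hx =>
      rw [Gr.comulLin_ext hx, Gr.map_counit_right (comul_radPow hx)]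
      refine congrArg _ ?_
      have := Coalgebra.lTensor_counit_comul (R := k) x
      rw [LinearMap.lTensor] at this
      rw [this, TensorProduct.rid_tmul, one_smul]
  antipode_left a := by
    change LinearMap.mul' k (Gr k H) ((Gr.antipodeLin k H).rTensor _ (Gr.comulLin k H a)) =
      algebraMap k (Gr k H) (Gr.counitLin k H a)
    induction a using Gr.induction with
    | zero => simp
    | add a a' h h' => simp only [map_add, h, h']
    | ext n x hx =>
      rw [Gr.comulLin_ext hx, Gr.mul_antipode_left (comul_radPow hx),
        HopfAlgebra.mul_antipode_rTensor_comul_apply, Gr.ext_algebraMap_counit hx]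
  antipode_right a := by
    change LinearMap.mul' k (Gr k H) ((Gr.antipodeLin k H).lTensor _ (Gr.comulLin k H a)) =
      algebraMap k (Gr k H) (Gr.counitLin k H a)
    induction a using Gr.induction with
    | zero => simp
    | add a a' h h' => simp only [map_add, h, h']
    | ext n x hx =>
      rw [Gr.comulLin_ext hx, Gr.mul_antipode_right (comul_radPow hx),
        HopfAlgebra.mul_antipode_lTensor_comul_apply, Gr.ext_algebraMap_counit hx]

noncomputable instance Gr.instHopfAlgebra : HopfAlgebra k (Gr k H) := (Gr.hopf k H).toHopfAlgebra

end Hopf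

/-- The universal `R`-matrix `gr R` of `gr H`: the image of `R` in the degree-`0` part
`H / J ⊗ H / J` of `gr H ⊗ gr H`. -/
noncomputable def Gr.rMatrix {k H : Type*} [Field k] [Ring H] [Algebra k H] (R : H ⊗[k] H) :
    Gr k H ⊗[k] Gr k H :=
  TensorProduct.map (Gr.degreeZero k H) (Gr.degreeZero k H) R

end RadicallyGraded

/-! Since every simple module is one-dimensional, `J` is the common kernel of the characters `H →
k`, so `H / J` is a finite product of copies of `k` with one primitive idempotent for each
character. The characters form a group `G` under convolution, inversion being composition with the
antipode. Applying `χ ⊗ ψ` to `Δᵒ(h) R = R Δ(h)` lands in the commutative ring `k`, where the image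
of `R` is a unit and cancels; hence `G` is abelian (`IsUniversalRMatrix.convMul_comm`) and `H / J`
is the function algebra `(kG)*`. This is recorded as a dual group frame of `gr H`
(`isDualGroupFrame_of_characters`).

The arrows come from `J / J ^ 2`, cut by the idempotents into Peirce parts `E y · (J / J ^ 2) · E
x`. Evaluating the first tensor leg of the comultiplication at a point of `G` translates the
idempotents and is injective on `J / J ^ 2`, so the dimension of a Peirce part is invariant under
simultaneous translation of `x` and `y` (`IsDualGroupFrame.finrank_peircePart`). As `G` is abelian,
it depends only on `y x⁻¹`, and these dimensions are the ramification datum. Bases of the Peirce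
parts define an algebra map `π` from the path algebra to `gr H` which is bijective in degrees `0`
and `1`, and surjective because `gr H` is generated in these degrees
(`IsIdempotentFrame.exists_pathCover`).

The path algebra is free on its degree `0` and `1` parts, subject only to the products of total
degree at most `1`. A linear map respecting these products therefore extends uniquely to an algebra
map. Transporting `Δ` and `S` along the inverse `σ` of `π` in degrees `0` and `1`, and pulling `ε`
back along `π`, gives a Hopf structure on the path algebra (`PathCover.exists_hopf`); each axiom is
either an equality of algebra maps or a condition that defines a subalgebra, so it is enough to
verify it in degrees `0` and `1`. The `R`-matrix has degree `0` and is carried along by `σ ⊗ σ`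
(`PathCover.IsLift.isUniversalRMatrix`). The kernel of `π` is admissible because `J` is nilpotent
and `π` is injective in degrees `0` and `1`.

For uniqueness, a presentation is also faithful in degrees `0` and `1`. The vertices are recovered
as the minimal idempotents of degree `0`, and the number of arrows from `x` to `y` as the dimension
of a Peirce part, so the quiver is determined by the graded algebra. If degree `0` is moreover
identified with `(kG')*`, the comultiplication of the idempotents recovers the group law. -/

theorem iSupIndep_supported_fiber (k : Type*) {α : Type*} [Field k] (d : α → ℕ) :
    iSupIndep fun n => Finsupp.supported k k {p | d p = n} := by
  intro n
  rw [iSup_subtype', ← Finsupp.supported_iUnion]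
  refine Finsupp.disjoint_supported_supported (Set.disjoint_left.mpr fun p hp hp' => ?_)
  simp only [Set.mem_iUnion, Set.mem_ofPred_eq] at hp hp'
  obtain ⟨j, h⟩ := hp'
  exact j.2 (h ▸ hp)

/-! ### The path algebra: generators, length grading, universal property -/

namespace PathAlgebra

section Basic

variable (k : Type*) {V : Type*} [Field k] [Quiver V]

/-- The basis element given by an arrow. -/
noncomputable def arrow {x y : V} (a : x ⟶ y) : PathAlgebra k V :=
  single k ⟨x, y, a.toPath⟩

theorem arrow_mul_single {x y z : V} (a : y ⟶ z) (p : Quiver.Path x y) :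
    arrow k a * single k ⟨x, y, p⟩ = single k ⟨x, z, p.cons a⟩ := by
  rw [arrow, single_mul_single, concat_of_eq]; rfl

theorem vertex_mem_grading (x : V) : vertex k x ∈ grading k V 0 :=
  Submodule.subset_span ⟨_, rfl, rfl⟩

theorem arrow_mem_grading {x y : V} (a : x ⟶ y) : arrow k a ∈ grading k V 1 :=
  Submodule.subset_span ⟨_, rfl, rfl⟩

theorem grading_eq_supported (n : ℕ) :
    grading k V n = Finsupp.supported k k {p : QuiverPath V | p.2.2.length = n} :=
  (Finsupp.supported_eq_span_single k _).symm

theorem grading_isInternal : DirectSum.IsInternal (grading k V) := by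
  rw [DirectSum.isInternal_submodule_iff_iSupIndep_and_iSup_eq_top]
  constructor
  · rw [show grading k V = _ from funext (grading_eq_supported k)]
    exact iSupIndep_supported_fiber k fun p : QuiverPath V => p.2.2.length
  · rw [eq_top_iff]
    rintro f -
    induction f using induction_basis with
    | zero => exact Submodule.zero_mem _
    | add f g hf hg => exact Submodule.add_mem _ hf hg
    | smul c f hf => exact Submodule.smul_mem _ c hf
    | single p =>
      exact Submodule.mem_iSup_of_mem p.2.2.length (Submodule.subset_span ⟨p, rfl, rfl⟩)

theorem grading_zero : grading k V 0 = Submodule.span k (Set.range (vertex k (V := V))) := by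
  refine congrArg _ (Set.ext fun f => ⟨?_, ?_⟩)
  · rintro ⟨⟨x, y, p⟩, hp, rfl⟩
    cases p with
    | nil => exact ⟨x, rfl⟩
    | cons p a => simp at hp
  · rintro ⟨x, rfl⟩
    exact ⟨_, rfl, rfl⟩

theorem grading_one : grading k V 1 =
    Submodule.span k (Set.range fun a : (Σ x y : V, x ⟶ y) => arrow k a.2.2) := by
  refine congrArg _ (Set.ext fun f => ⟨?_, ?_⟩)
  · rintro ⟨⟨x, y, p⟩, hp, rfl⟩
    cases p with
    | nil => simp at hp
    | cons p a =>
      cases p with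
      | nil => exact ⟨⟨x, y, a⟩, rfl⟩
      | cons p b => simp at hp
  · rintro ⟨a, rfl⟩
    exact ⟨_, rfl, rfl⟩

theorem grading_mul {m n : ℕ} {f g : PathAlgebra k V} (hf : f ∈ grading k V m)
    (hg : g ∈ grading k V n) : f * g ∈ grading k V (m + n) := by
  rw [mul_def]
  have key : grading k V m ≤ ((grading k V (m + n)).comap ((mulLin k).flip g)) := by
    refine Submodule.span_le.mpr ?_
    rintro _ ⟨p, hp, rfl⟩
    have : grading k V n ≤ ((grading k V (m + n)).comap (mulLin k (single k p))) := by
      refine Submodule.span_le.mpr ?_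
      rintro _ ⟨q, hq, rfl⟩
      rw [SetLike.mem_coe, Submodule.mem_comap, ← mul_def, single_mul_single, concat]
      split_ifs with h
      · refine Submodule.subset_span ⟨_, ?_, rfl⟩
        obtain ⟨a, b, p⟩ := p
        obtain ⟨c, d, q⟩ := q
        obtain rfl : d = a := h
        simp only [Set.mem_ofPred_eq] at hp hq ⊢
        simp only [Quiver.Path.cast_rfl_rfl, Quiver.Path.length_comp]
        omega
      · exact Submodule.zero_mem _
    exact this hg
  exact key hf

theorem arrow_mul_vertex {x y : V} (a : x ⟶ y) : arrow k a * vertex k x = arrow k a := by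
  rw [arrow, vertex, single_mul_single, concat_of_eq, Quiver.Path.nil_comp]

theorem vertex_mul_arrow {x y : V} (a : x ⟶ y) : vertex k y * arrow k a = arrow k a := by
  rw [arrow, vertex, single_mul_single, concat_of_eq, Quiver.Path.comp_nil]

theorem vertex_mul_self (x : V) : vertex k x * vertex k x = vertex k x := by
  rw [vertex, single_mul_single, concat_of_eq, Quiver.Path.nil_comp]

theorem vertex_mul_vertex_of_ne {x y : V} (h : x ≠ y) : vertex k x * vertex k y = 0 := by
  rw [vertex, vertex, single_mul_single]
  exact concat_of_ne (Ne.symm h)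

theorem vertex_mul_arrow_of_ne {x y z : V} (a : x ⟶ y) (h : z ≠ y) :
    vertex k z * arrow k a = 0 := by
  rw [arrow, vertex, single_mul_single]
  exact concat_of_ne (Ne.symm h)

theorem arrow_mul_vertex_of_ne {x y z : V} (a : x ⟶ y) (h : z ≠ x) :
    arrow k a * vertex k z = 0 := by
  rw [arrow, vertex, single_mul_single]
  exact concat_of_ne h

end Basic

end PathAlgebra

namespace PathAlgebra

theorem linearIndependent_single (k : Type*) {V : Type*} [Field k] [Quiver V] :
    LinearIndependent k (single k (V := V)) := by
  have h := (Finsupp.basisSingleOne (R := k) (ι := QuiverPath V)).linearIndependent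
  rwa [Finsupp.coe_basisSingleOne] at h

theorem linearIndependent_vertex (k : Type*) {V : Type*} [Field k] [Quiver V] :
    LinearIndependent k (vertex k (V := V)) :=
  (linearIndependent_single k).comp (fun x : V => (⟨x, x, Quiver.Path.nil⟩ : QuiverPath V))
    fun _ _ h => congrArg Sigma.fst h

theorem linearIndependent_arrow (k : Type*) {V : Type*} [Field k] [Quiver V] (x y : V) :
    LinearIndependent k (fun a : x ⟶ y => arrow k a) :=
  (linearIndependent_single k).comp (fun a : x ⟶ y => (⟨x, y, a.toPath⟩ : QuiverPath V))
    fun a b h => by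
      have h1 : (⟨y, a.toPath⟩ : Σ z, Quiver.Path x z) = ⟨y, b.toPath⟩ :=
        eq_of_heq (Sigma.mk.inj h).2
      have h2 : a.toPath = b.toPath := eq_of_heq (Sigma.mk.inj h1).2
      exact eq_of_heq (Quiver.Path.cons.inj h2).2.2

section Lift

variable {k V A : Type*} [Field k] [Quiver V] [Fintype V] [Ring A] [Algebra k A]

/-- A subalgebra which contains the vertices and the arrows is everything. -/
theorem mem_of_generators (S : Subalgebra k (PathAlgebra k V)) (h₀ : ∀ x, vertex k x ∈ S)
    (h₁ : ∀ {x y : V} (a : x ⟶ y), arrow k a ∈ S) (f : PathAlgebra k V) : f ∈ S := by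
  induction f using induction_basis with
  | zero => exact S.zero_mem
  | add f g hf hg => exact S.add_mem hf hg
  | smul c f hf => exact S.smul_mem hf c
  | single p =>
    obtain ⟨x, y, p⟩ := p
    induction p with
    | nil => exact h₀ x
    | cons p a ih => rw [← arrow_mul_single]; exact S.mul_mem (h₁ a) ih

theorem algHom_ext {f g : PathAlgebra k V →ₐ[k] A}
    (h₀ : ∀ b ∈ grading k V 0, f b = g b) (h₁ : ∀ b ∈ grading k V 1, f b = g b) : f = g :=
  AlgHom.ext fun b => mem_of_generators (AlgHom.equalizer f g)
    (fun x => h₀ _ (vertex_mem_grading k x)) (fun a => h₁ _ (arrow_mem_grading k a)) b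

theorem one_def : (1 : PathAlgebra k V) = ∑ x : V, vertex k x := rfl

theorem one_mem_grading : (1 : PathAlgebra k V) ∈ grading k V 0 :=
  Submodule.sum_mem _ fun x _ => vertex_mem_grading k x

/-- The image of a path under the assignment `f₀` on vertices and `f₁` on arrows. -/
noncomputable def evalPath (f₀ : V → A) (f₁ : ∀ {x y : V}, (x ⟶ y) → A) {x : V} :
    ∀ {y : V}, Quiver.Path x y → A
  | _, .nil => f₀ x
  | _, .cons p a => f₁ a * evalPath f₀ f₁ p

/-- The universal property of the path algebra. -/
theorem exists_lift (f₀ : V → A) (f₁ : ∀ {x y : V}, (x ⟶ y) → A)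
    (idem : ∀ x, f₀ x * f₀ x = f₀ x) (ortho : ∀ x y, x ≠ y → f₀ x * f₀ y = 0)
    (sum : ∑ x, f₀ x = 1) (left : ∀ {x y : V} (a : x ⟶ y), f₀ y * f₁ a = f₁ a)
    (right : ∀ {x y : V} (a : x ⟶ y), f₁ a * f₀ x = f₁ a) :
    ∃ F : PathAlgebra k V →ₐ[k] A, (∀ x, F (vertex k x) = f₀ x) ∧
      ∀ {x y : V} (a : x ⟶ y), F (arrow k a) = f₁ a := by
  -- The value of a path absorbs the idempotents of its two ends (`hl`, `hr`). Orthogonality then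
  -- makes the values of two non-composable paths multiply to zero, in agreement with `concat`.
  have hl : ∀ {x y : V} (p : Quiver.Path x y), f₀ y * evalPath f₀ f₁ p = evalPath f₀ f₁ p := by
    intro x y p
    cases p with
    | nil => exact idem x
    | cons p a => rw [evalPath, ← mul_assoc, left]
  have hr : ∀ {x y : V} (p : Quiver.Path x y), evalPath f₀ f₁ p * f₀ x = evalPath f₀ f₁ p := by
    intro x y p
    induction p with
    | nil => exact idem x
    | cons p a ih => rw [evalPath, mul_assoc, ih]
  have hcomp : ∀ {x y z : V} (q : Quiver.Path x y) (p : Quiver.Path y z),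
      evalPath f₀ f₁ (q.comp p) = evalPath f₀ f₁ p * evalPath f₀ f₁ q := by
    intro x y z q p
    induction p with
    | nil => exact (hl q).symm
    | cons p a ih => rw [Quiver.Path.comp_cons, evalPath, evalPath, ih, mul_assoc]
  let L : PathAlgebra k V →ₗ[k] A :=
    Finsupp.linearCombination k fun p : QuiverPath V => evalPath f₀ f₁ p.2.2
  have hL : ∀ p : QuiverPath V, L (single k p) = evalPath f₀ f₁ p.2.2 := fun p => by
    have := Finsupp.linearCombination_single k (1 : k) p
      (v := fun p : QuiverPath V => evalPath f₀ f₁ p.2.2)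
    rw [one_smul] at this
    exact this
  refine ⟨AlgHom.ofLinearMap L ?_ ?_, fun x => hL _, fun a => ?_⟩
  · rw [one_def, map_sum, ← sum]
    exact Finset.sum_congr rfl fun x _ => hL _
  · intro f g
    induction f using induction_basis with
    | zero => simp
    | add f f' hf hf' => simp only [add_mul, map_add, hf, hf']
    | smul c f hf => simp only [smul_mul_assoc, map_smul, hf]
    | single p =>
      induction g using induction_basis with
      | zero => simp
      | add f f' hf hf' => simp only [mul_add, map_add, hf, hf']
      | smul c f hf => simp only [mul_smul_comm, map_smul, hf]
      | single q =>
        obtain ⟨a, b, p⟩ := p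
        obtain ⟨c, d, q⟩ := q
        rw [single_mul_single, hL, hL]
        by_cases h : d = a
        · subst h
          rw [concat_of_eq, hL, hcomp]
        · rw [concat_of_ne (p := ⟨a, b, p⟩) (q := ⟨c, d, q⟩) h, map_zero, ← hr p, ← hl q,
            mul_assoc, ← mul_assoc (f₀ a), ortho a d (Ne.symm h), zero_mul, mul_zero]
  · refine (hL _).trans ?_
    change f₁ a * f₀ _ = f₁ a
    exact right a

end Lift

end PathAlgebra

/-! ### Tensor products of subspaces, and maps that are multiplicative in low degrees -/

section LowDegree

variable {k A B C D : Type*} [Field k] [Ring A] [Algebra k A] [Ring B] [Algebra k B]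
  [Ring C] [Algebra k C] [Ring D] [Algebra k D]

/-- The subspace `P ⊗ Q` of `A ⊗ B`. -/
def tensorSub (P : Submodule k A) (Q : Submodule k B) : Submodule k (A ⊗[k] B) :=
  Submodule.span k {u | ∃ a ∈ P, ∃ b ∈ Q, a ⊗ₜ[k] b = u}

theorem tmul_mem_tensorSub {P : Submodule k A} {Q : Submodule k B} {a : A} {b : B} (ha : a ∈ P)
    (hb : b ∈ Q) : a ⊗ₜ[k] b ∈ tensorSub P Q :=
  Submodule.subset_span ⟨a, ha, b, hb, rfl⟩

theorem tmul_mem_tensorPiece {𝒜 : ℕ → Submodule k A} {i j n : ℕ} (h : i + j = n) {a b : A}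
    (ha : a ∈ 𝒜 i) (hb : b ∈ 𝒜 j) : a ⊗ₜ[k] b ∈ tensorPiece 𝒜 n :=
  Submodule.subset_span ⟨i, j, h, a, ha, b, hb, rfl⟩

theorem tensorPiece_zero (𝒜 : ℕ → Submodule k A) :
    tensorPiece 𝒜 0 = tensorSub (𝒜 0) (𝒜 0) := by
  refine le_antisymm (Submodule.span_le.mpr ?_) (Submodule.span_le.mpr ?_)
  · rintro _ ⟨i, j, hij, a, ha, b, hb, rfl⟩
    obtain ⟨rfl, rfl⟩ : i = 0 ∧ j = 0 := by omega
    exact tmul_mem_tensorSub ha hb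
  · rintro _ ⟨a, ha, b, hb, rfl⟩
    exact tmul_mem_tensorPiece (i := 0) (j := 0) rfl ha hb

theorem tensorPiece_one (𝒜 : ℕ → Submodule k A) :
    tensorPiece 𝒜 1 = tensorSub (𝒜 0) (𝒜 1) ⊔ tensorSub (𝒜 1) (𝒜 0) := by
  refine le_antisymm (Submodule.span_le.mpr ?_)
    (sup_le (Submodule.span_le.mpr ?_) (Submodule.span_le.mpr ?_))
  · rintro _ ⟨i, j, hij, a, ha, b, hb, rfl⟩
    rcases Nat.eq_zero_or_pos i with rfl | hi
    · obtain rfl : j = 1 := by omega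
      exact Submodule.mem_sup_left (tmul_mem_tensorSub ha hb)
    · obtain ⟨rfl, rfl⟩ : i = 1 ∧ j = 0 := by omega
      exact Submodule.mem_sup_right (tmul_mem_tensorSub ha hb)
  · rintro _ ⟨a, ha, b, hb, rfl⟩
    exact tmul_mem_tensorPiece (i := 0) (j := 1) rfl ha hb
  · rintro _ ⟨a, ha, b, hb, rfl⟩
    exact tmul_mem_tensorPiece (i := 1) (j := 0) rfl ha hb

theorem tensorPiece_mul {𝒜 : ℕ → Submodule k A}
    (h𝒜 : ∀ i j : ℕ, ∀ a ∈ 𝒜 i, ∀ b ∈ 𝒜 j, a * b ∈ 𝒜 (i + j)) {m n : ℕ} {x y : A ⊗[k] A}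
    (hx : x ∈ tensorPiece 𝒜 m) (hy : y ∈ tensorPiece 𝒜 n) : x * y ∈ tensorPiece 𝒜 (m + n) := by
  induction hx using Submodule.span_induction with
  | zero => rw [zero_mul]; exact Submodule.zero_mem _
  | add x x' _ _ hx hx' => rw [add_mul]; exact Submodule.add_mem _ hx hx'
  | smul c x _ hx => rw [smul_mul_assoc]; exact Submodule.smul_mem _ _ hx
  | mem x hx =>
    obtain ⟨i, j, rfl, a, ha, b, hb, rfl⟩ := hx
    induction hy using Submodule.span_induction with
    | zero => rw [mul_zero]; exact Submodule.zero_mem _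
    | add x x' _ _ hx hx' => rw [mul_add]; exact Submodule.add_mem _ hx hx'
    | smul c x _ hx => rw [mul_smul_comm]; exact Submodule.smul_mem _ _ hx
    | mem y hy =>
      obtain ⟨i', j', rfl, a', ha', b', hb', rfl⟩ := hy
      rw [Algebra.TensorProduct.tmul_mul_tmul]
      exact tmul_mem_tensorPiece (by omega) (h𝒜 _ _ _ ha _ ha') (h𝒜 _ _ _ hb _ hb')

theorem map_mem_tensorPiece {𝒜 : ℕ → Submodule k A} {ℬ : ℕ → Submodule k B} {n : ℕ}
    {f g : A →ₗ[k] B} (hf : ∀ i ≤ n, ∀ a ∈ 𝒜 i, f a ∈ ℬ i) (hg : ∀ i ≤ n, ∀ a ∈ 𝒜 i, g a ∈ ℬ i)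
    {x : A ⊗[k] A} (hx : x ∈ tensorPiece 𝒜 n) : TensorProduct.map f g x ∈ tensorPiece ℬ n := by
  induction hx using Submodule.span_induction with
  | zero => rw [map_zero]; exact Submodule.zero_mem _
  | add x x' _ _ hx hx' => rw [map_add]; exact Submodule.add_mem _ hx hx'
  | smul c x _ hx => rw [map_smul]; exact Submodule.smul_mem _ _ hx
  | mem x hx =>
    obtain ⟨i, j, rfl, a, ha, b, hb, rfl⟩ := hx
    exact tmul_mem_tensorPiece rfl (hf i (by omega) a ha) (hg j (by omega) b hb)

theorem comm_mem_tensorPiece {𝒜 : ℕ → Submodule k A} {n : ℕ} {x : A ⊗[k] A}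
    (hx : x ∈ tensorPiece 𝒜 n) : TensorProduct.comm k A A x ∈ tensorPiece 𝒜 n := by
  induction hx using Submodule.span_induction with
  | zero => rw [map_zero]; exact Submodule.zero_mem _
  | add x x' _ _ hx hx' => rw [map_add]; exact Submodule.add_mem _ hx hx'
  | smul c x _ hx => rw [map_smul]; exact Submodule.smul_mem _ _ hx
  | mem x hx =>
    obtain ⟨i, j, rfl, a, ha, b, hb, rfl⟩ := hx
    exact tmul_mem_tensorPiece (Nat.add_comm j i) hb ha

theorem map_eq_map_of_mem_tensorPiece {M N : Type*} [AddCommGroup M] [Module k M]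
    [AddCommGroup N] [Module k N] {𝒜 : ℕ → Submodule k A} {n : ℕ} {f f' : A →ₗ[k] M}
    {g g' : A →ₗ[k] N} (hf : ∀ i ≤ n, ∀ a ∈ 𝒜 i, f a = f' a)
    (hg : ∀ i ≤ n, ∀ a ∈ 𝒜 i, g a = g' a) {x : A ⊗[k] A} (hx : x ∈ tensorPiece 𝒜 n) :
    TensorProduct.map f g x = TensorProduct.map f' g' x := by
  induction hx using Submodule.span_induction with
  | zero => simp
  | add x x' _ _ hx hx' => rw [map_add, map_add, hx, hx']
  | smul c x _ hx => rw [map_smul, map_smul, hx]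
  | mem x hx =>
    obtain ⟨i, j, rfl, a, ha, b, hb, rfl⟩ := hx
    rw [TensorProduct.map_tmul, TensorProduct.map_tmul, hf i (by omega) a ha,
      hg j (by omega) b hb]

theorem map_map_eq_of_mem_tensorPiece {M M' N N' L L' : Type*} [AddCommGroup M] [Module k M]
    [AddCommGroup N] [Module k N] [AddCommGroup M'] [Module k M'] [AddCommGroup N'] [Module k N']
    [AddCommGroup L] [Module k L] [AddCommGroup L'] [Module k L']
    {𝒜 : ℕ → Submodule k A} {n : ℕ} {f₁ : A →ₗ[k] M} {f₂ : M →ₗ[k] L} {f₁' : A →ₗ[k] M'}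
    {f₂' : M' →ₗ[k] L} {g₁ : A →ₗ[k] N} {g₂ : N →ₗ[k] L'} {g₁' : A →ₗ[k] N'} {g₂' : N' →ₗ[k] L'}
    {x : A ⊗[k] A} (hx : x ∈ tensorPiece 𝒜 n)
    (hf : ∀ i ≤ n, ∀ a ∈ 𝒜 i, f₂ (f₁ a) = f₂' (f₁' a))
    (hg : ∀ i ≤ n, ∀ a ∈ 𝒜 i, g₂ (g₁ a) = g₂' (g₁' a)) :
    TensorProduct.map f₂ g₂ (TensorProduct.map f₁ g₁ x) =
      TensorProduct.map f₂' g₂' (TensorProduct.map f₁' g₁' x) := by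
  rw [← LinearMap.comp_apply, ← LinearMap.comp_apply, ← TensorProduct.map_comp,
    ← TensorProduct.map_comp]
  exact map_eq_map_of_mem_tensorPiece hf hg hx

theorem map_mem_tensorSub {M N : Type*} [Ring M] [Algebra k M] [Ring N] [Algebra k N]
    {P : Submodule k A} {Q : Submodule k B} {P' : Submodule k M} {Q' : Submodule k N}
    {f : A →ₗ[k] M} {g : B →ₗ[k] N} (hf : ∀ a ∈ P, f a ∈ P') (hg : ∀ b ∈ Q, g b ∈ Q')
    {x : A ⊗[k] B} (hx : x ∈ tensorSub P Q) : TensorProduct.map f g x ∈ tensorSub P' Q' := by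
  induction hx using Submodule.span_induction with
  | zero => rw [map_zero]; exact Submodule.zero_mem _
  | add x x' _ _ hx hx' => rw [map_add]; exact Submodule.add_mem _ hx hx'
  | smul c x _ hx => rw [map_smul]; exact Submodule.smul_mem _ _ hx
  | mem x hx =>
    obtain ⟨a, ha, b, hb, rfl⟩ := hx
    exact tmul_mem_tensorSub (hf a ha) (hg b hb)

/-- `f (p q) = f p f q` for `p ∈ P` and `q ∈ Q`. -/
def MulOn (f : A →ₗ[k] B) (P Q : Submodule k A) : Prop :=
  ∀ p ∈ P, ∀ q ∈ Q, f (p * q) = f p * f q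

theorem MulOn.sup_left {f : A →ₗ[k] B} {P P' Q : Submodule k A} (h : MulOn f P Q)
    (h' : MulOn f P' Q) : MulOn f (P ⊔ P') Q := by
  intro p hp q hq
  obtain ⟨a, ha, b, hb, rfl⟩ := Submodule.mem_sup.mp hp
  rw [add_mul, map_add, map_add, add_mul, h a ha q hq, h' b hb q hq]

theorem MulOn.sup_right {f : A →ₗ[k] B} {P Q Q' : Submodule k A} (h : MulOn f P Q)
    (h' : MulOn f P Q') : MulOn f P (Q ⊔ Q') := by
  intro p hp q hq
  obtain ⟨a, ha, b, hb, rfl⟩ := Submodule.mem_sup.mp hq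
  rw [mul_add, map_add, map_add, mul_add, h p hp a ha, h' p hp b hb]

theorem MulOn.map {f : A →ₗ[k] B} {g : C →ₗ[k] D} {P P' : Submodule k A} {Q Q' : Submodule k C}
    (hf : MulOn f P P') (hg : MulOn g Q Q') :
    MulOn (TensorProduct.map f g) (tensorSub P Q) (tensorSub P' Q') := by
  intro x hx y hy
  induction hx using Submodule.span_induction with
  | zero => simp
  | add x x' _ _ hx hx' => rw [add_mul, map_add, map_add, add_mul, hx, hx']
  | smul c x _ hx => rw [smul_mul_assoc, map_smul, map_smul, smul_mul_assoc, hx]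
  | mem x hx =>
    obtain ⟨a, ha, b, hb, rfl⟩ := hx
    induction hy using Submodule.span_induction with
    | zero => simp
    | add x x' _ _ hx hx' => rw [mul_add, map_add, map_add, mul_add, hx, hx']
    | smul c x _ hx => rw [mul_smul_comm, map_smul, map_smul, mul_smul_comm, hx]
    | mem y hy =>
      obtain ⟨a', ha', b', hb', rfl⟩ := hy
      simp only [Algebra.TensorProduct.tmul_mul_tmul, TensorProduct.map_tmul, hf a ha a' ha',
        hg b hb b' hb']

/-- A linear map which preserves `1` and all products of degree at most `1`. -/
structure LowMul (𝒜 : ℕ → Submodule k A) (f : A →ₗ[k] B) : Prop where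
  map_one : f 1 = 1
  zero_zero : MulOn f (𝒜 0) (𝒜 0)
  zero_one : MulOn f (𝒜 0) (𝒜 1)
  one_zero : MulOn f (𝒜 1) (𝒜 0)

/-- A tensor of total degree `1` has one leg of degree `0` and one of degree `1`. Multiplying it by
a tensor of degree `0` therefore involves, in each leg, only products of total degree at most `1`.
Products of two elements of degree `1` do not enter `LowMul`. -/
theorem LowMul.tensor {𝒜 : ℕ → Submodule k A} {f : A →ₗ[k] B} {g : A →ₗ[k] C}
    (hf : LowMul 𝒜 f) (hg : LowMul 𝒜 g) : LowMul (tensorPiece 𝒜) (TensorProduct.map f g) where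
  map_one := by
    rw [Algebra.TensorProduct.one_def, TensorProduct.map_tmul, hf.map_one, hg.map_one,
      Algebra.TensorProduct.one_def]
  zero_zero := by
    rw [tensorPiece_zero]; exact hf.zero_zero.map hg.zero_zero
  zero_one := by
    rw [tensorPiece_zero, tensorPiece_one]
    exact (hf.zero_zero.map hg.zero_one).sup_right (hf.zero_one.map hg.zero_zero)
  one_zero := by
    rw [tensorPiece_zero, tensorPiece_one]
    exact (hf.zero_zero.map hg.one_zero).sup_left (hf.one_zero.map hg.zero_zero)

theorem LowMul.algHom_comp {𝒜 : ℕ → Submodule k A} {f : A →ₗ[k] B} (hf : LowMul 𝒜 f)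
    (g : B →ₐ[k] C) : LowMul 𝒜 (g.toLinearMap ∘ₗ f) where
  map_one := by simp [hf.map_one]
  zero_zero a ha b hb := by simp [hf.zero_zero a ha b hb]
  zero_one a ha b hb := by simp [hf.zero_one a ha b hb]
  one_zero a ha b hb := by simp [hf.one_zero a ha b hb]

theorem LowMul.comp_algHom {𝒜 : ℕ → Submodule k A} {ℬ : ℕ → Submodule k B} {f : B →ₗ[k] C}
    (hf : LowMul ℬ f) (g : A →ₐ[k] B) (hg : ∀ n, ∀ a ∈ 𝒜 n, g a ∈ ℬ n) :
    LowMul 𝒜 (f ∘ₗ g.toLinearMap) where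
  map_one := by simp [hf.map_one]
  zero_zero a ha b hb := by simpa using hf.zero_zero _ (hg 0 a ha) _ (hg 0 b hb)
  zero_one a ha b hb := by simpa using hf.zero_one _ (hg 0 a ha) _ (hg 1 b hb)
  one_zero a ha b hb := by simpa using hf.one_zero _ (hg 1 a ha) _ (hg 0 b hb)

/-- A linear map on the path algebra which preserves `1` and products of degree at most `1`
agrees in degrees `0` and `1` with an algebra homomorphism. -/
theorem PathAlgebra.exists_extension {V : Type*} [Quiver V] [Fintype V]
    {f : PathAlgebra k V →ₗ[k] A} (hf : LowMul (PathAlgebra.grading k V) f) :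
    ∃ F : PathAlgebra k V →ₐ[k] A, ∀ i ≤ 1, ∀ a ∈ PathAlgebra.grading k V i, F a = f a := by
  obtain ⟨F, h₀, h₁⟩ := PathAlgebra.exists_lift (k := k) (V := V)
    (fun x => f (vertex k x)) (fun a => f (arrow k a))
    (fun x => by
      rw [← hf.zero_zero _ (vertex_mem_grading k x) _ (vertex_mem_grading k x),
        vertex_mul_self])
    (fun x y h => by
      rw [← hf.zero_zero _ (vertex_mem_grading k x) _ (vertex_mem_grading k y),
        vertex_mul_vertex_of_ne k h, map_zero])
    (by rw [← map_sum, ← PathAlgebra.one_def, hf.map_one])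
    (fun {x y} a => by
      rw [← hf.zero_one _ (vertex_mem_grading k y) _ (arrow_mem_grading k a), vertex_mul_arrow])
    (fun {x y} a => by
      rw [← hf.one_zero _ (arrow_mem_grading k a) _ (vertex_mem_grading k x), arrow_mul_vertex])
  refine ⟨F, fun i hi a ha => ?_⟩
  suffices h : grading k V i ≤ LinearMap.eqLocus F.toLinearMap f from h ha
  interval_cases i
  · rw [grading_zero, Submodule.span_le]
    rintro _ ⟨x, rfl⟩
    exact h₀ x
  · rw [grading_one, Submodule.span_le]
    rintro _ ⟨a, rfl⟩
    exact h₁ a.2.2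

end LowDegree

/-! ### The antipode axiom is stable under products -/

section AntipodeIdentities

variable {k A : Type*} [Field k] [Ring A] [Algebra k A]

/-- With `u = Δ a` and `v = Δ b`, the expression `S(b₁) S(a₁) a₂ b₂` collapses from the inside, the
scalar `ε(a)` being central. Hence the elements that satisfy the antipode axiom are closed under
multiplication, and the axiom can be checked on generators. -/
theorem mul_rTensor_mul {S : A →ₗ[k] A} (hS : ∀ a b, S (a * b) = S b * S a) {u : A ⊗[k] A}
    {r : k} (hu : LinearMap.mul' k A (S.rTensor A u) = algebraMap k A r) (v : A ⊗[k] A) :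
    LinearMap.mul' k A (S.rTensor A (u * v)) = r • LinearMap.mul' k A (S.rTensor A v) := by
  induction v using TensorProduct.induction_on with
  | zero => simp
  | add v w hv hw => simp only [mul_add, map_add, hv, hw, smul_add]
  | tmul c d =>
    have key : LinearMap.mul' k A (S.rTensor A (u * c ⊗ₜ d)) =
        S c * LinearMap.mul' k A (S.rTensor A u) * d := by
      clear hu
      induction u using TensorProduct.induction_on with
      | zero => simp
      | add v w hv hw => simp only [add_mul, mul_add, map_add, hv, hw]
      | tmul a b => simp [hS, mul_assoc]
    rw [key, hu, ← Algebra.commutes, mul_assoc, ← Algebra.smul_def]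
    simp

/-- In the mirror image the inner factor of `a₁ b₁ S(b₂) S(a₂)` comes from the right-hand tensor
`v`, so the hypothesis is on `v` rather than `u`. -/
theorem mul_lTensor_mul {S : A →ₗ[k] A} (hS : ∀ a b, S (a * b) = S b * S a) {v : A ⊗[k] A}
    {r : k} (hv : LinearMap.mul' k A (S.lTensor A v) = algebraMap k A r) (u : A ⊗[k] A) :
    LinearMap.mul' k A (S.lTensor A (u * v)) = r • LinearMap.mul' k A (S.lTensor A u) := by
  induction u using TensorProduct.induction_on with
  | zero => simp
  | add v w hv hw => simp only [add_mul, map_add, hv, hw, smul_add]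
  | tmul a b =>
    have key : LinearMap.mul' k A (S.lTensor A (a ⊗ₜ b * v)) =
        a * LinearMap.mul' k A (S.lTensor A v) * S b := by
      clear hv
      induction v using TensorProduct.induction_on with
      | zero => simp
      | add v w hv hw => simp only [add_mul, mul_add, map_add, hv, hw]
      | tmul c d => simp [hS, mul_assoc]
    rw [key, hv, ← Algebra.commutes, mul_assoc, ← Algebra.smul_def]
    simp

end AntipodeIdentities

/-! ### Homogeneous components and powers of the arrow ideal -/

section Projections

variable {k A : Type*} [Field k]

theorem DirectSum.IsInternal.exists_proj [AddCommGroup A] [Module k A] {𝒜 : ℕ → Submodule k A}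
    (h : DirectSum.IsInternal 𝒜) :
    ∃ p : ℕ → A →ₗ[k] A, (∀ n, ∀ a, p n a ∈ 𝒜 n) ∧ (∀ n, ∀ a ∈ 𝒜 n, p n a = a) ∧
      ∀ m n, m ≠ n → ∀ a ∈ 𝒜 m, p n a = 0 := by
  classical
  let e := LinearEquiv.ofBijective (DirectSum.coeLinearMap 𝒜) h
  have he : ∀ n (a : 𝒜 n), e.symm a = DirectSum.lof k ℕ (fun n => 𝒜 n) n a := fun n a => by
    rw [LinearEquiv.symm_apply_eq]
    exact (DirectSum.coeLinearMap_lof 𝒜 n a).symm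
  refine ⟨fun n => (𝒜 n).subtype ∘ₗ DirectSum.component k ℕ (fun n => 𝒜 n) n ∘ₗ e.symm.toLinearMap,
    fun n a => Subtype.prop _, fun n a ha => ?_, fun m n hmn a ha => ?_⟩
  · have := he n ⟨a, ha⟩
    simp only at this
    simp [this]
  · have := he m ⟨a, ha⟩
    simp only at this
    simp [this, DirectSum.component.of, hmn]

variable {V : Type*} [Quiver V] [Fintype V] [Ring A] [Algebra k A]

theorem PathAlgebra.map_mem_of_generators (F : PathAlgebra k V →ₐ[k] A)
    {𝒜 : ℕ → Submodule k A} (h𝒜 : ∀ i j : ℕ, ∀ a ∈ 𝒜 i, ∀ b ∈ 𝒜 j, a * b ∈ 𝒜 (i + j))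
    (hF : ∀ i ≤ 1, ∀ a ∈ grading k V i, F a ∈ 𝒜 i) :
    ∀ n, ∀ a ∈ grading k V n, F a ∈ 𝒜 n := by
  intro n
  suffices h : grading k V n ≤ (𝒜 n).comap F.toLinearMap from fun a ha => h ha
  refine Submodule.span_le.mpr ?_
  rintro _ ⟨⟨x, y, p⟩, rfl, rfl⟩
  change F (single k ⟨x, y, p⟩) ∈ 𝒜 p.length
  induction p with
  | nil => exact hF 0 zero_le_one _ (vertex_mem_grading k x)
  | cons p a ih =>
    rw [← arrow_mul_single, map_mul, Quiver.Path.length_cons, add_comm]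
    exact h𝒜 _ _ _ (hF 1 le_rfl _ (arrow_mem_grading k a)) _ ih

/-- Every element of the path algebra is the sum of its parts of degree `0` and `1` and of a
combination of paths of length at least `2`. -/
theorem PathAlgebra.exists_decomposition (f : PathAlgebra k V) :
    ∃ f₀ ∈ grading k V 0, ∃ f₁ ∈ grading k V 1, ∃ f₂ ∈ Submodule.span k
      (single k '' {p : QuiverPath V | 2 ≤ p.2.2.length}), f = f₀ + f₁ + f₂ := by
  induction f using induction_basis with
  | zero =>
    exact ⟨0, Submodule.zero_mem _, 0, Submodule.zero_mem _, 0, Submodule.zero_mem _, by simp⟩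
  | add f g hf hg =>
    obtain ⟨f₀, h₀, f₁, h₁, f₂, h₂, rfl⟩ := hf
    obtain ⟨g₀, h₀', g₁, h₁', g₂, h₂', rfl⟩ := hg
    exact ⟨_, Submodule.add_mem _ h₀ h₀', _, Submodule.add_mem _ h₁ h₁', _,
      Submodule.add_mem _ h₂ h₂', by abel⟩
  | smul c f hf =>
    obtain ⟨f₀, h₀, f₁, h₁, f₂, h₂, rfl⟩ := hf
    exact ⟨_, Submodule.smul_mem _ c h₀, _, Submodule.smul_mem _ c h₁, _,
      Submodule.smul_mem _ c h₂, by simp⟩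
  | single p =>
    rcases Nat.lt_or_ge p.2.2.length 2 with h | h
    · rcases Nat.eq_zero_or_pos p.2.2.length with h' | h'
      · exact ⟨_, Submodule.subset_span ⟨p, h', rfl⟩, 0, Submodule.zero_mem _, 0,
          Submodule.zero_mem _, by simp⟩
      · exact ⟨0, Submodule.zero_mem _, _, Submodule.subset_span ⟨p, by grind, rfl⟩, 0,
          Submodule.zero_mem _, by simp⟩
    · exact ⟨0, Submodule.zero_mem _, 0, Submodule.zero_mem _, _,
        Submodule.subset_span ⟨p, h, rfl⟩, by simp⟩

theorem PathAlgebra.span_le_arrowIdeal_sq :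
    Submodule.span k (single k '' {p : QuiverPath V | 2 ≤ p.2.2.length}) ≤
      arrowIdeal k V ^ 2 := by
  refine Submodule.span_le.mpr ?_
  rintro _ ⟨⟨x, y, p⟩, hp, rfl⟩
  cases p with
  | nil => simp at hp
  | cons p a =>
    rw [← arrow_mul_single, sq]
    refine Submodule.mul_mem_mul (Submodule.subset_span ⟨⟨_, _, a.toPath⟩, Nat.le_refl 1, rfl⟩)
      (Submodule.subset_span ⟨_, ?_, rfl⟩)
    simp only [Set.mem_ofPred_eq, Quiver.Path.length_cons] at hp ⊢
    omega

theorem PathAlgebra.arrowIdeal_pow_le (m : ℕ) :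
    arrowIdeal k V ^ m ≤ Submodule.span k (single k '' {p : QuiverPath V | m ≤ p.2.2.length}) := by
  induction m with
  | zero =>
    rintro f -
    induction f using induction_basis with
    | zero => exact Submodule.zero_mem _
    | add f g hf hg => exact Submodule.add_mem _ hf hg
    | smul c f hf => exact Submodule.smul_mem _ c hf
    | single p => exact Submodule.subset_span ⟨p, Nat.zero_le _, rfl⟩
  | succ m ih =>
    rw [pow_succ]
    refine (mul_le_mul' ih le_rfl).trans ?_
    rw [arrowIdeal, Submodule.span_mul_span, Submodule.span_le]
    rintro _ ⟨_, ⟨⟨a, b, p⟩, hp, rfl⟩, _, ⟨⟨c, d, q⟩, hq, rfl⟩, rfl⟩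
    simp only [Set.mem_ofPred_eq] at hp hq
    change single k _ * single k _ ∈ _
    rw [single_mul_single]
    by_cases h : d = a
    · subst h
      rw [concat_of_eq]
      refine Submodule.subset_span ⟨_, ?_, rfl⟩
      simp only [Set.mem_ofPred_eq, Quiver.Path.length_comp]
      omega
    · rw [concat_of_ne (p := ⟨a, b, p⟩) (q := ⟨c, d, q⟩) h]
      exact Submodule.zero_mem _

end Projections

/-! ### Lifting a graded quasitriangular Hopf algebra to a path algebra -/

section PathCover

variable {k V B : Type*} [Field k] [Quiver V] [Fintype V] [Ring B] [HopfAlgebra k B]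

/-- `π` maps the path algebra of `V` onto the graded algebra `B`, and is bijective in degrees `0`
and `1`, where `σ` is its inverse. -/
structure PathCover (ℬ : ℕ → Submodule k B) (π : PathAlgebra k V →ₐ[k] B)
    (σ : B →ₗ[k] PathAlgebra k V) : Prop where
  map_mem : ∀ n, ∀ a ∈ PathAlgebra.grading k V n, π a ∈ ℬ n
  surj : ∀ n, ∀ b ∈ ℬ n, ∃ a ∈ PathAlgebra.grading k V n, π a = b
  leftInv : ∀ i ≤ 1, ∀ a ∈ PathAlgebra.grading k V i, σ (π a) = a

variable {ℬ : ℕ → Submodule k B} {π : PathAlgebra k V →ₐ[k] B} {σ : B →ₗ[k] PathAlgebra k V}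

namespace PathCover

theorem section_mem (h : PathCover ℬ π σ) {i : ℕ} (hi : i ≤ 1) {b : B} (hb : b ∈ ℬ i) :
    σ b ∈ PathAlgebra.grading k V i := by
  obtain ⟨a, ha, rfl⟩ := h.surj i b hb
  rwa [h.leftInv i hi a ha]

theorem rightInv (h : PathCover ℬ π σ) {i : ℕ} (hi : i ≤ 1) {b : B} (hb : b ∈ ℬ i) :
    π (σ b) = b := by
  obtain ⟨a, ha, rfl⟩ := h.surj i b hb
  rw [h.leftInv i hi a ha]

/-- The product is again in a degree where `σ` inverts `π`; this limits multiplicativity of `σ` to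
total degree at most `1`. In higher degrees nothing is known about `σ`. -/
theorem mulOn (h : PathCover ℬ π σ) {i j : ℕ} (hij : i + j ≤ 1) : MulOn σ (ℬ i) (ℬ j) := by
  intro a ha b hb
  obtain ⟨a, ha', rfl⟩ := h.surj i a ha
  obtain ⟨b, hb', rfl⟩ := h.surj j b hb
  rw [← map_mul, h.leftInv _ hij _ (PathAlgebra.grading_mul k ha' hb'),
    h.leftInv i (by omega) a ha', h.leftInv j (by omega) b hb']

theorem lowMul (h : PathCover ℬ π σ) : LowMul ℬ σ where
  map_one := by
    rw [← map_one π, h.leftInv 0 zero_le_one _ PathAlgebra.one_mem_grading]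
  zero_zero := h.mulOn (by omega)
  zero_one := h.mulOn (by omega)
  one_zero := h.mulOn (by omega)

theorem algHom_ext {A : Type*} [Ring A] [Algebra k A] (h : PathCover ℬ π σ)
    {f g : PathAlgebra k V →ₐ[k] A} (hfg : ∀ i ≤ 1, ∀ b ∈ ℬ i, f (σ b) = g (σ b)) : f = g := by
  refine PathAlgebra.algHom_ext (fun a ha => ?_) (fun a ha => ?_)
  · rw [← h.leftInv 0 zero_le_one a ha]
    exact hfg 0 zero_le_one _ (h.map_mem 0 a ha)
  · rw [← h.leftInv 1 le_rfl a ha]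
    exact hfg 1 le_rfl _ (h.map_mem 1 a ha)

/-- Vertices and arrows are values of `σ` at elements of degree `0` and `1`, so a property that
defines a subalgebra of the path algebra need only be tested where the Hopf structure of `B`
computes everything. -/
theorem mem_of_section (h : PathCover ℬ π σ) (S : Subalgebra k (PathAlgebra k V))
    (hS : ∀ i ≤ 1, ∀ b ∈ ℬ i, σ b ∈ S) (a : PathAlgebra k V) : a ∈ S :=
  PathAlgebra.mem_of_generators S
    (fun x => by
      have hx := PathAlgebra.vertex_mem_grading k x
      rw [← h.leftInv 0 zero_le_one _ hx]
      exact hS 0 zero_le_one _ (h.map_mem 0 _ hx))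
    (fun b => by
      have hb := PathAlgebra.arrow_mem_grading k b
      rw [← h.leftInv 1 le_rfl _ hb]
      exact hS 1 le_rfl _ (h.map_mem 1 _ hb)) a

/-- The linear map `(σ ⊗ σ) ∘ Δ ∘ π` respects products of degree at most `1`, because `Δ` is a
graded algebra map and `σ ⊗ σ` respects such products. The universal property of the path algebra
turns it into an algebra map. -/
theorem exists_comul (h : PathCover ℬ π σ) (hB : IsGradedHopf k ℬ) :
    ∃ Δ : PathAlgebra k V →ₐ[k] PathAlgebra k V ⊗[k] PathAlgebra k V,
      ∀ i ≤ 1, ∀ b ∈ ℬ i, Δ (σ b) = TensorProduct.map σ σ (Coalgebra.comul (R := k) b) := by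
  obtain ⟨Δ, hΔ⟩ := PathAlgebra.exists_extension
    (((h.lowMul.tensor h.lowMul).comp_algHom (Bialgebra.comulAlgHom k B) hB.comul_mem).comp_algHom π h.map_mem)
  refine ⟨Δ, fun i hi b hb => ?_⟩
  rw [hΔ i hi _ (h.section_mem hi hb)]
  simp [h.rightInv hi hb]

/-- An antipode reverses products, so the universal property is applied with the opposite algebra as
target. -/
theorem exists_antipode (h : PathCover ℬ π σ) (hB : IsGradedHopf k ℬ) :
    ∃ S : PathAlgebra k V →ₐ[k] (PathAlgebra k V)ᵐᵒᵖ,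
      ∀ i ≤ 1, ∀ b ∈ ℬ i, S (σ b) = MulOpposite.op (σ (HopfAlgebra.antipode k b)) := by
  have low : LowMul ℬ ((MulOpposite.opLinearEquiv k).toLinearMap ∘ₗ σ ∘ₗ
      HopfAlgebra.antipode k (A := B)) := by
    have key : ∀ i j : ℕ, i + j ≤ 1 → MulOn ((MulOpposite.opLinearEquiv k).toLinearMap ∘ₗ σ ∘ₗ
        HopfAlgebra.antipode k (A := B)) (ℬ i) (ℬ j) := by
      intro i j hij a ha b hb
      simp only [LinearMap.comp_apply, HopfAlgebra.antipode_mul_antidistrib,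
        h.mulOn (show j + i ≤ 1 by omega) _ (hB.antipode_mem j b hb) _ (hB.antipode_mem i a ha)]
      rfl
    exact ⟨by simp [h.lowMul.map_one], key 0 0 (by omega), key 0 1 (by omega), key 1 0 (by omega)⟩
  obtain ⟨S, hS⟩ := PathAlgebra.exists_extension (low.comp_algHom π h.map_mem)
  refine ⟨S, fun i hi b hb => ?_⟩
  rw [hS i hi _ (h.section_mem hi hb)]
  simp [h.rightInv hi hb]

theorem mul'_map (h : PathCover ℬ π σ) {i : ℕ} (hi : i ≤ 1) {x : B ⊗[k] B}
    (hx : x ∈ tensorPiece ℬ i) :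
    LinearMap.mul' k _ (TensorProduct.map σ σ x) = σ (LinearMap.mul' k B x) := by
  induction hx using Submodule.span_induction with
  | zero => simp
  | add x y _ _ hx hy => simp only [map_add, hx, hy]
  | smul c x _ hx => simp only [map_smul, hx]
  | mem x hx =>
    obtain ⟨m, n, rfl, a, ha, b, hb, rfl⟩ := hx
    simp [h.mulOn hi a ha b hb]

/-- The Hopf algebra structure of `B` lifts to the path algebra. -/
theorem exists_hopf (h : PathCover ℬ π σ) (hB : IsGradedHopf k ℬ) :
    ∃ A : HopfStructure k (PathAlgebra k V),
      (∀ i ≤ 1, ∀ b ∈ ℬ i, A.comul (σ b) =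
        TensorProduct.map σ σ (Coalgebra.comul (R := k) b)) ∧
      (∀ a, A.counit a = Coalgebra.counit (R := k) (π a)) ∧
      (∀ i ≤ 1, ∀ b ∈ ℬ i, A.antipode (σ b) = σ (HopfAlgebra.antipode k b)) := by
  obtain ⟨Δ, hΔ⟩ := h.exists_comul hB
  obtain ⟨T, hT⟩ := h.exists_antipode hB
  let S : PathAlgebra k V →ₗ[k] PathAlgebra k V :=
    (MulOpposite.opLinearEquiv k).symm.toLinearMap ∘ₗ T.toLinearMap
  have hSm : ∀ a b, S (a * b) = S b * S a := fun a b => by simp [S]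
  have hS : ∀ i ≤ 1, ∀ b ∈ ℬ i, S (σ b) = σ (HopfAlgebra.antipode k b) := fun i hi b hb => by
    simp [S, hT i hi b hb]
  let ε : PathAlgebra k V →ₐ[k] k := (Bialgebra.counitAlgHom k B).comp π
  have hε : ∀ i ≤ 1, ∀ b ∈ ℬ i, ε (σ b) = Coalgebra.counit (R := k) b := fun i hi b hb => by
    simp [ε, h.rightInv hi hb]
  have antipode_left : ∀ a, LinearMap.mul' k _ (S.rTensor _ (Δ a)) =
      algebraMap k _ (ε a) := by
    -- The axiom is not an equality of algebra maps, so agreement on generators does not settle it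
    -- directly. The elements which satisfy it do form a subalgebra, by `mul_rTensor_mul`.
    let K : Subalgebra k (PathAlgebra k V) :=
      { carrier := {a | LinearMap.mul' k _ (S.rTensor _ (Δ a)) = algebraMap k _ (ε a)}
        mul_mem' := fun {a b} ha hb => by
          simp only [Set.mem_ofPred_eq] at ha hb ⊢
          rw [map_mul, mul_rTensor_mul hSm ha, hb, map_mul, map_mul, Algebra.smul_def]
        add_mem' := fun {a b} ha hb => by
          simp only [Set.mem_ofPred_eq] at ha hb ⊢
          simp only [map_add, ha, hb]
        algebraMap_mem' := fun r => by
          simp [Algebra.algebraMap_eq_smul_one, Algebra.TensorProduct.one_def, S] }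
    intro a
    refine h.mem_of_section K (fun i hi b hb => ?_) a
    change LinearMap.mul' k _ (S.rTensor _ (Δ (σ b))) = algebraMap k _ (ε (σ b))
    -- Both legs of `Δ b` have degree at most `i ≤ 1`, and there `S ∘ σ` is `σ` composed with the
    -- antipode of `B`.
    have e : S.rTensor _ (TensorProduct.map σ σ (Coalgebra.comul (R := k) b)) =
        TensorProduct.map σ σ ((HopfAlgebra.antipode k).rTensor B (Coalgebra.comul (R := k) b)) := by
      rw [LinearMap.rTensor_map, LinearMap.map_rTensor]
      exact map_eq_map_of_mem_tensorPiece (fun j hj x hx => hS j (hj.trans hi) x hx)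
        (fun _ _ _ _ => rfl) (hB.comul_mem i b hb)
    have hm : (HopfAlgebra.antipode k).rTensor B (Coalgebra.comul (R := k) b) ∈ tensorPiece ℬ i :=
      map_mem_tensorPiece (fun j _ x hx => hB.antipode_mem j x hx) (fun _ _ _ hx => hx)
        (hB.comul_mem i b hb)
    rw [hΔ i hi b hb, e, h.mul'_map hi hm,
      HopfAlgebra.mul_antipode_rTensor_comul_apply, hε i hi b hb,
      Algebra.algebraMap_eq_smul_one, map_smul, h.lowMul.map_one, Algebra.algebraMap_eq_smul_one]
  have antipode_right : ∀ a, LinearMap.mul' k _ (S.lTensor _ (Δ a)) =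
      algebraMap k _ (ε a) := by
    let K : Subalgebra k (PathAlgebra k V) :=
      { carrier := {a | LinearMap.mul' k _ (S.lTensor _ (Δ a)) = algebraMap k _ (ε a)}
        mul_mem' := fun {a b} ha hb => by
          simp only [Set.mem_ofPred_eq] at ha hb ⊢
          rw [map_mul, mul_lTensor_mul hSm hb, ha, map_mul, map_mul, Algebra.smul_def,
            Algebra.commutes]
        add_mem' := fun {a b} ha hb => by
          simp only [Set.mem_ofPred_eq] at ha hb ⊢
          simp only [map_add, ha, hb]
        algebraMap_mem' := fun r => by
          simp [Algebra.algebraMap_eq_smul_one, Algebra.TensorProduct.one_def, S] }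
    intro a
    refine h.mem_of_section K (fun i hi b hb => ?_) a
    change LinearMap.mul' k _ (S.lTensor _ (Δ (σ b))) = algebraMap k _ (ε (σ b))
    have e : S.lTensor _ (TensorProduct.map σ σ (Coalgebra.comul (R := k) b)) =
        TensorProduct.map σ σ ((HopfAlgebra.antipode k).lTensor B (Coalgebra.comul (R := k) b)) := by
      rw [LinearMap.lTensor_map, LinearMap.map_lTensor]
      exact map_eq_map_of_mem_tensorPiece (fun _ _ _ _ => rfl)
        (fun j hj x hx => hS j (hj.trans hi) x hx) (hB.comul_mem i b hb)
    have hm : (HopfAlgebra.antipode k).lTensor B (Coalgebra.comul (R := k) b) ∈ tensorPiece ℬ i :=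
      map_mem_tensorPiece (fun _ _ _ hx => hx) (fun j _ x hx => hB.antipode_mem j x hx)
        (hB.comul_mem i b hb)
    rw [hΔ i hi b hb, e, h.mul'_map hi hm,
      HopfAlgebra.mul_antipode_lTensor_comul_apply, hε i hi b hb,
      Algebra.algebraMap_eq_smul_one, map_smul, h.lowMul.map_one, Algebra.algebraMap_eq_smul_one]
  refine ⟨⟨Δ, ε, S, ?_, ?_, ?_, antipode_left, antipode_right⟩, hΔ, fun _ => rfl, hS⟩
  -- Both sides are algebra maps, so they are compared at `σ b`. As all legs of `Δ b` have degree at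
  -- most `1`, each lifted comultiplication can be exchanged with `σ`, and the identity becomes the
  -- image under `σ ⊗ σ ⊗ σ` of coassociativity in `B`.
  · refine h.algHom_ext fun i hi b hb => ?_
    have hb' := hB.comul_mem i b hb
    change TensorProduct.assoc k _ _ _ (TensorProduct.map Δ.toLinearMap LinearMap.id (Δ (σ b))) =
      TensorProduct.map LinearMap.id Δ.toLinearMap (Δ (σ b))
    rw [hΔ i hi b hb,
      map_map_eq_of_mem_tensorPiece (f₂ := Δ.toLinearMap) (f₂' := TensorProduct.map σ σ)
        (f₁' := Coalgebra.comul (R := k)) (g₂ := LinearMap.id) (g₂' := σ) (g₁' := LinearMap.id) hb'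
        (fun j hj x hx => hΔ j (hj.trans hi) x hx) (fun _ _ _ _ => rfl),
      map_map_eq_of_mem_tensorPiece (g₂ := Δ.toLinearMap) (g₂' := TensorProduct.map σ σ)
        (g₁' := Coalgebra.comul (R := k)) (f₂ := LinearMap.id) (f₂' := σ) (f₁' := LinearMap.id) hb'
        (fun _ _ _ _ => rfl) (fun j hj x hx => hΔ j (hj.trans hi) x hx),
      ← TensorProduct.map_map_assoc]
    exact congrArg _ (Coalgebra.coassoc_apply b)
  · refine h.algHom_ext fun i hi b hb => ?_
    apply (Algebra.TensorProduct.lid k (PathAlgebra k V)).injective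
    refine Eq.trans ?_ (AlgEquiv.apply_symm_apply _ (σ b)).symm
    change TensorProduct.lid k _ (TensorProduct.map ε.toLinearMap LinearMap.id (Δ (σ b))) = σ b
    rw [hΔ i hi b hb,
      map_map_eq_of_mem_tensorPiece (f₂ := ε.toLinearMap) (f₂' := LinearMap.id)
        (f₁' := Coalgebra.counit (R := k)) (g₂ := LinearMap.id) (g₂' := σ) (g₁' := LinearMap.id)
        (hB.comul_mem i b hb) (fun j hj x hx => hε j (hj.trans hi) x hx) (fun _ _ _ _ => rfl)]
    have := Coalgebra.rTensor_counit_comul (R := k) b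
    rw [LinearMap.rTensor] at this
    rw [this]
    simp
  · refine h.algHom_ext fun i hi b hb => ?_
    apply (Algebra.TensorProduct.rid k k (PathAlgebra k V)).injective
    refine Eq.trans ?_ (AlgEquiv.apply_symm_apply _ (σ b)).symm
    change TensorProduct.rid k _ (TensorProduct.map LinearMap.id ε.toLinearMap (Δ (σ b))) = σ b
    rw [hΔ i hi b hb,
      map_map_eq_of_mem_tensorPiece (g₂ := ε.toLinearMap) (g₂' := LinearMap.id)
        (g₁' := Coalgebra.counit (R := k)) (f₂ := LinearMap.id) (f₂' := σ) (f₁' := LinearMap.id)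
        (hB.comul_mem i b hb) (fun _ _ _ _ => rfl) (fun j hj x hx => hε j (hj.trans hi) x hx)]
    have := Coalgebra.lTensor_counit_comul (R := k) b
    rw [LinearMap.lTensor] at this
    rw [this]
    simp

end PathCover

end PathCover

/-! ### Placing a tensor of two factors into three -/

section LegEmbeddings

variable {k A B : Type*} [Field k] [Ring A] [Algebra k A] [Ring B] [Algebra k B]
  {σ : B →ₗ[k] A}

/-- The inserted leg is `1`, so only `σ 1 = 1` is needed and `σ` may fail to be multiplicative. With
its three variants this transports `R₁₃`, `R₂₃` and `R₁₂`. -/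
theorem map_includeLeft_left (hσ : σ 1 = 1) (u : B ⊗[k] B) :
    TensorProduct.map (TensorProduct.map σ σ) σ
    (Algebra.TensorProduct.map (Algebra.TensorProduct.includeLeft : B →ₐ[k] B ⊗[k] B)
      (AlgHom.id k B) u) =
    Algebra.TensorProduct.map (Algebra.TensorProduct.includeLeft : A →ₐ[k] A ⊗[k] A)
      (AlgHom.id k A) (TensorProduct.map σ σ u) := by
  induction u using TensorProduct.induction_on with
  | zero => simp
  | add x y hx hy => simp only [map_add, hx, hy]
  | tmul x y => simp [hσ]

theorem map_includeRight_left (hσ : σ 1 = 1) (u : B ⊗[k] B) :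
    TensorProduct.map (TensorProduct.map σ σ) σ
    (Algebra.TensorProduct.map (Algebra.TensorProduct.includeRight : B →ₐ[k] B ⊗[k] B)
      (AlgHom.id k B) u) =
    Algebra.TensorProduct.map (Algebra.TensorProduct.includeRight : A →ₐ[k] A ⊗[k] A)
      (AlgHom.id k A) (TensorProduct.map σ σ u) := by
  induction u using TensorProduct.induction_on with
  | zero => simp
  | add x y hx hy => simp only [map_add, hx, hy]
  | tmul x y => simp [hσ]

theorem map_includeLeft_right (hσ : σ 1 = 1) (u : B ⊗[k] B) :
    TensorProduct.map σ (TensorProduct.map σ σ)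
    (Algebra.TensorProduct.map (AlgHom.id k B)
      (Algebra.TensorProduct.includeLeft : B →ₐ[k] B ⊗[k] B) u) =
    Algebra.TensorProduct.map (AlgHom.id k A)
      (Algebra.TensorProduct.includeLeft : A →ₐ[k] A ⊗[k] A) (TensorProduct.map σ σ u) := by
  induction u using TensorProduct.induction_on with
  | zero => simp
  | add x y hx hy => simp only [map_add, hx, hy]
  | tmul x y => simp [hσ]

theorem map_includeRight_right (hσ : σ 1 = 1) (u : B ⊗[k] B) :
    TensorProduct.map σ (TensorProduct.map σ σ)
    (Algebra.TensorProduct.map (AlgHom.id k B)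
      (Algebra.TensorProduct.includeRight : B →ₐ[k] B ⊗[k] B) u) =
    Algebra.TensorProduct.map (AlgHom.id k A)
      (Algebra.TensorProduct.includeRight : A →ₐ[k] A ⊗[k] A) (TensorProduct.map σ σ u) := by
  induction u using TensorProduct.induction_on with
  | zero => simp
  | add x y hx hy => simp only [map_add, hx, hy]
  | tmul x y => simp [hσ]

end LegEmbeddings

/-! ### From a path cover to a presentation -/

section Presentation

variable {k V B : Type*} [Field k] [Quiver V] [Fintype V] [Ring B] [HopfAlgebra k B]
  {ℬ : ℕ → Submodule k B} {π : PathAlgebra k V →ₐ[k] B} {σ : B →ₗ[k] PathAlgebra k V}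

/-- `A` is a lift to the path algebra of the Hopf algebra structure of `B`. -/
structure PathCover.IsLift (ℬ : ℕ → Submodule k B) (π : PathAlgebra k V →ₐ[k] B)
    (σ : B →ₗ[k] PathAlgebra k V) (A : HopfStructure k (PathAlgebra k V)) : Prop
    extends PathCover ℬ π σ where
  isGradedHopf : IsGradedHopf k ℬ
  comul_section : ∀ i ≤ 1, ∀ b ∈ ℬ i, A.comul (σ b) =
    TensorProduct.map σ σ (Coalgebra.comul (R := k) b)
  counit_eq : ∀ a, A.counit a = Coalgebra.counit (R := k) (π a)
  antipode_section : ∀ i ≤ 1, ∀ b ∈ ℬ i, A.antipode (σ b) = σ (HopfAlgebra.antipode k b)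

namespace PathCover.IsLift

variable {A : HopfStructure k (PathAlgebra k V)}

theorem gradedHopf (h : IsLift ℬ π σ A) :
    letI := A.toHopfAlgebra
    IsGradedHopf k (PathAlgebra.grading k V) := by
  let := A.toHopfAlgebra
  have hB := h.isGradedHopf
  refine ⟨PathAlgebra.grading_isInternal k, PathAlgebra.one_mem_grading,
    fun i j a ha b hb => PathAlgebra.grading_mul k ha hb, ?_, ?_, ?_⟩
  · refine PathAlgebra.map_mem_of_generators A.comul
      (fun i j a ha b hb => tensorPiece_mul (fun _ _ _ ha _ hb => PathAlgebra.grading_mul k ha hb)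
        ha hb) (fun i hi a ha => ?_)
    rw [← h.leftInv i hi a ha, h.comul_section i hi _ (h.map_mem i a ha)]
    exact map_mem_tensorPiece (fun j hj b hb => h.section_mem (hj.trans hi) hb)
      (fun j hj b hb => h.section_mem (hj.trans hi) hb) (hB.comul_mem i _ (h.map_mem i a ha))
  · intro n hn a ha
    exact (h.counit_eq a).trans (hB.counit_eq_zero n hn _ (h.map_mem n a ha))
  -- The antipode is an algebra map into the opposite algebra, which is graded by the same
  -- subspaces; the reversed order of factors is absorbed by commutativity of addition of degrees.
  · have := PathAlgebra.map_mem_of_generators (HopfAlgebra.antipodeAlgHomOp k (PathAlgebra k V))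
      (𝒜 := fun n => (PathAlgebra.grading k V n).comap
        (MulOpposite.opLinearEquiv k).symm.toLinearMap)
      (fun i j a ha b hb => by
        rw [add_comm]
        exact PathAlgebra.grading_mul k hb ha)
      (fun i hi a ha => by
        change A.antipode a ∈ PathAlgebra.grading k V i
        rw [← h.leftInv i hi a ha, h.antipode_section i hi _ (h.map_mem i a ha)]
        exact h.section_mem hi (hB.antipode_mem i _ (h.map_mem i a ha)))
    exact this

theorem map_comul (h : IsLift ℬ π σ A) (a : PathAlgebra k V) :
    TensorProduct.map π.toLinearMap π.toLinearMap (A.comul a) = Coalgebra.comul (R := k) (π a) := by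
  have : (Algebra.TensorProduct.map π π).comp A.comul = (Bialgebra.comulAlgHom k B).comp π := by
    refine h.algHom_ext fun i hi b hb => ?_
    change TensorProduct.map π.toLinearMap π.toLinearMap (A.comul (σ b)) =
      Coalgebra.comul (R := k) (π (σ b))
    rw [h.comul_section i hi b hb, h.rightInv hi hb,
      map_map_eq_of_mem_tensorPiece (f₁' := LinearMap.id) (f₂' := LinearMap.id)
        (g₁' := LinearMap.id) (g₂' := LinearMap.id) (h.isGradedHopf.comul_mem i b hb)
        (fun j hj x hx => h.rightInv (hj.trans hi) hx) (fun j hj x hx => h.rightInv (hj.trans hi) hx)]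
    simp
  exact DFunLike.congr_fun this a

theorem map_antipode (h : IsLift ℬ π σ A) (a : PathAlgebra k V) :
    π (A.antipode a) = HopfAlgebra.antipode k (π a) := by
  let := A.toHopfAlgebra
  have : (AlgHom.op π).comp (HopfAlgebra.antipodeAlgHomOp k (PathAlgebra k V)) =
      (HopfAlgebra.antipodeAlgHomOp k B).comp π := by
    refine h.algHom_ext fun i hi b hb => MulOpposite.unop_injective ?_
    change π (A.antipode (σ b)) = HopfAlgebra.antipode k (π (σ b))
    rw [h.antipode_section i hi b hb, h.rightInv hi hb,
      h.rightInv hi (h.isGradedHopf.antipode_mem i b hb)]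
  exact congrArg MulOpposite.unop (DFunLike.congr_fun this a)

/-- `R` and its inverse have degree `0`, where tensor powers of `σ` are multiplicative, so the
identities in `R` alone are carried over. The elements `a` with `Δᵒ(a) R = R Δ(a)` form a
subalgebra, and for `a = σ b` of degree at most `1` only products of a tensor of degree at most `1`
with one of degree `0` occur. The inverse `R'` is given explicitly because it too must have degree
`0`. -/
theorem isUniversalRMatrix (h : IsLift ℬ π σ A) {R R' : B ⊗[k] B} (hR : IsUniversalRMatrix k B R)
    (hR₀ : R ∈ tensorPiece ℬ 0) (hR₀' : R' ∈ tensorPiece ℬ 0) (h₁ : R * R' = 1)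
    (h₂ : R' * R = 1) :
    letI := A.toHopfAlgebra
    IsUniversalRMatrix k (PathAlgebra k V) (TensorProduct.map σ σ R) := by
  let := A.toHopfAlgebra
  have hB := h.isGradedHopf
  have low := h.lowMul.tensor h.lowMul
  have hΔ₀ : ∀ j ≤ 0, ∀ x ∈ ℬ j, A.comul.toLinearMap (σ x) =
      TensorProduct.map σ σ (Coalgebra.comul (R := k) x) :=
    fun j hj x hx => h.comul_section j (by omega) x hx
  have hlm : ∀ x ∈ ℬ 0, (Algebra.TensorProduct.includeLeft : B →ₐ[k] B ⊗[k] B).toLinearMap x ∈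
      tensorPiece ℬ 0 := fun x hx => tmul_mem_tensorPiece (zero_add 0) hx hB.one_mem
  have hrm : ∀ x ∈ ℬ 0, (Algebra.TensorProduct.includeRight : B →ₐ[k] B ⊗[k] B).toLinearMap x ∈
      tensorPiece ℬ 0 := fun x hx => tmul_mem_tensorPiece (zero_add 0) hB.one_mem hx
  have hR₀s : R ∈ tensorSub (ℬ 0) (ℬ 0) := tensorPiece_zero ℬ ▸ hR₀
  refine ⟨⟨⟨_, TensorProduct.map σ σ R', ?_, ?_⟩, rfl⟩, ?_, ?_, ?_⟩
  · rw [← low.zero_zero _ hR₀ _ hR₀', h₁, low.map_one]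
  · rw [← low.zero_zero _ hR₀' _ hR₀, h₂, low.map_one]
  · have m₁₃ : Algebra.TensorProduct.map (Algebra.TensorProduct.includeLeft : B →ₐ[k] B ⊗[k] B)
        (AlgHom.id k B) R ∈ tensorSub (tensorPiece ℬ 0) (ℬ 0) :=
      map_mem_tensorSub (f := (Algebra.TensorProduct.includeLeft : B →ₐ[k] B ⊗[k] B).toLinearMap)
        (g := LinearMap.id) hlm (fun _ hx => hx) hR₀s
    have m₂₃ : Algebra.TensorProduct.map (Algebra.TensorProduct.includeRight : B →ₐ[k] B ⊗[k] B)
        (AlgHom.id k B) R ∈ tensorSub (tensorPiece ℬ 0) (ℬ 0) :=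
      map_mem_tensorSub (f := (Algebra.TensorProduct.includeRight : B →ₐ[k] B ⊗[k] B).toLinearMap)
        (g := LinearMap.id) hrm (fun _ hx => hx) hR₀s
    have e := congrArg (TensorProduct.map (TensorProduct.map σ σ) σ) hR.comul_left
    rw [(low.zero_zero.map h.lowMul.zero_zero) _ m₁₃ _ m₂₃] at e
    rw [map_includeLeft_left h.lowMul.map_one, map_includeRight_left h.lowMul.map_one] at e
    rw [← e]
    change TensorProduct.map A.comul.toLinearMap LinearMap.id (TensorProduct.map σ σ R) =
      TensorProduct.map (TensorProduct.map σ σ) σ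
        (TensorProduct.map (Coalgebra.comul (R := k)) LinearMap.id R)
    exact map_map_eq_of_mem_tensorPiece hR₀ hΔ₀ (fun _ _ _ _ => rfl)
  · have m₁₃ : Algebra.TensorProduct.map (AlgHom.id k B)
        (Algebra.TensorProduct.includeRight : B →ₐ[k] B ⊗[k] B) R ∈ tensorSub (ℬ 0) (tensorPiece ℬ 0) :=
      map_mem_tensorSub (g := (Algebra.TensorProduct.includeRight : B →ₐ[k] B ⊗[k] B).toLinearMap)
        (f := LinearMap.id) (fun _ hx => hx) hrm hR₀s
    have m₁₂ : Algebra.TensorProduct.map (AlgHom.id k B)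
        (Algebra.TensorProduct.includeLeft : B →ₐ[k] B ⊗[k] B) R ∈ tensorSub (ℬ 0) (tensorPiece ℬ 0) :=
      map_mem_tensorSub (g := (Algebra.TensorProduct.includeLeft : B →ₐ[k] B ⊗[k] B).toLinearMap)
        (f := LinearMap.id) (fun _ hx => hx) hlm hR₀s
    have e := congrArg (TensorProduct.map σ (TensorProduct.map σ σ)) hR.comul_right
    rw [(h.lowMul.zero_zero.map low.zero_zero) _ m₁₃ _ m₁₂] at e
    rw [map_includeLeft_right h.lowMul.map_one, map_includeRight_right h.lowMul.map_one] at e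
    rw [← e]
    change TensorProduct.map LinearMap.id A.comul.toLinearMap (TensorProduct.map σ σ R) =
      TensorProduct.map σ (TensorProduct.map σ σ)
        (TensorProduct.map LinearMap.id (Coalgebra.comul (R := k)) R)
    exact map_map_eq_of_mem_tensorPiece hR₀ (fun _ _ _ _ => rfl) hΔ₀
  · let c := Algebra.TensorProduct.comm k (PathAlgebra k V) (PathAlgebra k V)
    let K : Subalgebra k (PathAlgebra k V) :=
      { carrier := {a | c (A.comul a) * TensorProduct.map σ σ R =
          TensorProduct.map σ σ R * A.comul a}
        mul_mem' := fun {a b} ha hb => by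
          simp only [Set.mem_ofPred_eq] at ha hb ⊢
          rw [map_mul, map_mul, mul_assoc, hb, ← mul_assoc, ha, mul_assoc]
        add_mem' := fun {a b} ha hb => by
          simp only [Set.mem_ofPred_eq] at ha hb ⊢
          simp only [map_add, add_mul, mul_add, ha, hb]
        algebraMap_mem' := fun r => by
          simp only [Set.mem_ofPred_eq, AlgHom.commutes, AlgEquiv.commutes, Algebra.commutes] }
    intro a
    refine h.mem_of_section K (fun i hi b hb => ?_) a
    change TensorProduct.comm k _ _ (A.comul (σ b)) * _ = _ * A.comul (σ b)
    have hb' := hB.comul_mem i b hb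
    have hc : TensorProduct.comm k _ _ (TensorProduct.map σ σ (Coalgebra.comul (R := k) b)) =
        TensorProduct.map σ σ (TensorProduct.comm k _ _ (Coalgebra.comul (R := k) b)) := by
      generalize Coalgebra.comul (R := k) b = t
      induction t using TensorProduct.induction_on with
      | zero => simp
      | add x y hx hy => simp only [map_add, hx, hy]
      | tmul x y => simp
    have m₁ : MulOn (TensorProduct.map σ σ) (tensorPiece ℬ i) (tensorPiece ℬ 0) := by
      interval_cases i
      · exact low.zero_zero
      · exact low.one_zero
    have m₂ : MulOn (TensorProduct.map σ σ) (tensorPiece ℬ 0) (tensorPiece ℬ i) := by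
      interval_cases i
      · exact low.zero_zero
      · exact low.zero_one
    rw [h.comul_section i hi b hb, hc, ← m₁ _ (comm_mem_tensorPiece hb') _ hR₀,
      ← m₂ _ hR₀ _ hb', hR.comul_op_mul]

theorem surjective (h : IsLift ℬ π σ A) : Function.Surjective π := by
  rw [← AlgHom.range_eq_top, eq_top_iff]
  intro b _
  have hb : b ∈ ⨆ n, ℬ n := by
    rw [h.isGradedHopf.isInternal.submodule_iSup_eq_top]; trivial
  refine (iSup_le (fun n b hb => ?_) : ⨆ n, ℬ n ≤ Subalgebra.toSubmodule π.range) hb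
  obtain ⟨a, -, rfl⟩ := h.surj n b hb
  exact ⟨a, rfl⟩

theorem isHopfIdeal_ker (h : IsLift ℬ π σ A) :
    letI := A.toHopfAlgebra
    (RingHom.ker π).IsHopfIdeal k := by
  let := A.toHopfAlgebra
  -- A linear section of `π` makes the quotient map factor through `π`. The image of `Δ a` in the
  -- tensor square of the quotient is then determined by `(π ⊗ π)(Δ a) = Δ(π a)`, which vanishes on
  -- the kernel.
  obtain ⟨s, hs⟩ := π.toLinearMap.exists_rightInverse_of_surjective
    (LinearMap.range_eq_top.mpr h.surjective)
  let I : Submodule k (PathAlgebra k V) := (RingHom.ker π).restrictScalars k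
  have hj : I.mkQ = (I.mkQ ∘ₗ s) ∘ₗ π.toLinearMap := by
    ext a
    refine (Submodule.Quotient.eq I).mpr ?_
    change π (a - s (π a)) = 0
    rw [map_sub, sub_eq_zero]
    exact (LinearMap.congr_fun hs (π a)).symm
  refine { counit_eq_zero := fun a ha => ?_
           map_mkQ_comul_eq_zero := fun a ha => ?_
           antipode_mem := fun a ha => ?_ }
  · refine (h.counit_eq a).trans ?_
    rw [show π a = 0 from ha, map_zero]
  · change TensorProduct.map I.mkQ I.mkQ (A.comul a) = 0
    rw [hj, TensorProduct.map_comp, LinearMap.comp_apply, h.map_comul,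
      show π a = 0 from ha, map_zero, map_zero]
  · change π (A.antipode a) = 0
    rw [h.map_antipode, show π a = 0 from ha, map_zero]

/-- Long paths die because `ℬ` vanishes in high degrees. Conversely, since `π` is graded, the parts
of degree `0` and `1` of a kernel element lie in the kernel themselves, and `π` is injective there;
only paths of length at least `2` remain. -/
theorem isAdmissible_ker (h : IsLift ℬ π σ A) {N : ℕ} (hN : ∀ n, N ≤ n → ℬ n = ⊥) :
    PathAlgebra.IsAdmissible k V (RingHom.ker π) := by
  -- The summand `2` serves only to meet the requirement that the exponent be at least `2`.
  refine ⟨N + 2, by omega, ?_, ?_⟩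
  · refine (PathAlgebra.arrowIdeal_pow_le _).trans (Submodule.span_le.mpr ?_)
    rintro _ ⟨p, hp, rfl⟩
    simp only [Set.mem_ofPred_eq] at hp
    change π _ = 0
    have := h.map_mem p.2.2.length (PathAlgebra.single k p) (Submodule.subset_span ⟨p, rfl, rfl⟩)
    rwa [hN _ (by omega), Submodule.mem_bot] at this
  · intro f hf
    change π f = 0 at hf
    obtain ⟨f₀, h₀, f₁, h₁, f₂, h₂, rfl⟩ := PathAlgebra.exists_decomposition f
    obtain ⟨p, -, hp, hp'⟩ := h.isGradedHopf.isInternal.exists_proj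
    have key : ∀ i ≤ 1, p i (π f₂) = 0 := by
      intro i hi
      suffices e : Submodule.span k (PathAlgebra.single k '' {p : QuiverPath V | 2 ≤ p.2.2.length}) ≤
          LinearMap.ker (p i ∘ₗ π.toLinearMap) from e h₂
      refine Submodule.span_le.mpr ?_
      rintro _ ⟨q, hq, rfl⟩
      simp only [Set.mem_ofPred_eq] at hq
      exact hp' q.2.2.length i (by omega) _ (h.map_mem _ _ (Submodule.subset_span ⟨q, rfl, rfl⟩))
    rw [map_add, map_add] at hf
    have e₀ := congrArg (p 0) hf
    have e₁ := congrArg (p 1) hf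
    rw [map_add, map_add, hp 0 _ (h.map_mem 0 _ h₀), hp' 1 0 one_ne_zero _ (h.map_mem 1 _ h₁),
      key 0 zero_le_one, map_zero, add_zero, add_zero] at e₀
    rw [map_add, map_add, hp 1 _ (h.map_mem 1 _ h₁), hp' 0 1 zero_ne_one _ (h.map_mem 0 _ h₀),
      key 1 le_rfl, map_zero, add_zero, zero_add] at e₁
    rw [← h.leftInv 0 zero_le_one _ h₀, ← h.leftInv 1 le_rfl _ h₁, e₀, e₁, map_zero, zero_add,
      zero_add]
    exact PathAlgebra.span_le_arrowIdeal_sq h₂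

end PathCover.IsLift

/-- A path cover gives a presentation. -/
theorem PathCover.exists_presentation (h : PathCover ℬ π σ) (hB : IsGradedHopf k ℬ)
    {R R' : B ⊗[k] B} (hR : IsUniversalRMatrix k B R)
    (hR₀ : R ∈ tensorPiece ℬ 0) (hR₀' : R' ∈ tensorPiece ℬ 0) (h₁ : R * R' = 1)
    (h₂ : R' * R = 1) {N : ℕ} (hN : ∀ n, N ≤ n → ℬ n = ⊥) :
    ∃ P : QuiverPresentation k ℬ R V, P.rMatrix ∈ tensorPiece (PathAlgebra.grading k V) 0 ∧
      (∀ i ≤ 1, ∀ b ∈ ℬ i, P.hopf.comul (σ b) =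
        TensorProduct.map σ σ (Coalgebra.comul (R := k) b)) ∧
      (∀ a, P.hopf.counit a = Coalgebra.counit (R := k) (π a)) := by
  obtain ⟨A, c₁, c₂, c₃⟩ := h.exists_hopf hB
  have L : PathCover.IsLift ℬ π σ A := ⟨h, hB, c₁, c₂, c₃⟩
  let := A.toHopfAlgebra
  have := L.isHopfIdeal_ker
  let e := Ideal.quotientKerAlgEquivOfSurjective (R₁ := k) L.surjective
  let iso : (PathAlgebra k V ⧸ RingHom.ker π) ≃ₐc[k] B := BialgEquiv.ofAlgEquiv e
    (Ideal.Quotient.algHom_ext k (AlgHom.ext fun a => (c₂ a).symm))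
    (Ideal.Quotient.algHom_ext k (AlgHom.ext fun a => by
      refine Eq.trans ?_ (L.map_comul a)
      change TensorProduct.map e.toLinearMap e.toLinearMap
        (TensorProduct.map (Ideal.Quotient.mkₐ k (RingHom.ker π)).toLinearMap
          (Ideal.Quotient.mkₐ k (RingHom.ker π)).toLinearMap (A.comul a)) = _
      rw [← LinearMap.comp_apply, ← TensorProduct.map_comp]
      rfl))
  refine ⟨{ hopf := A
            isGradedHopf := L.gradedHopf
            rMatrix := TensorProduct.map σ σ R
            isUniversalRMatrix := L.isUniversalRMatrix hR hR₀ hR₀' h₁ h₂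
            I := RingHom.ker π
            isTwoSided := inferInstance
            isHopfIdeal := L.isHopfIdeal_ker
            isAdmissible := L.isAdmissible_ker hN
            iso := iso
            map_grading := fun n => ?_
            map_rMatrix := ?_ }, ?_, c₁, c₂⟩
  · ext b
    constructor
    · rintro ⟨a, ha, rfl⟩
      exact h.map_mem n a ha
    · intro hb
      obtain ⟨a, ha, rfl⟩ := h.surj n b hb
      exact ⟨a, ha, rfl⟩
  · rw [← LinearMap.comp_apply, ← TensorProduct.map_comp]
    change TensorProduct.map π.toLinearMap π.toLinearMap (TensorProduct.map σ σ R) = R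
    rw [map_map_eq_of_mem_tensorPiece (f₁' := LinearMap.id) (f₂' := LinearMap.id)
        (g₁' := LinearMap.id) (g₂' := LinearMap.id) hR₀
        (fun j hj x hx => h.rightInv (by omega) hx) (fun j hj x hx => h.rightInv (by omega) hx)]
    simp
  · exact map_mem_tensorPiece (fun j hj b hb => h.section_mem (by omega) hb)
      (fun j hj b hb => h.section_mem (by omega) hb) hR₀

end Presentation

/-! ### Frames, translations and Peirce parts -/

section Translation

variable {k B : Type*} [Field k] [Ring B] [HopfAlgebra k B]

theorem LinearIndependent.exists_linearMap {ι M N : Type*} [AddCommGroup M] [Module k M]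
    [AddCommGroup N] [Module k N] {v : ι → M} (hv : LinearIndependent k v) (f : ι → N) :
    ∃ L : M →ₗ[k] N, ∀ i, L (v i) = f i := by
  obtain ⟨L, hL⟩ := ((Module.Basis.span hv).constr k f).exists_extend
  refine ⟨L, fun i => ?_⟩
  have := LinearMap.congr_fun hL (Module.Basis.span hv i)
  rw [Module.Basis.constr_basis] at this
  rw [← this]
  simp [Module.Basis.span_apply]

/-- The map `b ↦ ∑ φ(b₁) b₂` on a coalgebra. -/
noncomputable def coalgTranslate (φ : B →ₗ[k] k) : B →ₗ[k] B :=
  (Algebra.TensorProduct.lid k B).toLinearMap ∘ₗ TensorProduct.map φ LinearMap.id ∘ₗ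
    Coalgebra.comul (R := k)

/-- By coassociativity both sides are `∑ φ(b₁) ψ(b₂) b₃`, so translations compose by convolution of
functionals. This is used to undo the translation by a group element. -/
theorem coalgTranslate_coalgTranslate (φ ψ : B →ₗ[k] k) (b : B) :
    coalgTranslate ψ (coalgTranslate φ b) = coalgTranslate ((Algebra.TensorProduct.lid k k).toLinearMap ∘ₗ
      TensorProduct.map φ ψ ∘ₗ Coalgebra.comul (R := k)) b := by
  let Λ : B ⊗[k] (B ⊗[k] B) →ₗ[k] B := (Algebra.TensorProduct.lid k B).toLinearMap ∘ₗ
    TensorProduct.map φ ((Algebra.TensorProduct.lid k B).toLinearMap ∘ₗ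
      TensorProduct.map ψ LinearMap.id)
  have h₁ : ∀ t : B ⊗[k] B, coalgTranslate ψ ((Algebra.TensorProduct.lid k B).toLinearMap
      (TensorProduct.map φ LinearMap.id t)) =
      Λ (TensorProduct.map LinearMap.id (Coalgebra.comul (R := k)) t) := fun t => by
    induction t using TensorProduct.induction_on with
    | zero => simp
    | add x y hx hy => simp only [map_add, hx, hy]
    | tmul x y => simp [Λ, coalgTranslate]
  have h₂ : ∀ t : (B ⊗[k] B) ⊗[k] B, Λ (TensorProduct.assoc k B B B t) =
      (Algebra.TensorProduct.lid k B).toLinearMap (TensorProduct.map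
        ((Algebra.TensorProduct.lid k k).toLinearMap ∘ₗ TensorProduct.map φ ψ) LinearMap.id t) :=
    fun t => by
      induction t using TensorProduct.induction_on with
      | zero => simp
      | add x y hx hy => simp only [map_add, hx, hy]
      | tmul s c =>
        induction s using TensorProduct.induction_on with
        | zero => simp
        | add x y hx hy => simp only [TensorProduct.add_tmul, map_add, hx, hy]
        | tmul x y => simp [Λ, smul_smul, mul_comm]
  have h₃ := h₁ (Coalgebra.comul (R := k) b)
  have h₄ := Coalgebra.coassoc_apply (R := k) b
  rw [LinearMap.lTensor] at h₄
  rw [← h₄, h₂, LinearMap.rTensor, ← LinearMap.comp_apply (TensorProduct.map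
    ((Algebra.TensorProduct.lid k k).toLinearMap ∘ₗ TensorProduct.map φ ψ) LinearMap.id),
    ← TensorProduct.map_comp] at h₃
  exact h₃

theorem coalgTranslate_counit (b : B) : coalgTranslate (Coalgebra.counit (R := k)) b = b := by
  have := Coalgebra.rTensor_counit_comul (R := k) b
  rw [LinearMap.rTensor] at this
  simp [coalgTranslate, this]

/-- `E` is a basis of the degree-`0` part of `B` which consists of orthogonal idempotents. -/
structure IsIdempotentFrame (ℬ : ℕ → Submodule k B) {V : Type*} [Fintype V] (E : V → B) :
    Prop where
  linearIndependent : LinearIndependent k E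
  span_eq : Submodule.span k (Set.range E) = ℬ 0
  mul_self : ∀ x, E x * E x = E x
  mul_of_ne : ∀ x y, x ≠ y → E x * E y = 0
  sum_eq : ∑ x, E x = 1

/-- `E` is a basis of the degree-`0` part of `B` which identifies it with the dual of the group
algebra of `G`. -/
structure IsDualGroupFrame (ℬ : ℕ → Submodule k B) {G : Type*} [Group G] [Fintype G]
    (E : G → B) : Prop extends IsIdempotentFrame ℬ E where
  comul_eq : ∀ g, Coalgebra.comul (R := k) (E g) = ∑ x, E x ⊗ₜ[k] E (x⁻¹ * g)
  counit_one : Coalgebra.counit (R := k) (E 1) = 1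
  counit_of_ne : ∀ g, g ≠ 1 → Coalgebra.counit (R := k) (E g) = 0

/-- The part `e P f` of a subspace, for idempotents `e` and `f`. -/
def peircePart (P : Submodule k B) (e f : B) : Submodule k B where
  carrier := {b | b ∈ P ∧ e * b = b ∧ b * f = b}
  add_mem' := fun ⟨h₁, h₂, h₃⟩ ⟨h₁', h₂', h₃'⟩ =>
    ⟨Submodule.add_mem _ h₁ h₁', by rw [mul_add, h₂, h₂'], by rw [add_mul, h₃, h₃']⟩
  zero_mem' := ⟨Submodule.zero_mem _, mul_zero _, zero_mul _⟩
  smul_mem' := fun c b ⟨h₁, h₂, h₃⟩ =>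
    ⟨Submodule.smul_mem _ c h₁, by rw [mul_smul_comm, h₂], by rw [smul_mul_assoc, h₃]⟩

theorem peircePart_le (P : Submodule k B) (e f : B) : peircePart P e f ≤ P := fun _ hb => hb.1

namespace IsIdempotentFrame

variable {ℬ : ℕ → Submodule k B} {V : Type*} [Fintype V] {E : V → B}

theorem mem_zero (hE : IsIdempotentFrame ℬ E) (x : V) : E x ∈ ℬ 0 :=
  hE.span_eq ▸ Submodule.subset_span ⟨x, rfl⟩

theorem mem_of_mem_zero (hE : IsIdempotentFrame ℬ E) {P : Submodule k B} (hP : ∀ x, E x ∈ P)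
    {b : B} (hb : b ∈ ℬ 0) : b ∈ P := by
  rw [← hE.span_eq] at hb
  exact (Submodule.span_le.mpr (by rintro _ ⟨x, rfl⟩; exact hP x)) hb

theorem mul_mem_peircePart (hE : IsIdempotentFrame ℬ E) (hB : IsGradedHopf k ℬ) {b : B}
    (hb : b ∈ ℬ 1) (x y : V) : E y * (b * E x) ∈ peircePart (ℬ 1) (E y) (E x) := by
  refine ⟨hB.mul_mem 0 1 _ (hE.mem_zero y) _ (hB.mul_mem 1 0 _ hb _ (hE.mem_zero x)), ?_, ?_⟩
  · rw [← mul_assoc, hE.mul_self]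
  · rw [mul_assoc, mul_assoc, hE.mul_self]

theorem sum_peircePart (hE : IsIdempotentFrame ℬ E) (b : B) : ∑ x, ∑ y, E y * (b * E x) = b := by
  simp only [← Finset.sum_mul, hE.sum_eq, one_mul, ← Finset.mul_sum, mul_one]

end IsIdempotentFrame

namespace IsDualGroupFrame

variable {ℬ : ℕ → Submodule k B} {G : Type*} [Group G] [Fintype G] {E : G → B}

/-- The coordinate at `g` in degree `0`, extended by zero to positive degrees, is the evaluation of
functions at `g`. It is multiplicative in degree `0` because the `E x` are orthogonal idempotents,
and the mixed products lie in degree `1`, where it vanishes. -/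
theorem exists_coordinate (hE : IsDualGroupFrame ℬ E) (hB : IsGradedHopf k ℬ) [DecidableEq G]
    (g : G) : ∃ φ : B →ₗ[k] k, (∀ x, φ (E x) = if x = g then 1 else 0) ∧
      (∀ b ∈ ℬ 1, φ b = 0) ∧ LowMul ℬ φ := by
  obtain ⟨c, hc⟩ := hE.linearIndependent.exists_linearMap (fun x => if x = g then (1 : k) else 0)
  obtain ⟨p, -, hp, hp'⟩ := hB.isInternal.exists_proj
  have h₀ : ∀ x, (c ∘ₗ p 0) (E x) = if x = g then 1 else 0 := fun x => by
    rw [LinearMap.comp_apply, hp 0 _ (hE.mem_zero x), hc]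
  have h₁ : ∀ b ∈ ℬ 1, (c ∘ₗ p 0) b = 0 := fun b hb => by
    rw [LinearMap.comp_apply, hp' 1 0 one_ne_zero b hb, map_zero]
  refine ⟨c ∘ₗ p 0, h₀, h₁, ?_, ?_, ?_, ?_⟩
  · rw [← hE.sum_eq, map_sum]
    simp only [h₀]
    simp
  · intro a ha b hb
    refine hE.mem_of_mem_zero (P := LinearMap.eqLocus ((c ∘ₗ p 0) ∘ₗ LinearMap.mulLeft k a)
      ((c ∘ₗ p 0) a • (c ∘ₗ p 0))) (fun y => ?_) hb
    refine hE.mem_of_mem_zero (P := LinearMap.eqLocus ((c ∘ₗ p 0) ∘ₗ LinearMap.mulRight k (E y))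
      ((c ∘ₗ p 0) (E y) • (c ∘ₗ p 0))) (fun x => ?_) ha |>.trans (mul_comm _ _)
    change (c ∘ₗ p 0) (E x * E y) = (c ∘ₗ p 0) (E y) * (c ∘ₗ p 0) (E x)
    by_cases hxy : x = y
    · subst hxy
      rw [hE.mul_self, h₀]
      split_ifs <;> simp
    · rw [hE.mul_of_ne x y hxy, h₀, h₀, map_zero]
      split_ifs with h h' <;> simp
      exact hxy (h'.trans h.symm)
  · intro a ha b hb
    rw [h₁ _ (by simpa using hB.mul_mem 0 1 a ha b hb), h₁ b hb, mul_zero]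
  · intro a ha b hb
    rw [h₁ _ (by simpa using hB.mul_mem 1 0 a ha b hb), h₁ a ha, zero_mul]

/-- Let `L` evaluate the first leg of `Δ` at `g⁻¹`: in `Δ(E x) = ∑ E y ⊗ E (y⁻¹ x)` only `y = g⁻¹`
survives and leaves `E (g x)`. Injectivity follows by translating back with the evaluation at `g`:
the convolution of the two evaluations agrees with the counit in degrees `0` and `1`, which are the
only degrees met by `Δ` of an element of degree `1`. -/
theorem exists_translation (hE : IsDualGroupFrame ℬ E) (hB : IsGradedHopf k ℬ) (g : G) :
    ∃ L : B →ₗ[k] B, LowMul ℬ L ∧ (∀ x, L (E x) = E (g * x)) ∧ (∀ b ∈ ℬ 1, L b ∈ ℬ 1) ∧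
      ∀ b ∈ ℬ 1, L b = 0 → b = 0 := by
  classical
  choose φ hφ₀ hφ₁ hφ using hE.exists_coordinate hB
  have hL : ∀ h, LowMul ℬ (coalgTranslate (φ h)) := fun h =>
    (((hφ h).tensor (g := LinearMap.id) ⟨rfl, fun _ _ _ _ => rfl, fun _ _ _ _ => rfl,
      fun _ _ _ _ => rfl⟩).comp_algHom (Bialgebra.comulAlgHom k B) hB.comul_mem).algHom_comp
        (Algebra.TensorProduct.lid k B).toAlgHom
  have hLE : ∀ h x, coalgTranslate (φ h) (E x) = E (h⁻¹ * x) := fun h x => by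
    simp [coalgTranslate, hE.comul_eq, hφ₀]
  refine ⟨coalgTranslate (φ g⁻¹), hL _, fun x => by rw [hLE, inv_inv], fun b hb => ?_, fun b hb h => ?_⟩
  · have : ∀ t ∈ tensorPiece ℬ 1, (Algebra.TensorProduct.lid k B).toLinearMap
        (TensorProduct.map (φ g⁻¹) LinearMap.id t) ∈ ℬ 1 := by
      intro t ht
      rw [tensorPiece_one] at ht
      refine (sup_le (Submodule.span_le.mpr ?_) (Submodule.span_le.mpr ?_) :
        _ ≤ (ℬ 1).comap ((Algebra.TensorProduct.lid k B).toLinearMap ∘ₗ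
          TensorProduct.map (φ g⁻¹) LinearMap.id)) ht
      · rintro _ ⟨a, ha, b, hb, rfl⟩
        simpa using Submodule.smul_mem _ _ hb
      · rintro _ ⟨a, ha, b, hb, rfl⟩
        simp [hφ₁ _ a ha]
    exact this _ (hB.comul_mem 1 b hb)
  · have e := coalgTranslate_coalgTranslate (φ g⁻¹) (φ g) b
    rw [h, map_zero] at e
    refine ((coalgTranslate_counit (k := k) b).symm.trans ?_).trans e.symm
    refine (congrArg (Algebra.TensorProduct.lid k B)
      (map_eq_map_of_mem_tensorPiece (f := (Algebra.TensorProduct.lid k k).toLinearMap ∘ₗ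
      TensorProduct.map (φ g⁻¹) (φ g) ∘ₗ Coalgebra.comul (R := k)) (f' := Coalgebra.counit (R := k))
      (g := LinearMap.id) (g' := LinearMap.id)
      ?_ (fun _ _ _ _ => rfl) (hB.comul_mem 1 b hb))).symm
    intro i hi a ha
    interval_cases i
    · refine hE.mem_of_mem_zero (P := LinearMap.eqLocus ((Algebra.TensorProduct.lid k k).toLinearMap ∘ₗ
        TensorProduct.map (φ g⁻¹) (φ g) ∘ₗ Coalgebra.comul (R := k)) (Coalgebra.counit (R := k)))
        (fun x => ?_) ha
      change _ = Coalgebra.counit (R := k) (E x)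
      by_cases hx : x = 1
      · subst hx
        simp only [LinearMap.comp_apply, hE.comul_eq, hE.counit_one, map_sum]
        rw [Finset.sum_eq_single g⁻¹ (fun y _ hy => by simp [hφ₀, hy]) (by simp)]
        simp [hφ₀]
      · simp only [LinearMap.comp_apply, hE.comul_eq, hE.counit_of_ne x hx, map_sum]
        rw [Finset.sum_eq_single g⁻¹ (fun y _ hy => by simp [hφ₀, hy]) (by simp)]
        simp [hφ₀, hx]
    -- Each term of `Δ a` has a leg of degree `1`, which the evaluation on that leg kills; the
    -- counit is zero there as well.
    · rw [hB.counit_eq_zero 1 one_ne_zero a ha]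
      have ht := hB.comul_mem 1 a ha
      rw [tensorPiece_one] at ht
      refine (sup_le (Submodule.span_le.mpr ?_) (Submodule.span_le.mpr ?_) :
        _ ≤ LinearMap.ker ((Algebra.TensorProduct.lid k k).toLinearMap ∘ₗ
          TensorProduct.map (φ g⁻¹) (φ g))) ht
      · rintro _ ⟨a, ha, b, hb, rfl⟩
        simp [hφ₁ _ b hb]
      · rintro _ ⟨a, ha, b, hb, rfl⟩
        simp [hφ₁ _ a ha]

/-- The translation respects products with elements of degree `0`, so it carries `E y b = b` and `b
E x = b` to the same conditions for the translated idempotents. An inequality is enough, since `g`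
may be replaced by its inverse. -/
theorem finrank_peircePart_le (hE : IsDualGroupFrame ℬ E) (hB : IsGradedHopf k ℬ)
    [FiniteDimensional k (ℬ 1)] (g x y : G) :
    Module.finrank k (peircePart (ℬ 1) (E y) (E x)) ≤
      Module.finrank k (peircePart (ℬ 1) (E (g * y)) (E (g * x))) := by
  obtain ⟨L, hL, hLE, hL₁, hinj⟩ := hE.exists_translation hB g
  have : FiniteDimensional k (peircePart (ℬ 1) (E (g * y)) (E (g * x))) :=
    Submodule.finiteDimensional_of_le (peircePart_le _ _ _)
  have hmap : ∀ b ∈ peircePart (ℬ 1) (E y) (E x), L b ∈ peircePart (ℬ 1) (E (g * y)) (E (g * x)) := by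
    rintro b ⟨h₁, h₂, h₃⟩
    refine ⟨hL₁ b h₁, ?_, ?_⟩
    · rw [← hLE, ← hL.zero_one _ (hE.mem_zero y) _ h₁, h₂]
    · rw [← hLE, ← hL.one_zero _ h₁ _ (hE.mem_zero x), h₃]
  refine LinearMap.finrank_le_finrank_of_injective (f := L.restrict hmap) ?_
  rw [← LinearMap.ker_eq_bot, LinearMap.ker_eq_bot']
  intro b hb
  exact Subtype.ext (hinj b.1 b.2.1 (congrArg Subtype.val hb))

theorem finrank_peircePart (hE : IsDualGroupFrame ℬ E) (hB : IsGradedHopf k ℬ)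
    [FiniteDimensional k (ℬ 1)] (g x y : G) :
    Module.finrank k (peircePart (ℬ 1) (E (g * y)) (E (g * x))) =
      Module.finrank k (peircePart (ℬ 1) (E y) (E x)) :=
  le_antisymm
    (by
      have := hE.finrank_peircePart_le hB g⁻¹ (g * x) (g * y)
      rwa [inv_mul_cancel_left, inv_mul_cancel_left] at this)
    (hE.finrank_peircePart_le hB g x y)

end IsDualGroupFrame

end Translation

/-! ### The path algebra of a frame -/

section FrameCover

variable {k B : Type*} [Field k] [Ring B] [HopfAlgebra k B]

namespace IsIdempotentFrame

variable {ℬ : ℕ → Submodule k B} {V : Type*} [Quiver V] [Fintype V] {E : V → B}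

/-- The path algebra of a quiver with the right numbers of arrows covers `B`. -/
theorem exists_pathCover (hE : IsIdempotentFrame ℬ E) (hB : IsGradedHopf k ℬ)
    (b : ∀ x y : V, Module.Basis (x ⟶ y) k (peircePart (ℬ 1) (E y) (E x)))
    (hgen : ∀ n, ℬ (n + 1) ≤ ℬ n * ℬ 1) :
    ∃ (π : PathAlgebra k V →ₐ[k] B) (σ : B →ₗ[k] PathAlgebra k V), PathCover ℬ π σ ∧
      ∀ x, π (PathAlgebra.vertex k x) = E x := by
  classical
  have hb : ∀ {x y : V} (a : x ⟶ y), (b x y a : B) ∈ peircePart (ℬ 1) (E y) (E x) :=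
    fun a => Subtype.prop _
  obtain ⟨π, hπ₀, hπ₁⟩ := PathAlgebra.exists_lift (k := k) (V := V) E
    (fun {x y} a => (b x y a : B)) hE.mul_self hE.mul_of_ne hE.sum_eq
    (fun a => (hb a).2.1) (fun a => (hb a).2.2)
  obtain ⟨σ₀, hσ₀⟩ := hE.linearIndependent.exists_linearMap
    (fun x => PathAlgebra.vertex k (V := V) x)
  have hσ₁ : ∀ x y : V, ∃ L : B →ₗ[k] PathAlgebra k V, ∀ a : x ⟶ y,
      L (b x y a) = PathAlgebra.arrow k a := fun x y =>
    ((b x y).linearIndependent.map' _ (Submodule.ker_subtype _)).exists_linearMap _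
  choose L hL using hσ₁
  obtain ⟨p, -, hp, hp'⟩ := hB.isInternal.exists_proj
  -- In degree `0` the idempotents go back to vertices. In degree `1` an element is split into its
  -- Peirce components `E y b E x`, and on each of them the chosen basis goes back to the arrows.
  -- Higher degrees are sent to zero.
  let σ : B →ₗ[k] PathAlgebra k V := σ₀ ∘ₗ p 0 + ∑ x : V, ∑ y : V,
    L x y ∘ₗ LinearMap.mulLeft k (E y) ∘ₗ LinearMap.mulRight k (E x) ∘ₗ p 1
  have hσ : ∀ b, σ b = σ₀ (p 0 b) + ∑ x : V, ∑ y : V, L x y (E y * (p 1 b * E x)) := fun b => by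
    simp [σ, LinearMap.sum_apply]
  have map_mem : ∀ n, ∀ a ∈ PathAlgebra.grading k V n, π a ∈ ℬ n := by
    refine PathAlgebra.map_mem_of_generators π hB.mul_mem fun i hi a ha => ?_
    suffices h : PathAlgebra.grading k V i ≤ (ℬ i).comap π.toLinearMap from h ha
    interval_cases i
    · rw [PathAlgebra.grading_zero, Submodule.span_le]
      rintro _ ⟨x, rfl⟩
      change π _ ∈ ℬ 0
      rw [hπ₀]
      exact hE.mem_zero x
    · rw [PathAlgebra.grading_one, Submodule.span_le]
      rintro _ ⟨a, rfl⟩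
      change π _ ∈ ℬ 1
      rw [hπ₁]
      exact (hb a.2.2).1
  have surj₁ : ℬ 1 ≤ (PathAlgebra.grading k V 1).map π.toLinearMap := by
    intro c hc
    rw [← hE.sum_peircePart c]
    refine Submodule.sum_mem _ fun x _ => Submodule.sum_mem _ fun y _ => ?_
    have hmem := hE.mul_mem_peircePart hB hc x y
    generalize E y * (c * E x) = d at hmem
    suffices h : ⊤ ≤ ((PathAlgebra.grading k V 1).map π.toLinearMap).comap
        (peircePart (ℬ 1) (E y) (E x)).subtype from h (Submodule.mem_top (x := ⟨d, hmem⟩))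
    rw [← (b x y).span_eq, Submodule.span_le]
    rintro _ ⟨a, rfl⟩
    exact ⟨PathAlgebra.arrow k a, PathAlgebra.arrow_mem_grading k a, hπ₁ a⟩
  have surj : ∀ n, ℬ n ≤ (PathAlgebra.grading k V n).map π.toLinearMap := by
    intro n
    induction n with
    | zero =>
      intro c hc
      refine hE.mem_of_mem_zero (fun x => ?_) hc
      exact ⟨_, PathAlgebra.vertex_mem_grading k (V := V) x, hπ₀ x⟩
    | succ n ih =>
      refine (hgen n).trans (Submodule.mul_le.mpr fun c hc d hd => ?_)
      obtain ⟨c, hc', rfl⟩ := ih hc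
      obtain ⟨d, hd', rfl⟩ := surj₁ hd
      exact ⟨c * d, PathAlgebra.grading_mul k hc' hd', map_mul π c d⟩
  refine ⟨π, σ, ⟨map_mem, fun n c hc => surj n hc, fun i hi a ha => ?_⟩, hπ₀⟩
  suffices h : PathAlgebra.grading k V i ≤ LinearMap.eqLocus (σ ∘ₗ π.toLinearMap) LinearMap.id
    from h ha
  interval_cases i
  · rw [PathAlgebra.grading_zero, Submodule.span_le]
    rintro _ ⟨x, rfl⟩
    change σ (π (PathAlgebra.vertex k x)) = PathAlgebra.vertex k x
    rw [hσ, hπ₀, hp 0 _ (hE.mem_zero x), hp' 0 1 zero_ne_one _ (hE.mem_zero x)]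
    simp [hσ₀]
  · rw [PathAlgebra.grading_one, Submodule.span_le]
    rintro _ ⟨⟨x, y, a⟩, rfl⟩
    change σ (π (PathAlgebra.arrow k a)) = PathAlgebra.arrow k a
    obtain ⟨h₁, h₂, h₃⟩ := hb a
    -- A basis vector of one Peirce part is annihilated by every other pair of idempotents, so a
    -- single term of the double sum survives.
    rw [hσ, hπ₁, hp 1 _ h₁, hp' 1 0 one_ne_zero _ h₁, map_zero, zero_add,
      Finset.sum_eq_single x, Finset.sum_eq_single y, h₃, h₂, hL]
    · intro z _ hz
      rw [h₃, ← h₂, ← mul_assoc, hE.mul_of_ne z y hz, zero_mul, map_zero]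
    · simp
    · intro z _ hz
      refine Finset.sum_eq_zero fun y' _ => ?_
      rw [← h₃, mul_assoc, hE.mul_of_ne x z (Ne.symm hz), mul_zero, mul_zero, map_zero]
    · simp

end IsIdempotentFrame

namespace IsDualGroupFrame

variable {ℬ : ℕ → Submodule k B} {G : Type*} [CommGroup G] [Fintype G] {E : G → B}

/-- The ramification datum of a frame: the dimensions of the parts `E g ℬ₁ E 1`. -/
noncomputable def ramification (ℬ : ℕ → Submodule k B) (E : G → B) (C : ConjClasses G) : ℕ :=
  Module.finrank k (peircePart (ℬ 1) (E (ConjClasses.mkEquiv.symm C)) (E 1))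

/-- Translation on the left preserves `x⁻¹ y`, whereas a Hopf quiver counts arrows by the class of
`y x⁻¹`. Commutativity of `G` identifies the two, and it also makes every conjugacy class a single
element. -/
theorem ramification_mk (hE : IsDualGroupFrame ℬ E) (hB : IsGradedHopf k ℬ)
    [FiniteDimensional k (ℬ 1)] (x y : G) :
    Module.finrank k (peircePart (ℬ 1) (E y) (E x)) =
      ramification ℬ E (ConjClasses.mk (y * x⁻¹)) := by
  have h₁ : ConjClasses.mkEquiv.symm (ConjClasses.mk (y * x⁻¹)) = y * x⁻¹ :=
    ConjClasses.mkEquiv.symm_apply_apply _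
  have h₂ := hE.finrank_peircePart hB x 1 (y * x⁻¹)
  rw [mul_one, mul_comm y, mul_inv_cancel_left, mul_comm _ y] at h₂
  rw [ramification, h₁, h₂]

/-- A graded quasitriangular Hopf algebra with a frame, generated in degrees `0` and `1`, is
presented by the Hopf quiver of the frame. -/
theorem exists_presentation (hE : IsDualGroupFrame ℬ E) (hB : IsGradedHopf k ℬ)
    [FiniteDimensional k (ℬ 1)] (hgen : ∀ n, ℬ (n + 1) ≤ ℬ n * ℬ 1)
    {R R' : B ⊗[k] B} (hR : IsUniversalRMatrix k B R)
    (hR₀ : R ∈ tensorPiece ℬ 0) (hR₀' : R' ∈ tensorPiece ℬ 0) (h₁ : R * R' = 1)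
    (h₂ : R' * R = 1) {N : ℕ} (hN : ∀ n, N ≤ n → ℬ n = ⊥) :
    ∃ P : QuiverPresentation k ℬ R (HopfQuiver (ramification ℬ E)), P.IsDualGroupAlgebra ∧
      P.rMatrix ∈ tensorPiece (PathAlgebra.grading k (HopfQuiver (ramification ℬ E))) 0 := by
  let V := HopfQuiver (ramification ℬ E)
  let F : V → B := E
  have hF : IsIdempotentFrame ℬ F := hE.toIsIdempotentFrame
  have hfin : ∀ x y : V, FiniteDimensional k (peircePart (ℬ 1) (F y) (F x)) := fun x y =>
    Submodule.finiteDimensional_of_le (peircePart_le _ _ _)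
  let b : ∀ x y : V, Module.Basis (x ⟶ y) k (peircePart (ℬ 1) (F y) (F x)) := fun x y =>
    Module.finBasisOfFinrankEq k _ (hE.ramification_mk hB x y)
  obtain ⟨π, σ, hc, hπ⟩ := hF.exists_pathCover hB b hgen
  obtain ⟨P, hP, hΔ, hε⟩ := hc.exists_presentation hB hR hR₀ hR₀' h₁ h₂ hN
  have hσ : ∀ x : V, σ (F x) = PathAlgebra.vertex k x := fun x => by
    rw [← hc.leftInv 0 zero_le_one _ (PathAlgebra.vertex_mem_grading k x), hπ]
  refine ⟨P, ⟨fun g => ?_, ?_, fun g hg => ?_⟩, hP⟩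
  · have e := hΔ 0 zero_le_one _ (hE.mem_zero g)
    rw [hE.comul_eq, map_sum] at e
    refine (congrArg P.hopf.comul (hσ g).symm).trans (e.trans (Finset.sum_congr rfl fun x _ => ?_))
    exact congrArg₂ (· ⊗ₜ[k] ·) (hσ x) (hσ (x⁻¹ * g : G))
  · exact (hε _).trans ((congrArg _ (hπ (1 : G))).trans hE.counit_one)
  · exact (hε _).trans ((congrArg _ (hπ g)).trans (hE.counit_of_ne g hg))

end IsDualGroupFrame

end FrameCover

/-! ### Uniqueness of the quiver and of the group -/

section Uniqueness

variable {k B : Type*} [Field k] [Ring B] [HopfAlgebra k B] {ℬ : ℕ → Submodule k B}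

theorem PathAlgebra.disjoint_grading {V : Type*} [Quiver V] {n m : ℕ} (h : n < m) :
    Disjoint (grading k V n)
      (Submodule.span k (single k '' {p : QuiverPath V | m ≤ p.2.2.length})) := by
  have e : Submodule.span k (single k '' {p : QuiverPath V | m ≤ p.2.2.length}) =
      Finsupp.supported k k {p : QuiverPath V | m ≤ p.2.2.length} :=
    (Finsupp.supported_eq_span_single k _).symm
  rw [e, grading_eq_supported]
  refine Finsupp.disjoint_supported_supported (Set.disjoint_left.mpr fun p hp hp' => ?_)
  simp only [Set.mem_ofPred_eq] at hp hp'
  omega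

namespace IsIdempotentFrame

variable {V W : Type*} [Fintype V] [Fintype W] {E : V → B} {E' : W → B}

theorem mul_mem_span (hE : IsIdempotentFrame ℬ E) {b : B} (hb : b ∈ ℬ 0) (x : V) :
    b * E x ∈ Submodule.span k {E x} := by
  refine hE.mem_of_mem_zero (P := (Submodule.span k {E x}).comap (LinearMap.mulRight k (E x)))
    (fun y => ?_) hb
  rw [Submodule.mem_comap, LinearMap.mulRight_apply]
  by_cases h : y = x
  · rw [h, hE.mul_self]; exact Submodule.mem_span_singleton_self _
  · rw [hE.mul_of_ne y x h]; exact Submodule.zero_mem _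

theorem mem_span_mul (hE : IsIdempotentFrame ℬ E) {b : B} (hb : b ∈ ℬ 0) (x : V) :
    E x * b ∈ Submodule.span k {E x} := by
  refine hE.mem_of_mem_zero (P := (Submodule.span k {E x}).comap (LinearMap.mulLeft k (E x)))
    (fun y => ?_) hb
  rw [Submodule.mem_comap, LinearMap.mulLeft_apply]
  by_cases h : x = y
  · rw [← h, hE.mul_self]; exact Submodule.mem_span_singleton_self _
  · rw [hE.mul_of_ne x y h]; exact Submodule.zero_mem _

/-- The members of a frame are the minimal idempotents of the degree-`0` part. -/
theorem range_eq (hE : IsIdempotentFrame ℬ E) : Set.range E =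
    {a | a ∈ ℬ 0 ∧ a * a = a ∧ a ≠ 0 ∧ ∀ b ∈ ℬ 0, a * b ∈ Submodule.span k {a}} := by
  ext a
  constructor
  · rintro ⟨x, rfl⟩
    exact ⟨hE.mem_zero x, hE.mul_self x, hE.linearIndependent.ne_zero x,
      fun b hb => hE.mem_span_mul hb x⟩
  · rintro ⟨ha, haa, ha₀, hspan⟩
    -- Some product `a * E x` is nonzero because the `E x` sum to `1`. It lies on the line of `a` by
    -- minimality and on the line of `E x` because `a` has degree `0`, so `a` is a multiple of `E
    -- x`. Both are nonzero idempotents, and the factor is `1`.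
    obtain ⟨x, hx⟩ : ∃ x, a * E x ≠ 0 := by
      by_contra! h
      apply ha₀
      rw [← mul_one a, ← hE.sum_eq, Finset.mul_sum]
      exact Finset.sum_eq_zero fun x _ => h x
    obtain ⟨c, hc⟩ := Submodule.mem_span_singleton.mp (hspan _ (hE.mem_zero x))
    obtain ⟨d, hd⟩ := Submodule.mem_span_singleton.mp (hE.mul_mem_span ha x)
    have hc₀ : c ≠ 0 := by
      rintro rfl
      rw [zero_smul] at hc
      exact hx hc.symm
    have hr : a = (c⁻¹ * d) • E x := by
      rw [mul_smul, hd, ← hc, smul_smul, inv_mul_cancel₀ hc₀, one_smul]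
    refine ⟨x, ?_⟩
    have hr₀ : c⁻¹ * d ≠ 0 := by
      intro h
      rw [h, zero_smul] at hr
      exact ha₀ hr
    rw [hr, smul_mul_smul_comm, hE.mul_self] at haa
    have := smul_left_injective k (hE.linearIndependent.ne_zero x) haa
    rw [hr, (mul_eq_left₀ hr₀).mp this, one_smul]

/-- The description in `range_eq` does not refer to the frame, so two frames are two labellings of
one set, both injective by linear independence. -/
theorem exists_equiv (hE : IsIdempotentFrame ℬ E) (hE' : IsIdempotentFrame ℬ E') :
    ∃ e : V ≃ W, ∀ x, E x = E' (e x) := by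
  have h : Set.range E = Set.range E' := hE.range_eq.trans hE'.range_eq.symm
  let e := (Equiv.ofInjective E hE.linearIndependent.injective).trans
    ((Equiv.setCongr h).trans (Equiv.ofInjective E' hE'.linearIndependent.injective).symm)
  refine ⟨e, fun x => ?_⟩
  exact (Equiv.apply_ofInjective_symm hE'.linearIndependent.injective ⟨E x, h ▸ ⟨x, rfl⟩⟩).symm

end IsIdempotentFrame

namespace QuiverPresentation

variable {RB : B ⊗[k] B} {V : Type*} [Quiver V] [Fintype V] (P : QuiverPresentation k ℬ RB V)

/-- The projection of the path algebra onto the presented algebra. -/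
noncomputable def proj : PathAlgebra k V →ₐ[k] B :=
  letI := P.hopf.toHopfAlgebra
  letI := P.isTwoSided
  letI := P.isHopfIdeal
  (P.iso : (PathAlgebra k V ⧸ P.I) →ₐ[k] B).comp (Ideal.Quotient.mkₐ k P.I)

theorem map_proj (n : ℕ) : (PathAlgebra.grading k V n).map P.proj.toLinearMap = ℬ n :=
  SetLike.coe_injective (P.map_grading n)

/-- The inclusion of `I` in the square of the arrow ideal puts the kernel inside the span of the
paths of length at least `2`. Hence vertices and arrows survive faithfully in the presented algebra.
-/
theorem disjoint_ker_proj {n : ℕ} (hn : n < 2) :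
    Disjoint (PathAlgebra.grading k V n) (LinearMap.ker P.proj.toLinearMap) := by
  refine (PathAlgebra.disjoint_grading hn).mono_right ?_
  obtain ⟨m, -, -, h⟩ := P.isAdmissible
  refine le_trans (fun f hf => ?_) (h.trans (PathAlgebra.arrowIdeal_pow_le 2))
  let := P.hopf.toHopfAlgebra
  have := P.isTwoSided
  have := P.isHopfIdeal
  have hf' : P.iso (Ideal.Quotient.mk P.I f) = P.iso 0 := Eq.trans hf (map_zero P.iso).symm
  exact Ideal.Quotient.eq_zero_iff_mem.mp (P.iso.injective hf')

theorem comul_proj (a : PathAlgebra k V) : Coalgebra.comul (R := k) (P.proj a) =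
    TensorProduct.map P.proj.toLinearMap P.proj.toLinearMap (P.hopf.comul a) := by
  let := P.hopf.toHopfAlgebra
  have := P.isTwoSided
  have := P.isHopfIdeal
  refine (CoalgHomClass.map_comp_comul_apply P.iso (Ideal.Quotient.mk P.I a)).symm.trans ?_
  rw [Bialgebra.Quotient.comul_mk, ← LinearMap.comp_apply, ← TensorProduct.map_comp]
  rfl

theorem counit_proj (a : PathAlgebra k V) :
    Coalgebra.counit (R := k) (P.proj a) = P.hopf.counit a := by
  let := P.hopf.toHopfAlgebra
  have := P.isTwoSided
  have := P.isHopfIdeal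
  exact CoalgHomClass.counit_comp_apply P.iso (Ideal.Quotient.mk P.I a)

theorem isIdempotentFrame :
    IsIdempotentFrame ℬ (fun x : V => P.proj (PathAlgebra.vertex k x)) where
  linearIndependent := (PathAlgebra.linearIndependent_vertex k).map (f := P.proj.toLinearMap) (by
    rw [← PathAlgebra.grading_zero]
    exact P.disjoint_ker_proj two_pos)
  span_eq := by
    rw [← P.map_proj 0, PathAlgebra.grading_zero, Submodule.map_span, ← Set.range_comp]
    rfl
  mul_self x := by rw [← map_mul, PathAlgebra.vertex_mul_self]
  mul_of_ne x y h := by rw [← map_mul, PathAlgebra.vertex_mul_vertex_of_ne k h, map_zero]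
  sum_eq := by rw [← map_sum, ← PathAlgebra.one_def, map_one]

/-- Cutting an element of degree `1` by the idempotents at `y` and `x` leaves exactly its arrows
from `x` to `y`, and these stay independent in `B`. The number of arrows thus depends only on the
graded algebra and the two idempotents. -/
theorem finrank_peircePart (x y : V) [Fintype (x ⟶ y)] :
    Module.finrank k (peircePart (ℬ 1) (P.proj (PathAlgebra.vertex k y))
      (P.proj (PathAlgebra.vertex k x))) = Fintype.card (x ⟶ y) := by
  have hspan : peircePart (ℬ 1) (P.proj (PathAlgebra.vertex k y))
      (P.proj (PathAlgebra.vertex k x)) =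
      Submodule.span k (Set.range (P.proj.toLinearMap ∘ fun a : x ⟶ y => PathAlgebra.arrow k a)) := by
    refine le_antisymm ?_ (Submodule.span_le.mpr ?_)
    · rintro b ⟨h₁, h₂, h₃⟩
      rw [← P.map_proj 1] at h₁
      obtain ⟨f, hf, rfl⟩ := h₁
      rw [← h₂, ← h₃, Set.range_comp, ← Submodule.map_span]
      refine ⟨PathAlgebra.vertex k y * (f * PathAlgebra.vertex k x), ?_, by simp⟩
      suffices h : PathAlgebra.grading k V 1 ≤
          (Submodule.span k (Set.range fun a : x ⟶ y => PathAlgebra.arrow k a)).comap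
            (LinearMap.mulLeft k (PathAlgebra.vertex k y) ∘ₗ
              LinearMap.mulRight k (PathAlgebra.vertex k x)) from h hf
      rw [PathAlgebra.grading_one, Submodule.span_le]
      rintro _ ⟨⟨x', y', a⟩, rfl⟩
      change PathAlgebra.vertex k y * (PathAlgebra.arrow k a * PathAlgebra.vertex k x) ∈
        Submodule.span k (Set.range fun a : x ⟶ y => PathAlgebra.arrow k a)
      by_cases hx : x = x'
      · subst hx
        rw [PathAlgebra.arrow_mul_vertex]
        by_cases hy : y = y'
        · subst hy
          rw [PathAlgebra.vertex_mul_arrow]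
          exact Submodule.subset_span ⟨a, rfl⟩
        · rw [PathAlgebra.vertex_mul_arrow_of_ne k a hy]
          exact Submodule.zero_mem _
      · rw [PathAlgebra.arrow_mul_vertex_of_ne k a hx, mul_zero]
        exact Submodule.zero_mem _
    · rintro _ ⟨a, rfl⟩
      refine ⟨?_, ?_, ?_⟩
      · rw [← P.map_proj 1]
        exact ⟨_, PathAlgebra.arrow_mem_grading k a, rfl⟩
      · change P.proj _ * P.proj _ = P.proj _
        rw [← map_mul, PathAlgebra.vertex_mul_arrow]
      · change P.proj _ * P.proj _ = P.proj _
        rw [← map_mul, PathAlgebra.arrow_mul_vertex]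
  rw [hspan]
  refine finrank_span_eq_card ((PathAlgebra.linearIndependent_arrow k x y).map
    ((P.disjoint_ker_proj one_lt_two).mono_left (Submodule.span_le.mpr ?_)))
  rintro _ ⟨a, rfl⟩
  exact PathAlgebra.arrow_mem_grading k a

variable {G G' : Type*} [Group G] [Fintype G] [Group G'] [Fintype G'] {S : ConjClasses G → ℕ}
  {S' : ConjClasses G' → ℕ} (Q : QuiverPresentation k ℬ RB (HopfQuiver S))

/-- The idempotent of the presented algebra given by an element of the group. -/
noncomputable def idem (g : G) : B := Q.proj (PathAlgebra.vertex k (V := HopfQuiver S) g)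

theorem idem_isIdempotentFrame : IsIdempotentFrame ℬ Q.idem := Q.isIdempotentFrame

theorem finrank_idem (x y : G) : Module.finrank k (peircePart (ℬ 1) (Q.idem y) (Q.idem x)) =
    S (ConjClasses.mk (y * x⁻¹)) := by
  let : Fintype ((show HopfQuiver S from x) ⟶ (show HopfQuiver S from y)) :=
    inferInstanceAs (Fintype (Fin (S (ConjClasses.mk (y * x⁻¹)))))
  exact (Q.finrank_peircePart (show HopfQuiver S from x) (show HopfQuiver S from y)).trans
    (Fintype.card_fin _)

/-- Once the vertices are matched as minimal idempotents, both arrow numbers are the dimension of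
one and the same Peirce part. The bijection of vertices need not respect the group laws. -/
theorem quiverIsomorphic (Q : QuiverPresentation k ℬ RB (HopfQuiver S))
    (Q' : QuiverPresentation k ℬ RB (HopfQuiver S')) :
    QuiverIsomorphic (HopfQuiver S) (HopfQuiver S') := by
  obtain ⟨e, he⟩ := Q.idem_isIdempotentFrame.exists_equiv Q'.idem_isIdempotentFrame
  have h : ∀ x y : G, S (ConjClasses.mk (y * x⁻¹)) = S' (ConjClasses.mk (e y * (e x)⁻¹)) :=
    fun x y => by rw [← Q.finrank_idem x y, he, he, Q'.finrank_idem]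
  exact ⟨e, fun x y => ⟨finCongr (h x y)⟩⟩

theorem idem_isDualGroupFrame {Q : QuiverPresentation k ℬ RB (HopfQuiver S)}
    (hQ : Q.IsDualGroupAlgebra) : IsDualGroupFrame ℬ Q.idem where
  toIsIdempotentFrame := Q.idem_isIdempotentFrame
  comul_eq g := by
    refine (Q.comul_proj _).trans ?_
    refine (congrArg _ (hQ.1 g)).trans ?_
    rw [map_sum]
    rfl
  counit_one := (Q.counit_proj _).trans hQ.2.1
  counit_of_ne g hg := (Q.counit_proj _).trans (hQ.2.2 g hg)

end QuiverPresentation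

/-- The coefficient of `E' (e x) ⊗ E' (e y)` in `Δ(E (x y))` is computed in both frames. In the
first it is `1`, and in the second it is nonzero only if `e x * e y = e (x * y)`. -/
theorem IsDualGroupFrame.map_mul {G G' : Type*} [Group G] [Fintype G] [Group G'] [Fintype G']
    {E : G → B} {E' : G' → B} (hE : IsDualGroupFrame ℬ E) (hE' : IsDualGroupFrame ℬ E')
    (e : G ≃ G') (he : ∀ x, E x = E' (e x)) (x y : G) : e (x * y) = e x * e y := by
  classical
  have hφ : ∀ a : G', ∃ φ : B →ₗ[k] k, ∀ z, φ (E' z) = if z = a then 1 else 0 := fun a =>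
    hE'.linearIndependent.exists_linearMap _
  choose φ hφ using hφ
  have h := hE.comul_eq (x * y)
  simp only [he] at h
  rw [hE'.comul_eq] at h
  have h' := congrArg (fun t => Algebra.TensorProduct.lid k k
    (TensorProduct.map (φ (e x)) (φ (e y)) t)) h
  simp only [map_sum, TensorProduct.map_tmul, Algebra.TensorProduct.lid_tmul, hφ] at h'
  rw [Finset.sum_eq_single (e x) (fun z _ hz => by simp [hz]) (by simp),
    Finset.sum_eq_single x (fun z _ hz => by simp [hz]) (by simp)] at h'
  by_contra hne
  have : (e x)⁻¹ * e (x * y) ≠ e y := fun h => hne (by rw [← h, mul_inv_cancel_left])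
  simp [this] at h'

theorem QuiverPresentation.exists_mulEquiv {G G' : Type*} [Group G] [Fintype G] [Group G']
    [Fintype G'] {S : ConjClasses G → ℕ} {S' : ConjClasses G' → ℕ} {RB : B ⊗[k] B}
    {Q : QuiverPresentation k ℬ RB (HopfQuiver S)} {Q' : QuiverPresentation k ℬ RB (HopfQuiver S')}
    (hQ : Q.IsDualGroupAlgebra) (hQ' : Q'.IsDualGroupAlgebra) :
    ∃ e : G ≃* G', ∀ g : G, S' (ConjClasses.mk (e g)) = S (ConjClasses.mk g) := by
  obtain ⟨e, he⟩ := Q.idem_isIdempotentFrame.exists_equiv Q'.idem_isIdempotentFrame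
  let f : G ≃* G' := MulEquiv.mk' e
    ((idem_isDualGroupFrame hQ).map_mul (idem_isDualGroupFrame hQ') e he)
  refine ⟨f, fun g => ?_⟩
  -- The arrows that start at the identity already display the whole ramification datum.
  have h := Q.finrank_idem 1 g
  rw [he, he, Q'.finrank_idem, show e 1 = 1 from map_one f, inv_one, inv_one, mul_one, mul_one] at h
  exact h

end Uniqueness

/-! ### The radical grading of `gr H` and its `R`-matrix -/

section RadicalGrading

variable {k : Type*} {H : Type u} [Field k] [Ring H]

section Algebra

variable [Algebra k H]

theorem Gr.ext_mem_grading {n : ℕ} {x : H} (hx : x ∈ radPow k H n) :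
    Gr.ext k H n x ∈ Gr.grading k H n := by
  rw [Gr.ext_apply hx]
  exact ⟨_, rfl⟩

theorem Gr.exists_ext_of_mem_grading {n : ℕ} {a : Gr k H} (ha : a ∈ Gr.grading k H n) :
    ∃ x ∈ radPow k H n, Gr.ext k H n x = a := by
  obtain ⟨b, rfl⟩ := ha
  induction b using GrPiece.ind with | h x hx
  exact ⟨x, hx, Gr.ext_apply hx⟩

theorem Gr.grading_isInternal : DirectSum.IsInternal (Gr.grading k H) := by
  rw [DirectSum.isInternal_submodule_iff_iSupIndep_and_iSup_eq_top]
  constructor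
  · intro n
    rw [Submodule.disjoint_def]
    rintro _ ⟨a, rfl⟩ h
    have hle : ⨆ j, ⨆ (_ : j ≠ n), Gr.grading k H j ≤
        LinearMap.ker (DirectSum.component k ℕ (GrPiece k H) n) := by
      refine iSup₂_le fun j hj => ?_
      rintro _ ⟨b, rfl⟩
      exact (DirectSum.component.of (R := k) (M := GrPiece k H) n j b).trans (dif_neg hj)
    have := hle h
    rw [LinearMap.mem_ker, DirectSum.component.lof_self] at this
    rw [this, map_zero]
  · rw [eq_top_iff]
    rintro a -
    induction a using Gr.induction with
    | zero => exact Submodule.zero_mem _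
    | add a b ha hb => exact Submodule.add_mem _ ha hb
    | ext n x hx => exact Submodule.mem_iSup_of_mem n (Gr.ext_mem_grading hx)

theorem Gr.mul_mem_grading {i j : ℕ} {a b : Gr k H} (ha : a ∈ Gr.grading k H i)
    (hb : b ∈ Gr.grading k H j) : a * b ∈ Gr.grading k H (i + j) := by
  obtain ⟨x, hx, rfl⟩ := Gr.exists_ext_of_mem_grading ha
  obtain ⟨y, hy, rfl⟩ := Gr.exists_ext_of_mem_grading hb
  rw [Gr.ext_mul hx hy]
  exact Gr.ext_mem_grading (radPow_mul hx hy)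

/-- This comes from `J ^ (n + 1) = J ^ n · J`. It says that `gr H` is generated in degrees `0` and
`1`, which makes the map from the path algebra surjective. -/
theorem Gr.grading_succ_le (n : ℕ) :
    Gr.grading k H (n + 1) ≤ Gr.grading k H n * Gr.grading k H 1 := by
  intro a ha
  obtain ⟨x, hx, rfl⟩ := Gr.exists_ext_of_mem_grading ha
  change x ∈ (Ring.jacobson H) ^ (n + 1) at hx
  clear ha
  rw [Submodule.pow_succ] at hx
  induction hx using Submodule.mul_induction_on' with
  | mem_mul_mem a ha b hb =>
    rw [← Gr.ext_mul (i := n) (j := 1) ha (mem_radPow_one.mpr hb)]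
    exact Submodule.mul_mem_mul (Gr.ext_mem_grading ha) (Gr.ext_mem_grading (mem_radPow_one.mpr hb))
  | add a _ b _ ha hb =>
    rw [map_add]
    exact Submodule.add_mem _ ha hb

theorem Gr.finiteDimensional_grading [FiniteDimensional k H] (n : ℕ) :
    FiniteDimensional k (Gr.grading k H n) := by
  have : Module.Finite k (GrPiece k H n) :=
    inferInstanceAs (Module.Finite k (↥(radPow k H n) ⧸ (radPow k H (n + 1)).submoduleOf _))
  exact Module.Finite.range _

/-- A finite-dimensional algebra is Artinian, so its Jacobson radical is nilpotent. -/
theorem Gr.exists_grading_eq_bot [FiniteDimensional k H] :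
    ∃ N, ∀ n, N ≤ n → Gr.grading k H n = ⊥ := by
  have : IsArtinianRing H := IsArtinianRing.of_finite k H
  obtain ⟨N, hN⟩ := IsSemiprimaryRing.isNilpotent (R := H)
  refine ⟨N, fun n hn => ?_⟩
  rw [eq_bot_iff]
  intro a ha
  obtain ⟨x, hx, rfl⟩ := Gr.exists_ext_of_mem_grading ha
  have h₀ : x ∈ (Ring.jacobson H) ^ N := radPow_anti (k := k) hn hx
  rw [hN] at h₀
  rw [show x = 0 from h₀, map_zero]
  exact Submodule.zero_mem _

theorem Gr.degreeZero_apply (x : H) : Gr.degreeZero k H x = Gr.ext k H 0 x := by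
  rw [Gr.ext_apply (mem_radPow_zero x)]
  rfl

theorem Gr.degreeZero_eq_zero_iff {x : H} :
    Gr.degreeZero k H x = 0 ↔ x ∈ Ring.jacobson H := by
  rw [← mem_radPow_one (k := k)]
  constructor
  · intro h
    rw [Gr.degreeZero_apply, Gr.ext_apply (mem_radPow_zero x)] at h
    have h' : GrPiece.mk (k := k) 0 x (mem_radPow_zero x) = 0 :=
      DirectSum.of_injective (β := GrPiece k H) 0 (h.trans (map_zero _).symm)
    exact (Submodule.Quotient.mk_eq_zero ((radPow k H (0 + 1)).submoduleOf (radPow k H 0))).mp h'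
  · intro h
    rw [Gr.degreeZero_apply]
    exact Gr.ext_eq_zero zero_lt_one h

/-- The projection `H → H / J ⊆ gr H` as an algebra homomorphism. -/
noncomputable def Gr.degreeZeroAlg (k H : Type*) [Field k] [Ring H] [Algebra k H] :
    H →ₐ[k] Gr k H :=
  AlgHom.ofLinearMap (Gr.degreeZero k H) (by rw [Gr.degreeZero_apply, Gr.ext_one])
    (fun x y => by
      rw [Gr.degreeZero_apply, Gr.degreeZero_apply, Gr.degreeZero_apply,
        Gr.ext_mul (mem_radPow_zero x) (mem_radPow_zero y)])

theorem Gr.tensorSymbol_zero (u : H ⊗[k] H) : Gr.tensorSymbol k H 0 u =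
    TensorProduct.map (Gr.degreeZero k H) (Gr.degreeZero k H) u := by
  rw [show Gr.degreeZero k H = Gr.ext k H 0 from LinearMap.ext Gr.degreeZero_apply,
    Gr.tensorSymbol]
  simp

theorem Gr.tensorSymbol_mem {n : ℕ} {u : H ⊗[k] H} (hu : u ∈ radTensor k H n) :
    Gr.tensorSymbol k H n u ∈ tensorPiece (Gr.grading k H) n := by
  induction hu using Submodule.span_induction with
  | zero => rw [map_zero]; exact Submodule.zero_mem _
  | add x y _ _ hx hy => rw [map_add]; exact Submodule.add_mem _ hx hy
  | smul c x _ hx => rw [map_smul]; exact Submodule.smul_mem _ _ hx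
  | mem x hx =>
    obtain ⟨i, j, hij, a, ha, b, hb, rfl⟩ := hx
    rw [Gr.tensorSymbol_tmul hij ha hb]
    exact tmul_mem_tensorPiece hij (Gr.ext_mem_grading ha) (Gr.ext_mem_grading hb)

theorem Gr.comm_tensorSymbol {n : ℕ} {u : H ⊗[k] H} (hu : u ∈ radTensor k H n) :
    TensorProduct.comm k _ _ (Gr.tensorSymbol k H n u) =
      Gr.tensorSymbol k H n (TensorProduct.comm k _ _ u) := by
  induction hu using Submodule.span_induction with
  | zero => simp
  | add x y _ _ hx hy => simp only [map_add, hx, hy]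
  | smul c x _ hx => simp only [map_smul, hx]
  | mem x hx =>
    obtain ⟨i, j, hij, a, ha, b, hb, rfl⟩ := hx
    rw [Gr.tensorSymbol_tmul hij ha hb, TensorProduct.comm_tmul, TensorProduct.comm_tmul,
      Gr.tensorSymbol_tmul (by omega : j + i = n) hb ha]

theorem radTensor_zero (u : H ⊗[k] H) : u ∈ radTensor k H 0 := by
  induction u using TensorProduct.induction_on with
  | zero => exact Submodule.zero_mem _
  | add x y hx hy => exact Submodule.add_mem _ hx hy
  | tmul x y =>
    exact tmul_mem_radTensor (i := 0) (j := 0) rfl (mem_radPow_zero x) (mem_radPow_zero y)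

theorem Gr.map_degreeZero_mem (u : H ⊗[k] H) :
    TensorProduct.map (Gr.degreeZero k H) (Gr.degreeZero k H) u ∈
      tensorPiece (Gr.grading k H) 0 := by
  rw [← Gr.tensorSymbol_zero]
  exact Gr.tensorSymbol_mem (radTensor_zero u)

end Algebra

variable [HopfAlgebra k H] [IsElementary k H]

theorem Gr.isGradedHopf : IsGradedHopf k (Gr.grading k H) where
  isInternal := Gr.grading_isInternal
  one_mem := by
    rw [← Gr.ext_one]
    exact Gr.ext_mem_grading (mem_radPow_zero 1)
  mul_mem _ _ _ ha _ hb := Gr.mul_mem_grading ha hb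
  comul_mem n a ha := by
    obtain ⟨x, hx, rfl⟩ := Gr.exists_ext_of_mem_grading ha
    change Gr.comulLin k H _ ∈ _
    rw [Gr.comulLin_ext hx]
    exact Gr.tensorSymbol_mem (comul_radPow hx)
  counit_eq_zero n hn a ha := by
    obtain ⟨x, hx, rfl⟩ := Gr.exists_ext_of_mem_grading ha
    exact (Gr.counitLin_ext hx).trans (if_neg hn)
  antipode_mem n a ha := by
    obtain ⟨x, hx, rfl⟩ := Gr.exists_ext_of_mem_grading ha
    change Gr.antipodeLin k H _ ∈ _
    rw [Gr.antipodeLin_ext hx]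
    exact Gr.ext_mem_grading (antipode_radPow hx)

theorem Gr.comul_degreeZero (x : H) : Coalgebra.comul (R := k) (Gr.degreeZero k H x) =
    TensorProduct.map (Gr.degreeZero k H) (Gr.degreeZero k H) (Coalgebra.comul (R := k) x) := by
  rw [← Gr.tensorSymbol_zero, Gr.degreeZero_apply]
  exact Gr.comulLin_ext (mem_radPow_zero x)

theorem Gr.counit_degreeZero (x : H) :
    Coalgebra.counit (R := k) (Gr.degreeZero k H x) = Coalgebra.counit (R := k) x := by
  rw [Gr.degreeZero_apply]
  exact (Gr.counitLin_ext (mem_radPow_zero x)).trans (if_pos rfl)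

/-- The projection of `H` onto degree `0` is an algebra map compatible with the comultiplications,
so invertibility and the two hexagon identities are images of those for `R`. The intertwining
relation is needed in every degree: for `x ∈ J ^ n` it follows by taking symbols of degree `n` on
both sides of `Δᵒ(x) R = R Δ(x)`, as `R` has filtration degree `0`. -/
theorem Gr.isUniversalRMatrix {R : H ⊗[k] H} (hR : IsUniversalRMatrix k H R) :
    IsUniversalRMatrix k (Gr k H) (Gr.rMatrix R) := by
  let d := Gr.degreeZeroAlg k H
  have hd : d.toLinearMap 1 = 1 := map_one d
  have hdd : Gr.rMatrix R = Algebra.TensorProduct.map d d R := rfl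
  refine ⟨?_, ?_, ?_, ?_⟩
  · rw [hdd]
    exact hR.isUnit.map _
  · have e := congrArg (Algebra.TensorProduct.map (Algebra.TensorProduct.map d d) d) hR.comul_left
    rw [map_mul] at e
    refine Eq.trans ?_ (e.trans (congrArg₂ (· * ·) (map_includeLeft_left hd R)
      (map_includeRight_left hd R)))
    change TensorProduct.map (Coalgebra.comul (R := k)) LinearMap.id
      (TensorProduct.map d.toLinearMap d.toLinearMap R) =
      TensorProduct.map (TensorProduct.map d.toLinearMap d.toLinearMap) d.toLinearMap
        (TensorProduct.map (Coalgebra.comul (R := k)) LinearMap.id R)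
    exact map_map_eq_of_mem_tensorPiece (radTensor_zero R) (fun _ _ x _ => Gr.comul_degreeZero x)
      (fun _ _ _ _ => rfl)
  · have e := congrArg (Algebra.TensorProduct.map d (Algebra.TensorProduct.map d d)) hR.comul_right
    rw [map_mul] at e
    refine Eq.trans ?_ (e.trans (congrArg₂ (· * ·) (map_includeRight_right hd R)
      (map_includeLeft_right hd R)))
    change TensorProduct.map LinearMap.id (Coalgebra.comul (R := k))
      (TensorProduct.map d.toLinearMap d.toLinearMap R) =
      TensorProduct.map d.toLinearMap (TensorProduct.map d.toLinearMap d.toLinearMap)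
        (TensorProduct.map LinearMap.id (Coalgebra.comul (R := k)) R)
    exact map_map_eq_of_mem_tensorPiece (radTensor_zero R) (fun _ _ _ _ => rfl)
      (fun _ _ x _ => Gr.comul_degreeZero x)
  · intro a
    rw [Gr.rMatrix, ← Gr.tensorSymbol_zero]
    change TensorProduct.comm k _ _ (Gr.comulLin k H a) * _ = _ * Gr.comulLin k H a
    induction a using Gr.induction with
    | zero => simp
    | add a b ha hb => simp only [map_add, add_mul, mul_add, ha, hb]
    | ext n x hx =>
      have hx' := comul_radPow hx
      have e₁ := Gr.tensorSymbol_mul (comm_mem_tensorPiece hx') (radTensor_zero R)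
      have e₂ := Gr.tensorSymbol_mul (radTensor_zero R) hx'
      rw [add_zero] at e₁
      rw [zero_add] at e₂
      rw [Gr.comulLin_ext hx, Gr.comm_tensorSymbol hx', e₁, e₂, hR.comul_op_mul]

end RadicalGrading

/-! ### The abelian group of characters -/

section Characters

variable {k : Type*} {H : Type u} [Field k] [Ring H] [HopfAlgebra k H]

/-- The inverse is `χ` composed with the antipode, which is multiplicative because `k` is
commutative. A left inverse is all that a group structure on a monoid requires. -/
theorem AlgHom.convMul_inv_cancel (χ : H →ₐ[k] k) :
    ∃ χ' : H →ₐ[k] k, WithConv.toConv χ' * WithConv.toConv χ = 1 := by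
  let χ' : H →ₐ[k] k := AlgHom.ofLinearMap (χ.toLinearMap ∘ₗ HopfAlgebra.antipode k)
    (by simp) (fun x y => by simp [HopfAlgebra.antipode_mul_antidistrib, mul_comm])
  refine ⟨χ', ?_⟩
  ext a
  rw [AlgHom.convMul_apply, AlgHom.convOne_apply]
  have h : ∀ u : H ⊗[k] H, Algebra.TensorProduct.lift χ' χ (fun _ _ => .all ..) u =
      χ (LinearMap.mul' k H ((HopfAlgebra.antipode k).rTensor H u)) := by
    intro u
    induction u using TensorProduct.induction_on with
    | zero => simp
    | add x y hx hy => simp only [map_add, hx, hy]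
    | tmul x y =>
      rw [Algebra.TensorProduct.lift_tmul, LinearMap.rTensor_tmul, LinearMap.mul'_apply, map_mul]
      rfl
  exact (h _).trans (by
    rw [HopfAlgebra.mul_antipode_rTensor_comul_apply, AlgHom.commutes])

/-- The characters of a quasitriangular Hopf algebra commute under convolution. -/
theorem IsUniversalRMatrix.convMul_comm {R : H ⊗[k] H} (hR : IsUniversalRMatrix k H R)
    (χ ψ : WithConv (H →ₐ[k] k)) : χ * ψ = ψ * χ := by
  let Φ : H ⊗[k] H →ₐ[k] k := Algebra.TensorProduct.lift χ.ofConv ψ.ofConv (fun _ _ => .all ..)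
  have hΦ : ∀ u : H ⊗[k] H, Algebra.TensorProduct.lift ψ.ofConv χ.ofConv (fun _ _ => .all ..) u =
      Φ (TensorProduct.comm k H H u) := by
    intro u
    induction u using TensorProduct.induction_on with
    | zero => simp
    | add x y hx hy => simp only [map_add, hx, hy]
    | tmul x y => simp [Φ, mul_comm]
  ext a
  rw [AlgHom.convMul_apply, AlgHom.convMul_apply, hΦ]
  -- In the commutative ring `k` the factor `Φ R` can be moved to the same side in both products,
  -- and it cancels because it is a unit.
  have h := congrArg Φ (hR.comul_op_mul a)
  rw [map_mul, map_mul, mul_comm] at h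
  exact ((hR.isUnit.map Φ).mul_left_cancel h).symm

open Classical in
-- Distinct characters are linearly independent, so some functional on the dual space takes
-- prescribed values on them. In finite dimension that functional is evaluation at an element of
-- `H`.
theorem exists_dual_characters (k H : Type*) [Field k] [Ring H] [Algebra k H]
    [FiniteDimensional k H] :
    ∃ h : (H →ₐ[k] k) → H, ∀ χ ψ : H →ₐ[k] k, ψ (h χ) = if ψ = χ then 1 else 0 := by
  have hli := linearIndependent_algHom_toLinearMap k H k
  choose L hL using fun χ : H →ₐ[k] k =>
    hli.exists_linearMap (fun ψ => if ψ = χ then (1 : k) else 0)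
  refine ⟨fun χ => (Module.evalEquiv k H).symm (L χ), fun χ ψ => ?_⟩
  rw [← hL χ ψ]
  exact Module.apply_evalEquiv_symm_apply k H ψ.toLinearMap (L χ)

theorem exists_characterGroup [FiniteDimensional k H] {R : H ⊗[k] H}
    (hR : IsUniversalRMatrix k H R) :
    ∃ (G : Type) (_ : CommGroup G) (_ : Fintype G) (χ : G ≃ (H →ₐ[k] k)),
      χ 1 = Bialgebra.counitAlgHom k H ∧ ∀ x y a, χ (x * y) a =
        Algebra.TensorProduct.lift (χ x) (χ y) (fun _ _ => .all ..)
          (Coalgebra.comul (R := k) a) := by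
  choose inv hinv using fun χ : H →ₐ[k] k => AlgHom.convMul_inv_cancel χ
  let _ : CommGroup (WithConv (H →ₐ[k] k)) :=
    { (inferInstance : Monoid (WithConv (H →ₐ[k] k))) with
      inv := fun χ => WithConv.toConv (inv χ.ofConv)
      inv_mul_cancel := fun χ => hinv χ.ofConv
      mul_comm := hR.convMul_comm }
  have : Finite (WithConv (H →ₐ[k] k)) := Finite.of_equiv _ (WithConv.equiv _).symm
  -- There are finitely many characters, so the group has a copy in `Type`, whatever the universes
  -- of `k` and `H`.
  let e : Shrink.{0} (WithConv (H →ₐ[k] k)) ≃* WithConv (H →ₐ[k] k) := Shrink.mulEquiv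
  refine ⟨Shrink.{0} (WithConv (H →ₐ[k] k)), inferInstance, Fintype.ofFinite _,
    e.toEquiv.trans (WithConv.equiv _), ?_, fun x y a => ?_⟩
  · exact congrArg WithConv.ofConv (map_one e)
  · exact (DFunLike.congr_fun (congrArg WithConv.ofConv (map_mul e x y)) a).trans
      (AlgHom.convMul_apply _ _ _)

end Characters

/-! ### The idempotents dual to the characters -/

section CharacterFrame

variable {k : Type*} {H : Type u} [Field k] [Ring H] [HopfAlgebra k H] [IsElementary k H]

/-- The idempotents of `H / J` which are dual to the characters of an elementary Hopf algebra with
group of characters `G` form a dual group frame. -/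
theorem isDualGroupFrame_of_characters {G : Type*} [CommGroup G] [Fintype G]
    (χ : G ≃ (H →ₐ[k] k)) (h₁ : χ 1 = Bialgebra.counitAlgHom k H)
    (hmul : ∀ x y a, χ (x * y) a = Algebra.TensorProduct.lift (χ x) (χ y) (fun _ _ => .all ..)
      (Coalgebra.comul (R := k) a)) :
    ∃ E : G → Gr k H, IsDualGroupFrame (k := k) (Gr.grading k H) E := by
  classical
  have : FiniteDimensional k H := IsElementary.finiteDimensional
  obtain ⟨h', hh'⟩ := exists_dual_characters k H
  obtain ⟨h, hh⟩ : ∃ h : G → H, ∀ x y, χ y (h x) = if y = x then 1 else 0 :=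
    ⟨fun x => h' (χ x), fun x y => by rw [hh']; simp [χ.injective.eq_iff]⟩
  let d := Gr.degreeZeroAlg k H
  -- The characters cut out the radical, so a class modulo `J` is determined by its character
  -- values. Both sides have the same values.
  have hd : ∀ a : H, d a = ∑ x, χ x a • d (h x) := by
    intro a
    rw [← sub_eq_zero, ← Finset.sum_congr rfl (fun x _ => map_smul d (χ x a) (h x)), ← map_sum,
      ← map_sub]
    refine Gr.degreeZero_eq_zero_iff.mpr ((mem_jacobson_iff (k := k) _).mpr fun ψ => ?_)
    obtain ⟨y, rfl⟩ := χ.surjective ψ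
    rw [map_sub, map_sum, Finset.sum_eq_single y, map_smul, hh, if_pos rfl, smul_eq_mul, mul_one,
      sub_self]
    · intro x _ hx
      rw [map_smul, hh, if_neg (Ne.symm hx), smul_zero]
    · simp
  have hdd : ∀ u : H ⊗[k] H, TensorProduct.map (Gr.degreeZero k H) (Gr.degreeZero k H) u =
      ∑ x, ∑ y, Algebra.TensorProduct.lift (χ x) (χ y) (fun _ _ => .all ..) u •
        (d (h x) ⊗ₜ[k] d (h y)) := by
    intro u
    induction u using TensorProduct.induction_on with
    | zero => simp
    | add u v hu hv => simp only [map_add, hu, hv, add_smul, Finset.sum_add_distrib]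
    | tmul a b =>
      change d a ⊗ₜ[k] d b = _
      rw [hd a, hd b, TensorProduct.sum_tmul]
      refine Finset.sum_congr rfl fun x _ => ?_
      rw [TensorProduct.tmul_sum]
      refine Finset.sum_congr rfl fun y _ => ?_
      rw [TensorProduct.smul_tmul_smul, Algebra.TensorProduct.lift_tmul]
  refine ⟨fun x => d (h x), ⟨?_, ?_, ?_, ?_, ?_⟩, ?_, ?_, ?_⟩
  · rw [Fintype.linearIndependent_iff]
    intro c hc y
    rw [← Finset.sum_congr rfl (fun x _ => map_smul d (c x) (h x)), ← map_sum] at hc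
    have := (mem_jacobson_iff (k := k) _).mp (Gr.degreeZero_eq_zero_iff.mp hc) (χ y)
    simpa [hh] using this
  · refine le_antisymm (Submodule.span_le.mpr ?_) fun a ha => ?_
    · rintro _ ⟨x, rfl⟩
      change Gr.degreeZero k H (h x) ∈ _
      rw [Gr.degreeZero_apply]
      exact Gr.ext_mem_grading (mem_radPow_zero _)
    · obtain ⟨a, -, rfl⟩ := Gr.exists_ext_of_mem_grading ha
      rw [← Gr.degreeZero_apply]
      change d a ∈ _
      rw [hd a]
      exact Submodule.sum_mem _ fun x _ =>
        Submodule.smul_mem _ _ (Submodule.subset_span ⟨x, rfl⟩)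
  · intro x
    rw [← map_mul, hd]
    simp [hh]
  · intro x y hxy
    rw [← map_mul, hd]
    refine Finset.sum_eq_zero fun z _ => ?_
    rw [map_mul, hh, hh]
    by_cases hz : z = x
    · rw [if_neg (show ¬ z = y from fun h => hxy (hz.symm.trans h)), mul_zero, zero_smul]
    · rw [if_neg hz, zero_mul, zero_smul]
  · rw [← map_one d, hd]
    simp
  · intro g
    -- The coefficient of `d (h x) ⊗ d (h y)` is the convolution product of `χ x` and `χ y`
    -- evaluated at `h g`, that is `χ (x * y) (h g)`, which is `1` if `x * y = g` and `0` otherwise.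
    refine (Gr.comul_degreeZero (h g)).trans ((hdd _).trans (Finset.sum_congr rfl fun x _ => ?_))
    rw [Finset.sum_eq_single (x⁻¹ * g)]
    · rw [← hmul, hh, if_pos (mul_inv_cancel_left x g), one_smul]
    · intro y _ hy
      rw [← hmul, hh, if_neg (fun h => hy (eq_inv_mul_of_mul_eq h)), zero_smul]
    · simp
  · refine (Gr.counit_degreeZero (h 1)).trans ?_
    have := hh 1 1
    rwa [h₁, if_pos rfl] at this
  · intro g hg
    refine (Gr.counit_degreeZero (h g)).trans ?_
    have := hh g 1
    rwa [h₁, if_neg (Ne.symm hg)] at this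

end CharacterFrame

/-! ### The presentation theorem -/

theorem theorem4p5 {k : Type v} {H : Type u} [Field k] [Ring H] [HopfAlgebra k H]
    [IsElementary k H] (R : H ⊗[k] H) (hR : IsUniversalRMatrix k H R) :
    IsGradedHopf k (Gr.grading k H) ∧ IsUniversalRMatrix k (Gr k H) (Gr.rMatrix R) ∧
    ∃ (G : Type) (_ : CommGroup G) (_ : Fintype G) (S : ConjClasses G → ℕ),
      (∃ P : QuiverPresentation k (Gr.grading k H) (Gr.rMatrix R) (HopfQuiver S),
        P.IsDualGroupAlgebra ∧
        P.rMatrix ∈ tensorPiece (PathAlgebra.grading k (HopfQuiver S)) 0) ∧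
      (∀ (G' : Type w) [Group G'] [Fintype G'] (S' : ConjClasses G' → ℕ),
        Nonempty (QuiverPresentation k (Gr.grading k H) (Gr.rMatrix R) (HopfQuiver S')) →
          QuiverIsomorphic (HopfQuiver S) (HopfQuiver S')) ∧
      (∀ (G' : Type w) [Group G'] [Fintype G'] (S' : ConjClasses G' → ℕ)
        (P' : QuiverPresentation k (Gr.grading k H) (Gr.rMatrix R) (HopfQuiver S')),
        P'.IsDualGroupAlgebra →
          ∃ e : G ≃* G', ∀ g : G, S' (ConjClasses.mk (e g)) = S (ConjClasses.mk g)) := by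
  have : FiniteDimensional k H := IsElementary.finiteDimensional
  have := Gr.finiteDimensional_grading (k := k) (H := H) 1
  obtain ⟨G, _, _, χ, hχ, hχ'⟩ := exists_characterGroup hR
  obtain ⟨E, hE⟩ := isDualGroupFrame_of_characters χ hχ hχ'
  obtain ⟨N, hN⟩ := Gr.exists_grading_eq_bot (k := k) (H := H)
  obtain ⟨R', h₁, h₂⟩ := isUnit_iff_exists.mp hR.isUnit
  -- The image under `D` of the inverse of `R` is an inverse of `gr R` that visibly has degree `0`,
  -- as the lift to the path algebra demands.
  let D := Algebra.TensorProduct.map (Gr.degreeZeroAlg k H) (Gr.degreeZeroAlg k H)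
  obtain ⟨P, hP, hPR⟩ := hE.exists_presentation Gr.isGradedHopf Gr.grading_succ_le
    (Gr.isUniversalRMatrix hR) (Gr.map_degreeZero_mem R) (Gr.map_degreeZero_mem R')
    (((map_mul D R R').symm.trans (congrArg D h₁)).trans (map_one D))
    (((map_mul D R' R).symm.trans (congrArg D h₂)).trans (map_one D)) hN
  exact ⟨Gr.isGradedHopf, Gr.isUniversalRMatrix hR, G, _, _, _, ⟨P, hP, hPR⟩,
    fun G' _ _ S' ⟨P'⟩ => P.quiverIsomorphic P', fun G' _ _ S' P' hP' =>
      QuiverPresentation.exists_mulEquiv hP hP'⟩
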